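/- Let $\mathsf K$ be one of the following four kinds of algebras: Pinter's substitution algebras $\mathsf{Sc}$ (operators $\mathsf c_i,\mathsf s_{[i/j]}$), quasi-polyadic algebras $\mathsf{QA}$ (operators $\mathsf c_i,\mathsf s_{[i/j]},\mathsf s_{[i,j]}$; in finite dimension these are the polyadic algebras $\mathsf{PA}$), cylindric algebras $\mathsf{CA}$ (operators $\mathsf c_i,\mathsf d_{ij}$), quasi-polyadic equality algebras $\mathsf{QEA}$ (operators $\mathsf c_i,\mathsf s_{[i/j]},\mathsf s_{[i,j]},\mathsf d_{ij}$; in finite dimension these are the polyadic equality algebras $\mathsf{PEA}$). $\mathsf K_\alpha$ is the class of such algebras of dimension $\alpha$. For finite $n$, $\mathsf{Nr}_n\mathsf K_\omega$ is the class of (isomorphic copies of) neat reducts $\mathsf{Nr}_n\mathfrak C=\{c\in\mathfrak C:\mathsf c_i c=c\text{ for all } i\ge n\}$, with the operations of index $<n$, of algebras $\mathfrak C\in\mathsf K_\omega$. For a class $\mathsf L$, $\mathfrak A\in\mathbf S_c\mathsf L$ means that $\mathfrak A$ is isomorphic to a subalgebra $\mathfrak A'$ of some $\mathfrak B\in\mathsf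 L$ such that for all $X\subseteq \mathfrak A'$, $\sum^{\mathfrak A'}X=1$ implies $\sum^{\mathfrak B}X=1$; $\mathbf{Up}\,\mathsf L$ is the class of ultraproducts of members of $\mathsf L$, and $\mathbf{Ur}\,\mathsf L$ the class of algebras having an ultrapower in $\mathsf L$. $\mathsf{RK}_n$, the class of representable algebras, consists of the algebras embeddable into a product of full set algebras with units ${}^nU$, $U$ a set. $\mathsf{CRK}_n$, the class of completely representable algebras, consists of the algebras $\mathfrak A$ with an embedding $f:\mathfrak A\to\wp(V)$, where $V=\bigcup_{i\in I}{}^nU_i$ with $I\ne\emptyset$ and the $U_i$ nonempty and pairwise disjoint, such that $f(\prod X)=\bigcap f[X]$ for every $X\subseteq\mathfrak A$ for which $\prod X$ exists. An algebra is completely additive if its non-Boolean operators distribute over all existing joins. An atomic completely additive algebra $\mathfrak A$ is strongly representable if $\mathfrak{Cm}\,\mathfrak{At}\,\mathfrak A$, the complex algebra of its atom structure, is in $\mathsf{RK}_n$. Then: 1. For every finite $n>2$ there is an uncountable, atomic, completely additive algebra in $\mathsf{Nr}_n\mathsf K_\omega$ that is not completely representable; in particular $\mathsf{Nr}_n\mathsf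 K_\omega\nsubseteq\mathsf{CRK}_n$. 2. For every finite $n>1$ there is a countable algebra in $\mathsf{CRK}_n$ (hence strongly representable) that is not in $\mathbf{UpUr}\,\mathsf{Nr}_n\mathsf K_\omega$; in particular it is not in $\mathsf{Nr}_n\mathsf K_\omega$. 3. For every finite $n$, every atomic and completely additive $\mathfrak A\in\mathbf S_c\mathsf{Nr}_n\mathsf K_\omega$ is strongly representable. -/

import Mathlib

universe u

namespace AlgLogic

/-- The four kinds of algebras between Pinter's substitution algebras and polyadic equality
algebras: `Sc` (substitution), `QA` (quasi-polyadic), `CA` (cylindric), `QEA` (quasi-polyadic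
equality).  In finite dimension `QA` and `QEA` are the polyadic (equality) algebras. -/
inductive Kind
  | Sc
  | QA
  | CA
  | QEA

namespace Kind

/-- Are the replacement operators `s_[i/j]` in the signature? -/
def hasSub : Kind → Bool
  | Sc => true
  | QA => true
  | CA => false
  | QEA => true

/-- Are the transposition operators `s_[i,j]` in the signature? -/
def hasSwap : Kind → Bool
  | Sc => false
  | QA => true
  | CA => false
  | QEA => true

/-- Are the diagonal constants `d_ij` in the signature? -/
def hasDiag : Kind → Bool
  | Sc => false
  | QA => false
  | CA => true
  | QEA => true

end Kind

/-- Symbols for the unary non-Boolean operators of kind `K` in dimension `α`. -/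
inductive UnOp (K : Kind) (α : Type) : Type
  | cyl (i : α) : UnOp K α
  | sub (h : K.hasSub = true) (i j : α) : UnOp K α
  | swap (h : K.hasSwap = true) (i j : α) : UnOp K α

/-- Symbols for the non-Boolean constants of kind `K` in dimension `α`. -/
inductive Cst (K : Kind) (α : Type) : Type
  | diag (h : K.hasDiag = true) (i j : α) : Cst K α

/-- Renaming of the indices of operators. -/
def UnOp.map {K : Kind} {α β : Type} (e : α → β) : UnOp K α → UnOp K β
  | .cyl i => .cyl (e i)
  | .sub h i j => .sub h (e i) (e j)
  | .swap h i j => .swap h (e i) (e j)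

/-- Renaming of the indices of constants. -/
def Cst.map {K : Kind} {α β : Type} (e : α → β) : Cst K α → Cst K β
  | .diag h i j => .diag h (e i) (e j)

/-- A Boolean algebra with further operations, of the signature of kind `K` in dimension `α`
(no equations on the further operations are imposed here; see `Alg.InK`). -/
structure Alg (K : Kind) (α : Type) : Type (u + 1) where
  carrier : Type u
  [ba : BooleanAlgebra carrier]
  un : UnOp K α → carrier → carrier
  cst : Cst K α → carrier

attribute [instance] Alg.ba

instance {K : Kind} {α : Type} : CoeSort (Alg.{u} K α) (Type u) := ⟨Alg.carrier⟩

/-- The replacement `[i/j]`: it sends `i` to `j` and fixes everything else. -/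
def repl {α : Type} [DecidableEq α] (i j : α) : α → α := Function.update id i j

namespace Alg

variable {K : Kind} {α : Type}

/-- The cylindrifier `c_i`. -/
def cyl (A : Alg.{u} K α) (i : α) : A → A := A.un (.cyl i)

/-- The replacement operator `s_[i/j]`. -/
def sub (A : Alg.{u} K α) (h : K.hasSub = true) (i j : α) : A → A := A.un (.sub h i j)

/-- The transposition operator `s_[i,j]`. -/
def swap (A : Alg.{u} K α) (h : K.hasSwap = true) (i j : α) : A → A := A.un (.swap h i j)

/-- The diagonal element `d_ij`. -/
def diag (A : Alg.{u} K α) (h : K.hasDiag = true) (i j : α) : A := A.cst (.diag h i j)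

/-- `g` is an endomorphism of the Boolean algebra `B`. -/
def IsBoolEnd {B : Type u} [BooleanAlgebra B] (g : B → B) : Prop :=
  (∀ x y, g (x ⊔ y) = g x ⊔ g y) ∧ (∀ x, g xᶜ = (g x)ᶜ)

/-- The laws of the cylindrifiers: commuting quantifiers. -/
structure CylLaws (A : Alg.{u} K α) : Prop where
  cyl_bot : ∀ i, A.cyl i ⊥ = ⊥
  le_cyl : ∀ i x, x ≤ A.cyl i x
  cyl_inf_cyl : ∀ i x y, A.cyl i (x ⊓ A.cyl i y) = A.cyl i x ⊓ A.cyl i y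
  cyl_comm : ∀ i j x, A.cyl i (A.cyl j x) = A.cyl j (A.cyl i x)

/-- Pinter's laws for the replacement operators. -/
structure SubLaws (A : Alg.{u} K α) (h : K.hasSub = true) : Prop where
  sub_self : ∀ i x, A.sub h i i x = x
  sub_end : ∀ i j, IsBoolEnd (A.sub h i j)
  sub_cyl : ∀ i j x, A.sub h i j (A.cyl i x) = A.cyl i x
  cyl_sub : ∀ i j x, i ≠ j → A.cyl i (A.sub h i j x) = A.sub h i j x
  sub_cyl_comm : ∀ i j k x, k ≠ i → k ≠ j →
    A.sub h i j (A.cyl k x) = A.cyl k (A.sub h i j x)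
  cyl_sub_symm : ∀ i j x, A.cyl i (A.sub h j i x) = A.cyl j (A.sub h i j x)
  sub_sub_comm : ∀ i j k l x, i ≠ k → i ≠ l → k ≠ j →
    A.sub h i j (A.sub h k l x) = A.sub h k l (A.sub h i j x)
  sub_sub : ∀ i j k x, A.sub h i j (A.sub h k i x) = A.sub h i j (A.sub h k j x)

/-- The laws for the transposition operators (the schema of Sain and Thompson, together with
the laws for conjugation by a transposition, which hold in every quasi-polyadic algebra). -/
structure SwapLaws [DecidableEq α] (A : Alg.{u} K α) (hs : K.hasSub = true)
    (h : K.hasSwap = true) : Prop where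
  swap_self : ∀ i x, A.swap h i i x = x
  swap_symm : ∀ i j x, A.swap h i j x = A.swap h j i x
  swap_end : ∀ i j, IsBoolEnd (A.swap h i j)
  swap_swap : ∀ i j x, A.swap h i j (A.swap h i j x) = x
  swap_braid : ∀ i j k x, i ≠ j → i ≠ k → j ≠ k →
    A.swap h i j (A.swap h i k x) = A.swap h j k (A.swap h i j x)
  swap_sub : ∀ i j x, A.swap h i j (A.sub hs i j x) = A.sub hs j i x
  swap_conj_cyl : ∀ i j k x,
    A.swap h i j (A.cyl k x) = A.cyl (Equiv.swap i j k) (A.swap h i j x)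
  swap_conj_sub : ∀ i j k l x, A.swap h i j (A.sub hs k l x)
    = A.sub hs (Equiv.swap i j k) (Equiv.swap i j l) (A.swap h i j x)

/-- The laws for the diagonals of a cylindric algebra. -/
structure DiagLawsCA (A : Alg.{u} K α) (h : K.hasDiag = true) : Prop where
  diag_self : ∀ i, A.diag h i i = ⊤
  diag_cyl : ∀ i j k, k ≠ i → k ≠ j → A.diag h i j = A.cyl k (A.diag h i k ⊓ A.diag h k j)
  diag_disj : ∀ i j x, i ≠ j →
    A.cyl i (A.diag h i j ⊓ x) ⊓ A.cyl i (A.diag h i j ⊓ xᶜ) = ⊥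

/-- The laws for the diagonals of a quasi-polyadic equality algebra. -/
structure DiagLawsQEA (A : Alg.{u} K α) (hs : K.hasSub = true) (h : K.hasDiag = true) :
    Prop where
  sub_diag : ∀ i j, A.sub hs i j (A.diag h i j) = ⊤
  inf_diag_le : ∀ i j x, x ⊓ A.diag h i j ≤ A.sub hs i j x

/-- Membership in the variety `K_α`. -/
def InK [DecidableEq α] : {K : Kind} → Alg.{u} K α → Prop
  | .Sc, A => A.CylLaws ∧ A.SubLaws rfl
  | .QA, A => A.CylLaws ∧ A.SubLaws rfl ∧ A.SwapLaws rfl rfl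
  | .CA, A => A.CylLaws ∧ A.DiagLawsCA rfl
  | .QEA, A => A.CylLaws ∧ A.SubLaws rfl ∧ A.SwapLaws rfl rfl ∧ A.DiagLawsQEA rfl rfl

/-- Homomorphisms of algebras of the same signature. -/
structure IsHom (A B : Alg.{u} K α) (f : A → B) : Prop where
  map_sup : ∀ x y, f (x ⊔ y) = f x ⊔ f y
  map_inf : ∀ x y, f (x ⊓ y) = f x ⊓ f y
  map_compl : ∀ x, f xᶜ = (f x)ᶜ
  map_bot : f ⊥ = ⊥
  map_top : f ⊤ = ⊤
  map_un : ∀ o x, f (A.un o x) = B.un o (f x)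
  map_cst : ∀ d, f (A.cst d) = B.cst d

/-- The direct product of a family of algebras. -/
def pi {I : Type u} (F : I → Alg.{u} K α) : Alg.{u} K α where
  carrier := ∀ i, F i
  un o x := fun i => (F i).un o (x i)
  cst d := fun i => (F i).cst d

/-- The reduct obtained from a `β`-dimensional algebra by keeping only the operations whose
indices come from `α` along `e`. -/
def rd {β : Type} (e : α → β) (C : Alg.{u} K β) : Alg.{u} K α where
  carrier := C
  un o := C.un (o.map e)
  cst d := C.cst (d.map e)

/-- The operators of `A` distribute over all joins that exist in `A`. -/
def CompletelyAdditive (A : Alg.{u} K α) : Prop :=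
  ∀ (o : UnOp K α) (X : Set A) (s : A), IsLUB X s → IsLUB (A.un o '' X) (A.un o s)

end Alg

/-! ### Neat reducts, complete subalgebras, ultraproducts and ultraroots -/

/-- The universe of the neat reduct to `n` dimensions of an `ω`-dimensional algebra. -/
def neatSet {K : Kind} (n : ℕ) (C : Alg.{u} K ℕ) : Set C :=
  {c | ∀ i, n ≤ i → C.cyl i c = c}

/-- `Nr_n K_ω`: the algebras isomorphic to the neat reduct `Nr_n C` of some `C ∈ K_ω`. -/
def NrOmega (K : Kind) (n : ℕ) : Set (Alg.{u} K (Fin n)) :=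
  {A | ∃ C : Alg.{u} K ℕ, C.InK ∧ ∃ f : A → C,
    Alg.IsHom A (C.rd Fin.val) f ∧ Function.Injective f ∧ Set.range f = neatSet n C}

section Operations

variable {K : Kind} {α : Type}

/-- `S_c L`: the algebras isomorphic to a complete subalgebra of a member of `L`, that is, to
a subalgebra `A ⊆ B` such that `∑ X = 1` in `A` implies `∑ X = 1` in `B` for all `X ⊆ A`. -/
def CompleteSub (L : Set (Alg.{u} K α)) : Set (Alg.{u} K α) :=
  {A | ∃ B ∈ L, ∃ f : A → B, Alg.IsHom A B f ∧ Function.Injective f ∧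
    ∀ X : Set A, IsLUB X ⊤ → IsLUB (f '' X) ⊤}

/-- `B` is (isomorphic to) the ultraproduct of the family `F` modulo `U`: it is the quotient of
the direct product by equality on a set in `U`. -/
def IsUltraproduct {I : Type u} (U : Ultrafilter I) (F : I → Alg.{u} K α)
    (B : Alg.{u} K α) : Prop :=
  ∃ q : Alg.pi F → B, Alg.IsHom (Alg.pi F) B q ∧ Function.Surjective q ∧
    ∀ x y : (∀ i, F i), q x = q y ↔ ∀ᶠ i in (U : Filter I), x i = y i

/-- `Up L`: the ultraproducts of members of `L`. -/
def Up (L : Set (Alg.{u} K α)) : Set (Alg.{u} K α) :=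
  {B | ∃ (I : Type u) (U : Ultrafilter I) (F : I → Alg.{u} K α),
    (∀ i, F i ∈ L) ∧ IsUltraproduct U F B}

/-- `Ur L`: the algebras some ultrapower of which is in `L`. -/
def Ur (L : Set (Alg.{u} K α)) : Set (Alg.{u} K α) :=
  {A | ∃ (I : Type u) (U : Ultrafilter I), ∃ B ∈ L, IsUltraproduct U (fun _ => A) B}

end Operations

/-! ### Set algebras and representations -/

section Representations

variable {K : Kind} {α : Type} [DecidableEq α]

/-- The full set algebra with unit `^α U`. -/
def fullSetAlg (K : Kind) (α : Type) [DecidableEq α] (U : Type u) : Alg.{u} K α where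
  carrier := Set (α → U)
  un
    | .cyl i, X => {s | ∃ t ∈ X, ∀ j, j ≠ i → t j = s j}
    | .sub _ i j, X => {s | s ∘ repl i j ∈ X}
    | .swap _ i j, X => {s | s ∘ Equiv.swap i j ∈ X}
  cst
    | .diag _ i j => {s | s i = s j}

/-- `RK_α`: the algebras embeddable into a product of full set algebras. -/
def RK (K : Kind) (α : Type) [DecidableEq α] : Set (Alg.{u} K α) :=
  {A | ∃ (I : Type u) (U : I → Type u) (f : A → Alg.pi fun i => fullSetAlg K α (U i)),
    Alg.IsHom A (Alg.pi fun i => fullSetAlg K α (U i)) f ∧ Function.Injective f}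

/-- The set `⋃ i, ^α (U i)` of sequences. -/
def genSpace (α : Type) {M I : Type u} (U : I → Set M) : Set (α → M) :=
  {s | ∃ i, ∀ k, s k ∈ U i}

/-- The sequence `s ∘ τ`. -/
def genSpace.comp {M I : Type u} {U : I → Set M} (s : genSpace α U) (τ : α → α) :
    genSpace α U :=
  ⟨s.1 ∘ τ, s.2.imp fun _ h k => h (τ k)⟩

/-- The algebra of all subsets of `⋃ i, ^α (U i)`. -/
def genSetAlg (K : Kind) (α : Type) [DecidableEq α] {M I : Type u} (U : I → Set M) :
    Alg.{u} K α where
  carrier := Set (genSpace α U)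
  un
    | .cyl i, X => {s | ∃ t ∈ X, ∀ j, j ≠ i → t.1 j = s.1 j}
    | .sub _ i j, X => {s | genSpace.comp s (repl i j) ∈ X}
    | .swap _ i j, X => {s | genSpace.comp s (Equiv.swap i j) ∈ X}
  cst
    | .diag _ i j => {s | s.1 i = s.1 j}

/-- `CRK_α`: the algebras with a complete representation, that is, an embedding `f` into the
algebra of all subsets of a generalized space (a nonempty union of the sets `^α (U i)` for
nonempty, pairwise disjoint `U i`) such that `f (∏ X) = ⋂ f[X]` whenever `∏ X` is defined. -/
def CRK (K : Kind) (α : Type) [DecidableEq α] : Set (Alg.{u} K α) :=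
  {A | ∃ (M I : Type u) (U : I → Set M), Nonempty I ∧ (∀ i, (U i).Nonempty) ∧
    (∀ i j, i ≠ j → Disjoint (U i) (U j)) ∧
    ∃ f : A → Set (genSpace α U), Alg.IsHom A (genSetAlg K α U) f ∧ Function.Injective f ∧
      ∀ (X : Set A) (p : A), IsGLB X p → f p = ⋂ x ∈ X, f x}

end Representations

/-! ### Atom structures and complex algebras -/

section AtomStructures

variable {K : Kind} {α : Type}

/-- Relational structures of the type dual to `K` in dimension `α`. -/
structure AtStr (K : Kind) (α : Type) : Type (u + 1) where
  carrier : Type u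
  rel : UnOp K α → carrier → carrier → Prop
  pred : Cst K α → carrier → Prop

/-- The atom structure `At A`. -/
def At (A : Alg.{u} K α) : AtStr.{u} K α where
  carrier := {a : A // IsAtom a}
  rel o a b := a.1 ≤ A.un o b.1
  pred d a := a.1 ≤ A.cst d

/-- The complex algebra `Cm S`. -/
def Cm (S : AtStr.{u} K α) : Alg.{u} K α where
  carrier := Set S.carrier
  un o X := {a | ∃ b ∈ X, S.rel o a b}
  cst d := {a | S.pred d a}

/-- `A` is atomic and completely additive, and its completion `Cm At A` is representable. -/
def StronglyRepresentable [DecidableEq α] (A : Alg.{u} K α) : Prop :=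
  IsAtomic A ∧ A.CompletelyAdditive ∧ Cm (At A) ∈ RK K α

end AtomStructures

end AlgLogic

set_option linter.unusedSectionVars false

namespace AlgLogic

/-! ### Cylindrifiers -/

namespace Alg

namespace CylLaws

variable {K : Kind} {α : Type} {A : Alg.{u} K α} (hA : A.CylLaws)
include hA

/-! The three claims are independent, and each rests on its own construction.

Strong representability: let `A` sit completely inside the neat reduct of `C`. Dimension `n + k` of
`C` plays the role of a point `k`, so an `n`-tuple of points gives a substitution `s_t` on `C`. A
generic ultrafilter on the finite-dimensional elements labels each tuple `t` by the unique atom `b`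
with `s_t b` in it. It exists by the Rasiowa–Sikorski argument because only countably many families
have to be met. To keep them countable, witnesses are demanded only for finitely many sets of atoms
at a time (`exists_network`), and an ultraproduct of the resulting networks serves all sets at once
(`exists_hom_of_networks`). The density needed for the argument is `meetsAll_substAll`. Completeness
of the embedding gives it for injective tuples, and joins preserved by replacements give it for
tuples with repetitions.

Outside `UpUr Nr`: in a neat reduct, one spare dimension lets two elements be composed. The trace of
this on atoms determined by two projections is the first-order sentence `HasCompositions`, which
therefore passes to ultraproducts and ultraroots. It fails in a countable algebra of sets of integer
sequences with sorts, generated by the singletons, a sum relation and a negation relation. Their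
composition would be the hyperplane `∑ s k = 0` on the sequences with sorts `0, ..., n - 1`. On
those sequences every member of the algebra is decided by finite colourings that each ignore one
coordinate, and Gallai's theorem excludes the hyperplane (`not_isLowDim_hyperplane`). Since all
singletons are elements, the algebra is completely representable.

Not completely representable: points are branches of the binary tree, each with a colour from a set
`I`, and elements are the sets of sequences that see finitely many levels, colours and coordinates.
Homogeneity of the tree makes this a neat reduct. Sequences whose distinct entries lie on distinct
branches give the atoms. In a complete representation every tuple satisfies an atom, so points of
different colours separate at a finite level of the tree. A binary splitting process has at most
continuum many branches, so `I` injects into `Set ℕ`. This fails for `I = Set (Set ℕ)`. -/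

theorem cyl_cyl (i : α) (x : A) : A.cyl i (A.cyl i x) = A.cyl i x := by
  have h := hA.cyl_inf_cyl i ⊤ x
  have ht : A.cyl i ⊤ = ⊤ := top_le_iff.1 (hA.le_cyl i ⊤)
  simpa [ht] using h

theorem cyl_top (i : α) : A.cyl i ⊤ = ⊤ := top_le_iff.1 (hA.le_cyl i ⊤)

theorem cyl_mono (i : α) {x y : A} (h : x ≤ y) : A.cyl i x ≤ A.cyl i y := by
  have h1 : x ⊓ A.cyl i y = x := inf_eq_left.2 (h.trans (hA.le_cyl i y))
  have h2 := hA.cyl_inf_cyl i x y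
  rw [h1] at h2
  exact inf_eq_left.1 h2.symm

theorem cyl_eq_bot {i : α} {x : A} : A.cyl i x = ⊥ ↔ x = ⊥ :=
  ⟨fun h => le_bot_iff.1 (h ▸ hA.le_cyl i x), fun h => h ▸ hA.cyl_bot i⟩

theorem cyl_inf_of_closed {i : α} {x y : A} (hy : A.cyl i y = y) :
    A.cyl i (x ⊓ y) = A.cyl i x ⊓ y := by
  have := hA.cyl_inf_cyl i x y
  rwa [hy] at this

/-- Both sides say that `c_i x ⊓ c_i y` vanishes, so `c_i` is its own conjugate. Closure of closed
elements under complement and complete additivity of `c_i` come from this. -/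
theorem inf_cyl_eq_bot {i : α} {x y : A} : x ⊓ A.cyl i y = ⊥ ↔ A.cyl i x ⊓ y = ⊥ := by
  rw [← hA.cyl_eq_bot (i := i), hA.cyl_inf_cyl, inf_comm, ← hA.cyl_inf_cyl, hA.cyl_eq_bot,
    inf_comm]

theorem cyl_compl_closed {i : α} {x : A} (hx : A.cyl i x = x) : A.cyl i xᶜ = xᶜ := by
  refine le_antisymm ?_ (hA.le_cyl i _)
  rw [le_compl_iff_disjoint_right, disjoint_iff, inf_comm, hA.inf_cyl_eq_bot, hx, inf_compl_self]

theorem cyl_le_iff {i : α} {x y : A} (hy : A.cyl i y = y) : A.cyl i x ≤ y ↔ x ≤ y :=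
  ⟨(hA.le_cyl i x).trans, fun h => hy ▸ hA.cyl_mono i h⟩

theorem cyl_sup (i : α) (x y : A) : A.cyl i (x ⊔ y) = A.cyl i x ⊔ A.cyl i y := by
  refine le_antisymm ?_ (sup_le (hA.cyl_mono i le_sup_left) (hA.cyl_mono i le_sup_right))
  have hc : A.cyl i ((A.cyl i x)ᶜ ⊓ (A.cyl i y)ᶜ) = (A.cyl i x)ᶜ ⊓ (A.cyl i y)ᶜ := by
    rw [hA.cyl_inf_of_closed (hA.cyl_compl_closed (hA.cyl_cyl i y)),
      hA.cyl_compl_closed (hA.cyl_cyl i x)]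
  have hc' : A.cyl i (A.cyl i x ⊔ A.cyl i y) = A.cyl i x ⊔ A.cyl i y := by
    rw [← compl_sup] at hc
    simpa using hA.cyl_compl_closed hc
  rw [hA.cyl_le_iff hc']
  exact sup_le_sup (hA.le_cyl i x) (hA.le_cyl i y)

end CylLaws

end Alg

/-! ### Replacement operators in all four signatures -/

namespace Alg

section Subst

variable {K : Kind} {α : Type} [DecidableEq α]

/-- The replacement operator `s_[i/j]`, which is definable from the diagonals where it is not
in the signature. -/
def subst (A : Alg.{u} K α) (i j : α) (x : A) : A :=
  if h : K.hasSub = true then A.sub h i j x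
  else if h : K.hasDiag = true then (if i = j then x else A.cyl i (A.diag h i j ⊓ x))
  else x

theorem subst_eq_sub (A : Alg.{u} K α) (h : K.hasSub = true) (i j : α) (x : A) :
    A.subst i j x = A.sub h i j x := by
  simp [subst, h]

/-- Pinter's laws, for the derived replacement operators. -/
structure SubstLaws (A : Alg.{u} K α) : Prop extends A.CylLaws where
  subst_self : ∀ i x, A.subst i i x = x
  subst_sup : ∀ i j x y, A.subst i j (x ⊔ y) = A.subst i j x ⊔ A.subst i j y
  subst_compl : ∀ i j x, A.subst i j xᶜ = (A.subst i j x)ᶜ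
  subst_cyl : ∀ i j x, A.subst i j (A.cyl i x) = A.cyl i x
  cyl_subst : ∀ i j x, i ≠ j → A.cyl i (A.subst i j x) = A.subst i j x
  subst_cyl_comm : ∀ i j k x, k ≠ i → k ≠ j →
    A.subst i j (A.cyl k x) = A.cyl k (A.subst i j x)
  cyl_subst_symm : ∀ i j x, A.cyl i (A.subst j i x) = A.cyl j (A.subst i j x)
  subst_comm : ∀ i j k l x, i ≠ k → i ≠ l → k ≠ j →
    A.subst i j (A.subst k l x) = A.subst k l (A.subst i j x)
  subst_subst : ∀ i j k x, A.subst i j (A.subst k i x) = A.subst i j (A.subst k j x)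

/-- The two laws linking diagonals and replacements. -/
structure DiagSubstLaws (A : Alg.{u} K α) (h : K.hasDiag = true) : Prop where
  subst_diag : ∀ i j, A.subst i j (A.diag h i j) = ⊤
  inf_diag_le : ∀ i j x, x ⊓ A.diag h i j ≤ A.subst i j x


/-! ### Replacement operators of a cylindric algebra, defined from its diagonals -/

section CADiag

variable {A : Alg.{u} .CA α} (hA : A.CylLaws) (hd : A.DiagLawsCA rfl)
include hA hd

local notation "δ" => Alg.diag A rfl

theorem ca_cyl_diag {i j : α} (h : i ≠ j) : A.cyl i (δ i j ⊓ δ j i) = ⊤ := by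
  rw [inf_comm, ← hd.diag_cyl j j i h h, hd.diag_self]

theorem ca_cyl_diag_top (i j : α) : A.cyl i (δ i j) = ⊤ := by
  by_cases h : i = j
  · rw [h, hd.diag_self, hA.cyl_top]
  · exact top_le_iff.1 (ca_cyl_diag hA hd h ▸ hA.cyl_mono i inf_le_left)

/-- The law `diag_disj` is applied with `x = d_ji`: since `c_i (d_ij ⊓ d_ji) = ⊤`, the part of
`d_ij` outside `d_ji` must vanish. -/
theorem ca_diag_symm (i j : α) : δ i j = δ j i := by
  have key : ∀ i j : α, δ i j ≤ δ j i := by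
    intro i j
    by_cases h : i = j
    · rw [h]
    have := hd.diag_disj i j (δ j i) h
    rw [ca_cyl_diag hA hd h, top_inf_eq, hA.cyl_eq_bot] at this
    rwa [← disjoint_iff, disjoint_compl_right_iff] at this
  exact le_antisymm (key i j) (key j i)

theorem ca_diag_closed {i j k : α} (hi : k ≠ i) (hj : k ≠ j) : A.cyl k (δ i j) = δ i j := by
  rw [hd.diag_cyl i j k hi hj, hA.cyl_cyl]

theorem ca_diag_trans {i j k : α} (hi : j ≠ i) (hk : j ≠ k) : δ i j ⊓ δ j k ≤ δ i k := by
  rw [hd.diag_cyl i k j hi hk]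
  exact hA.le_cyl _ _

/-- Below `d_ij` cylindrification loses nothing, because `c_i (d_ij ⊓ x)` is disjoint from `d_ij ⊓
xᶜ`. -/
theorem ca_inf_cyl_diag {i j : α} (h : i ≠ j) (x : A) :
    δ i j ⊓ A.cyl i (δ i j ⊓ x) = δ i j ⊓ x := by
  refine le_antisymm (le_inf inf_le_left ?_) (le_inf inf_le_left (hA.le_cyl _ _))
  rw [← disjoint_compl_right_iff, disjoint_iff, inf_right_comm, inf_comm]
  exact le_bot_iff.1 ((inf_le_inf_left _ (hA.le_cyl i _)).trans (hd.diag_disj i j x h).le)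

theorem ca_subst {i j : α} (h : i ≠ j) (x : A) : A.subst i j x = A.cyl i (δ i j ⊓ x) := by
  simp [subst, Kind.hasSub, Kind.hasDiag, h]

theorem ca_substLaws : A.SubstLaws := by
  have hself : ∀ i (x : A), A.subst i i x = x := by
    intro i x; simp [subst, Kind.hasSub, Kind.hasDiag]
  have cyl_subst : ∀ i j (x : A), i ≠ j → A.cyl i (A.subst i j x) = A.subst i j x := by
    intro i j x h
    rw [ca_subst hA hd h, hA.cyl_cyl]
  have subst_closed : ∀ {i j : α} {x : A}, A.cyl i x = x → A.subst i j x = x := by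
    intro i j x hx
    by_cases h : i = j
    · subst h; exact hself _ _
    · rw [ca_subst hA hd h, hA.cyl_inf_of_closed hx, ca_cyl_diag_top hA hd, top_inf_eq]
  refine { hA with
    subst_self := hself
    subst_sup := ?_
    subst_compl := ?_
    subst_cyl := fun i j x => subst_closed (hA.cyl_cyl i x)
    cyl_subst := cyl_subst
    subst_cyl_comm := ?_
    cyl_subst_symm := ?_
    subst_comm := ?_
    subst_subst := ?_ }
  · intro i j x y
    by_cases h : i = j
    · subst h; simp only [hself]
    · simp only [ca_subst hA hd h, inf_sup_left, hA.cyl_sup]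
  · intro i j x
    by_cases h : i = j
    · subst h; simp only [hself]
    · simp only [ca_subst hA hd h]
      -- The two cylindrifications are disjoint by `diag_disj`, and their join is `c_i d_ij = ⊤`.
      refine (IsCompl.compl_eq ⟨?_, ?_⟩).symm
      · exact disjoint_iff.2 (hd.diag_disj i j x h)
      · rw [codisjoint_iff, ← hA.cyl_sup, ← inf_sup_left, sup_compl_eq_top, inf_top_eq,
          ca_cyl_diag_top hA hd]
  · intro i j k x hi hj
    by_cases h : i = j
    · subst h; simp only [hself]
    · rw [ca_subst hA hd h, ca_subst hA hd h, hA.cyl_comm k i, inf_comm,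
        ← hA.cyl_inf_of_closed (ca_diag_closed hA hd hi hj) (y := δ i j), inf_comm x]
  · intro i j x
    by_cases h : i = j
    · subst h; rfl
    · rw [ca_subst hA hd h, ca_subst hA hd (Ne.symm h), hA.cyl_comm, ca_diag_symm hA hd]
  · intro i j k l x hik hil hkj
    by_cases h : i = j
    · subst h; simp only [hself]
    by_cases h' : k = l
    · subst h'; simp only [hself]
    simp only [ca_subst hA hd h, ca_subst hA hd h']
    have e1 : δ i j ⊓ A.cyl k (δ k l ⊓ x) = A.cyl k (δ i j ⊓ (δ k l ⊓ x)) := by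
      rw [inf_comm, ← hA.cyl_inf_of_closed (ca_diag_closed hA hd hik.symm hkj), inf_comm]
    have e2 : δ k l ⊓ A.cyl i (δ i j ⊓ x) = A.cyl i (δ k l ⊓ (δ i j ⊓ x)) := by
      rw [inf_comm, ← hA.cyl_inf_of_closed (ca_diag_closed hA hd hik hil), inf_comm]
    rw [e1, e2, hA.cyl_comm, inf_left_comm]
  · intro i j k x
    by_cases h : i = j
    · subst h; rfl
    by_cases hk : k = i
    · subst hk
      rw [hself, subst_closed (cyl_subst _ _ _ h)]
    by_cases hkj : k = j
    · subst hkj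
      rw [hself, ca_subst hA hd h, ca_subst hA hd hk, ca_subst hA hd h, ca_diag_symm hA hd i k,
        ca_inf_cyl_diag hA hd hk]
    simp only [ca_subst hA hd h, ca_subst hA hd hk, ca_subst hA hd hkj]
    have e : ∀ y : A, δ i j ⊓ A.cyl k y = A.cyl k (δ i j ⊓ y) := by
      intro y
      rw [inf_comm, ← hA.cyl_inf_of_closed (ca_diag_closed hA hd hk hkj), inf_comm]
    -- With `d_ij` moved under `c_k`, the law reduces to `d_ij ⊓ d_ki = d_ij ⊓ d_kj`.
    rw [e, e, ← inf_assoc, ← inf_assoc]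
    congr 3
    refine le_antisymm (le_inf inf_le_left ?_) (le_inf inf_le_left ?_)
    · rw [inf_comm]; exact ca_diag_trans hA hd (Ne.symm hk) h
    · rw [ca_diag_symm hA hd i j, inf_comm]
      exact ca_diag_trans hA hd (Ne.symm hkj) (Ne.symm h)

theorem ca_diagSubstLaws : A.DiagSubstLaws rfl where
  subst_diag i j := by
    by_cases h : i = j
    · subst h; rw [hd.diag_self, subst]; simp [Kind.hasSub, Kind.hasDiag]
    · rw [ca_subst hA hd h, inf_idem, ca_cyl_diag_top hA hd]
  inf_diag_le i j x := by
    by_cases h : i = j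
    · subst h; simp [subst, Kind.hasSub, Kind.hasDiag]
    · rw [ca_subst hA hd h, inf_comm]; exact hA.le_cyl _ _

end CADiag

theorem CylLaws.substLaws {A : Alg.{u} K α} (hA : A.CylLaws) {h : K.hasSub = true}
    (hs : A.SubLaws h) : A.SubstLaws := by
  have e : A.subst = A.sub h := by
    funext i j x; exact A.subst_eq_sub h i j x
  refine { hA with
    subst_self := ?_, subst_sup := ?_, subst_compl := ?_, subst_cyl := ?_, cyl_subst := ?_,
    subst_cyl_comm := ?_, cyl_subst_symm := ?_, subst_comm := ?_, subst_subst := ?_ } <;> rw [e]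
  · exact hs.sub_self
  · exact fun i j => (hs.sub_end i j).1
  · exact fun i j => (hs.sub_end i j).2
  · exact hs.sub_cyl
  · exact hs.cyl_sub
  · exact hs.sub_cyl_comm
  · exact hs.cyl_sub_symm
  · exact hs.sub_sub_comm
  · exact hs.sub_sub

/-- The four signatures merge here: what follows mostly uses these laws, with the laws of diagonals
and transpositions where those exist, instead of the separate axiom systems. -/
theorem InK.substLaws : ∀ {K : Kind} {A : Alg.{u} K α}, A.InK → A.SubstLaws
  | .Sc, _, h => h.1.substLaws h.2
  | .QA, _, h => h.1.substLaws h.2.1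
  | .CA, _, h => ca_substLaws h.1 h.2
  | .QEA, _, h => h.1.substLaws h.2.1

theorem InK.diagSubstLaws : ∀ {K : Kind} {A : Alg.{u} K α}, A.InK → ∀ h : K.hasDiag = true,
    A.DiagSubstLaws h
  | .CA, _, hA, _ => ca_diagSubstLaws hA.1 hA.2
  | .QEA, A, hA, _ =>
    { subst_diag := fun i j => by
        rw [A.subst_eq_sub rfl]; exact hA.2.2.2.sub_diag i j
      inf_diag_le := fun i j x => by
        rw [A.subst_eq_sub rfl]; exact hA.2.2.2.inf_diag_le i j x }
  | .Sc, _, _, h => absurd h (by simp [Kind.hasDiag])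
  | .QA, _, _, h => absurd h (by simp [Kind.hasDiag])

theorem InK.swapLaws : ∀ {K : Kind} {A : Alg.{u} K α}, A.InK → ∀ h : K.hasSwap = true,
    ∃ hs : K.hasSub = true, A.SwapLaws hs h
  | .QA, _, hA, _ => ⟨rfl, hA.2.2⟩
  | .QEA, _, hA, _ => ⟨rfl, hA.2.2.1⟩
  | .Sc, _, _, h => absurd h (by simp [Kind.hasSwap])
  | .CA, _, _, h => absurd h (by simp [Kind.hasSwap])

end Subst

end Alg

theorem repl_self {α : Type} [DecidableEq α] (i : α) : repl i i = id :=
  Function.update_eq_self i id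

namespace Alg

section

variable {K : Kind} {α : Type} [DecidableEq α] {A : Alg.{u} K α}

/-! ### Consequences of Pinter's laws -/

namespace SubstLaws

variable (hA : A.SubstLaws)
include hA

theorem subst_inf (i j : α) (x y : A) : A.subst i j (x ⊓ y) = A.subst i j x ⊓ A.subst i j y := by
  rw [← compl_compl (x ⊓ y), compl_inf, hA.subst_compl, hA.subst_sup, hA.subst_compl,
    hA.subst_compl, compl_sup, compl_compl, compl_compl]

theorem subst_bot (i j : α) : A.subst i j ⊥ = ⊥ := by
  have := hA.subst_inf i j ⊥ ⊥ᶜ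
  rwa [hA.subst_compl, inf_compl_self, inf_compl_self] at this

theorem subst_top (i j : α) : A.subst i j ⊤ = ⊤ := by
  rw [← compl_bot, hA.subst_compl, hA.subst_bot]

theorem subst_mono (i j : α) {x y : A} (h : x ≤ y) : A.subst i j x ≤ A.subst i j y := by
  rw [← inf_eq_left, ← hA.subst_inf, inf_eq_left.2 h]

theorem subst_of_closed {i j : α} {x : A} (h : A.cyl i x = x) : A.subst i j x = x := by
  rw [← h, hA.subst_cyl]

theorem closed_subst {i j k : α} {x : A} (hi : k ≠ i) (hj : k ≠ j) (h : A.cyl k x = x) :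
    A.cyl k (A.subst i j x) = A.subst i j x := by
  rw [← hA.subst_cyl_comm i j k x hi hj, h]

theorem closed_cyl {i k : α} {x : A} (h : A.cyl k x = x) :
    A.cyl k (A.cyl i x) = A.cyl i x := by
  rw [hA.cyl_comm, h]

theorem closed_inf {k : α} {x y : A} (hx : A.cyl k x = x) (hy : A.cyl k y = y) :
    A.cyl k (x ⊓ y) = x ⊓ y := by
  rw [hA.cyl_inf_of_closed hy, hx]

theorem subst_cancel {i j : α} {x : A} (h : A.cyl j x = x) :
    A.subst j i (A.subst i j x) = x := by
  rw [hA.subst_subst, hA.subst_self, hA.subst_of_closed h]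

/-- Renaming of a bound variable. -/
theorem cyl_subst_fresh {i k : α} {x : A} (h : A.cyl k x = x) :
    A.cyl k (A.subst i k x) = A.cyl i x := by
  rw [hA.cyl_subst_symm, hA.subst_of_closed h]

end SubstLaws

/-- Conjugation by the transposition carries the right side to the left side. The right side depends
on neither `i` nor `j`, and a transposition fixes such an element: `s_[i,j] s_[i/j] = s_[j/i]`, and
both replacements leave it alone. -/
theorem swap_subst_subst (hA : A.InK) (h : K.hasSwap = true) {i j k l : α} (hij : i ≠ j)
    (hik : k ≠ i) (hil : l ≠ i) (hjk : k ≠ j) (hjl : l ≠ j) (x : A) :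
    A.subst j k (A.subst i l (A.swap h i j x)) = A.subst i k (A.subst j l x) := by
  obtain ⟨hs, hw⟩ := hA.swapLaws h
  have hL := hA.substLaws
  have e : ∀ a b (y : A), A.subst a b y = A.sub hs a b y := A.subst_eq_sub hs
  have h1 : A.swap h i j (A.subst i k (A.subst j l x))
      = A.subst j k (A.subst i l (A.swap h i j x)) := by
    simp only [e]
    rw [hw.swap_conj_sub, hw.swap_conj_sub, Equiv.swap_apply_left, Equiv.swap_apply_right,
      Equiv.swap_apply_of_ne_of_ne hik hjk, Equiv.swap_apply_of_ne_of_ne hil hjl]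
  have hci : A.cyl i (A.subst i k (A.subst j l x)) = A.subst i k (A.subst j l x) :=
    hL.cyl_subst _ _ _ hik.symm
  have hcj : A.cyl j (A.subst i k (A.subst j l x)) = A.subst i k (A.subst j l x) :=
    hL.closed_subst hij.symm hjk.symm (hL.cyl_subst _ _ _ hjl.symm)
  rw [← h1]
  conv_lhs => rw [← hL.subst_of_closed (j := j) hci, e, hw.swap_sub, ← e]
  exact hL.subst_of_closed hcj

/-! ### Laws of equality derived from `DiagSubstLaws` -/

section Diag

variable {h : K.hasDiag = true} (hA : A.SubstLaws) (hd : A.DiagSubstLaws h)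
include hA hd

theorem diag_self (i : α) : A.diag h i i = ⊤ := by
  rw [← hd.subst_diag i i, hA.subst_self]

theorem subst_diag_symm (i j : α) : A.subst i j (A.diag h j i) = ⊤ := by
  have := congrArg (A.subst i j) (hd.subst_diag j i)
  rwa [hA.subst_subst, hA.subst_self, hA.subst_top] at this

theorem diag_symm (i j : α) : A.diag h i j = A.diag h j i := by
  have key : ∀ i j, A.diag h i j ≤ A.diag h j i := by
    intro i j
    have := hd.inf_diag_le i j (A.diag h j i)ᶜ
    rw [hA.subst_compl, subst_diag_symm hA hd, compl_top, le_bot_iff, inf_comm,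
      ← disjoint_iff, disjoint_compl_right_iff] at this
    exact this
  exact le_antisymm (key i j) (key j i)

theorem diag_inf_subst_le (i j : α) (x : A) : A.subst i j x ⊓ A.diag h i j ≤ x := by
  have := hd.inf_diag_le i j xᶜ
  rw [hA.subst_compl, le_compl_iff_disjoint_right, disjoint_iff] at this
  rw [← disjoint_compl_right_iff, disjoint_iff, ← this]
  ac_rfl

theorem diag_le_subst_diag (i j k : α) : A.diag h j k ≤ A.subst i j (A.diag h i k) := by
  have := hd.inf_diag_le j k (A.subst i j (A.diag h i k))ᶜ
  rw [hA.subst_compl, hA.subst_subst, hd.subst_diag, hA.subst_top, compl_top, le_bot_iff,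
    inf_comm, ← disjoint_iff, disjoint_compl_right_iff] at this
  exact this

theorem diag_trans (i j k : α) : A.diag h i j ⊓ A.diag h j k ≤ A.diag h i k := by
  refine le_trans ?_ (diag_inf_subst_le hA hd i j _)
  rw [inf_comm]
  exact inf_le_inf_right _ (diag_le_subst_diag hA hd i j k)

/-- Since `s_[i/j]` sends `d_ij` to `⊤`, it annihilates `c_k` of the complement of `d_ij`. By
`inf_diag_le` that cylindrification is then disjoint from `d_ij`, so the complement is closed and
with it `d_ij`. -/
theorem diag_closed {i j k : α} (hi : k ≠ i) (hj : k ≠ j) :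
    A.cyl k (A.diag h i j) = A.diag h i j := by
  have h1 : A.subst i j (A.cyl k (A.diag h i j)ᶜ) = ⊥ := by
    rw [hA.subst_cyl_comm _ _ _ _ hi hj, hA.subst_compl, hd.subst_diag, compl_top, hA.cyl_bot]
  have h2 := hd.inf_diag_le i j (A.cyl k (A.diag h i j)ᶜ)
  rw [h1, le_bot_iff, ← disjoint_iff, ← le_compl_iff_disjoint_right] at h2
  simpa using hA.cyl_compl_closed (le_antisymm h2 (hA.le_cyl _ _))

theorem subst_diag_eq {i j k : α} (hj : i ≠ j) (hk : i ≠ k) :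
    A.subst i j (A.diag h i k) = A.diag h j k := by
  refine le_antisymm ?_ (diag_le_subst_diag hA hd i j k)
  have h1 := hA.subst_mono i j (diag_trans hA hd j i k)
  rw [hA.subst_inf, subst_diag_symm hA hd |> fun _ => diag_symm hA hd j i, hd.subst_diag,
    top_inf_eq, hA.subst_of_closed (diag_closed hA hd hj hk)] at h1
  exact h1

theorem cyl_diag (i j : α) : A.cyl i (A.diag h i j) = ⊤ := by
  have := hA.subst_mono i j (hA.le_cyl i (A.diag h i j))
  rwa [hd.subst_diag, hA.subst_cyl, top_le_iff] at this

/-- With the extra factor `d_ik` this is transitivity of equality. Nothing else involves the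
dimension `i`, so applying `c_i` removes the factor, as `c_i d_ik = ⊤`. -/
theorem subst_inf_diag_le_subst {i k l : α} (hk : i ≠ k) (hl : i ≠ l) (x : A) :
    A.subst i k x ⊓ A.diag h k l ≤ A.subst i l x := by
  have h1 : A.diag h i k ⊓ (A.subst i k x ⊓ A.diag h k l) ≤ A.subst i l x := by
    refine le_trans (le_inf (le_trans ?_ (diag_inf_subst_le hA hd i k x))
      (le_trans ?_ (diag_trans hA hd i k l))) (hd.inf_diag_le i l x)
    · rw [inf_comm]; exact inf_le_inf_right _ inf_le_left
    · exact inf_le_inf_left _ inf_le_right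
  have h2 := hA.cyl_mono i h1
  rwa [hA.cyl_subst _ _ _ hl, hA.cyl_inf_of_closed, cyl_diag hA hd, top_inf_eq] at h2
  exact hA.closed_inf (hA.cyl_subst _ _ _ hk) (diag_closed hA hd hk hl)

end Diag

end

/-! ### Simultaneous substitutions -/

section SubstAll

variable {K : Kind} {C : Alg.{u} K ℕ} {n : ℕ}

/-- The composition of the replacements `s_[i/t i]`, for `i` in the list `L`. -/
def substList (C : Alg.{u} K ℕ) (t : Fin n → ℕ) (L : List (Fin n)) (x : C) : C :=
  L.foldr (fun (i : Fin n) y => C.subst i (t i) y) x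

/-- The substitution of `t i` for `i`, for all `i < n`. -/
def substAll (C : Alg.{u} K ℕ) (t : Fin n → ℕ) (x : C) : C :=
  C.substList t (List.finRange n) x

theorem substList_cons (t : Fin n → ℕ) (i : Fin n) (L : List (Fin n)) (x : C) :
    C.substList t (i :: L) x = C.subst i (t i) (C.substList t L x) := rfl

theorem substList_append (t : Fin n → ℕ) (L L' : List (Fin n)) (x : C) :
    C.substList t (L ++ L') x = C.substList t L (C.substList t L' x) := by
  simp [substList, List.foldr_append]

theorem substList_congr {t t' : Fin n → ℕ} {L : List (Fin n)} (h : ∀ i ∈ L, t i = t' i) (x : C) :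
    C.substList t L x = C.substList t' L x := by
  induction L with
  | nil => rfl
  | cons i L ih =>
    rw [substList_cons, substList_cons, ih fun j hj => h j (List.mem_cons_of_mem _ hj),
      h i List.mem_cons_self]

variable (hC : C.SubstLaws)
include hC

theorem substList_inf (t : Fin n → ℕ) (L : List (Fin n)) (x y : C) :
    C.substList t L (x ⊓ y) = C.substList t L x ⊓ C.substList t L y := by
  induction L with
  | nil => rfl
  | cons i L ih => rw [substList_cons, ih, hC.subst_inf]; rfl

theorem substList_bot (t : Fin n → ℕ) (L : List (Fin n)) : C.substList t L ⊥ = ⊥ := by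
  induction L with
  | nil => rfl
  | cons i L ih => rw [substList_cons, ih, hC.subst_bot]

theorem substList_mono (t : Fin n → ℕ) (L : List (Fin n)) {x y : C} (h : x ≤ y) :
    C.substList t L x ≤ C.substList t L y := by
  rw [← inf_eq_left, ← substList_inf hC, inf_eq_left.2 h]

theorem substList_cyl_comm (t : Fin n → ℕ) (L : List (Fin n)) {k : ℕ}
    (hk : ∀ i ∈ L, k ≠ i ∧ k ≠ t i) (x : C) :
    C.substList t L (C.cyl k x) = C.cyl k (C.substList t L x) := by
  induction L with
  | nil => rfl
  | cons i L ih =>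
    rw [substList_cons, substList_cons, ih fun j hj => hk j (List.mem_cons_of_mem _ hj),
      hC.subst_cyl_comm]
    · exact (hk i List.mem_cons_self).1
    · exact (hk i List.mem_cons_self).2

theorem substList_closed {t : Fin n → ℕ} {L : List (Fin n)} {k : ℕ}
    (hk : ∀ i ∈ L, k ≠ i ∧ k ≠ t i) {x : C} (hx : C.cyl k x = x) :
    C.cyl k (C.substList t L x) = C.substList t L x := by
  rw [← substList_cyl_comm hC t L hk, hx]

/-- All targets lie outside `n`, so no target is a source and the replacements commute. This is what
makes their composition a simultaneous substitution. -/
theorem substList_perm {t : Fin n → ℕ} (ht : ∀ i, n ≤ t i) {L L' : List (Fin n)}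
    (h : L.Perm L') (x : C) : C.substList t L x = C.substList t L' x := by
  have : LeftCommutative fun (i : Fin n) (y : C) => C.subst i (t i) y := ⟨by
    intro i j y
    by_cases hij : i = j
    · rw [hij]
    · have := ht i; have := ht j; have := i.2; have := j.2
      exact hC.subst_comm _ _ _ _ _ (fun e => hij (Fin.ext e)) (by omega) (by omega)⟩
  exact h.foldr_eq (f := fun (i : Fin n) (y : C) => C.subst i (t i) y) x

theorem substAll_eq_subst {t : Fin n → ℕ} (ht : ∀ i, n ≤ t i) (i : Fin n) (x : C) :
    C.substAll t x = C.subst i (t i) (C.substList t ((List.finRange n).erase i) x) :=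
  substList_perm hC ht (List.perm_cons_erase (List.mem_finRange i)) x

theorem substAll_eq_substList {t : Fin n → ℕ} (ht : ∀ i, n ≤ t i) (i : Fin n) (x : C) :
    C.substAll t x = C.substList t ((List.finRange n).erase i) (C.subst i (t i) x) := by
  have h : (List.finRange n).Perm ((List.finRange n).erase i ++ [i]) :=
    (List.perm_cons_erase (List.mem_finRange i)).trans (List.perm_append_singleton _ _).symm
  rw [substAll, substList_perm hC ht h, substList_append]; rfl

theorem substAll_eq_substList_two {t : Fin n → ℕ} (ht : ∀ i, n ≤ t i) {i j : Fin n} (hij : i ≠ j)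
    (x : C) : C.substAll t x = C.substList t (((List.finRange n).erase i).erase j)
      (C.subst j (t j) (C.subst i (t i) x)) := by
  have hj : j ∈ (List.finRange n).erase i :=
    (List.mem_erase_of_ne hij.symm).2 (List.mem_finRange j)
  have h : ((List.finRange n).erase i).Perm (((List.finRange n).erase i).erase j ++ [j]) :=
    (List.perm_cons_erase hj).trans (List.perm_append_singleton _ _).symm
  rw [substAll_eq_substList hC ht i, substList_perm hC ht h, substList_append]; rfl

omit hC in
theorem mem_erase_finRange {i k : Fin n} : k ∈ (List.finRange n).erase i ↔ k ≠ i := by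
  rw [(List.nodup_finRange n).mem_erase_iff]
  simp [List.mem_finRange]

omit hC in
theorem mem_erase_erase_finRange {i j k : Fin n} :
    k ∈ ((List.finRange n).erase i).erase j ↔ k ≠ j ∧ k ≠ i := by
  rw [((List.nodup_finRange n).erase i).mem_erase_iff, mem_erase_finRange]

/-- The replacements of `i` and `j` are performed first. The one at `i` is idle after `s_[i/j]`, and
`subst_subst` redirects `s_[i/j]` to the target of `j`. -/
theorem substAll_subst {t : Fin n → ℕ} (ht : ∀ i, n ≤ t i) (i j : Fin n) (x : C) :
    C.substAll t (C.subst i j x) = C.substAll (t ∘ repl i j) x := by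
  have ht' : ∀ k, n ≤ (t ∘ repl i j) k := fun k => ht _
  by_cases hij : i = j
  · subst hij
    rw [hC.subst_self]
    rw [repl_self, Function.comp_id]
  have hij' : (i : ℕ) ≠ j := fun e => hij (Fin.ext e)
  have hi := ht i; have hj := ht j; have hi2 := i.2; have hj2 := j.2
  rw [substAll_eq_substList_two hC ht hij, substAll_eq_substList_two hC ht' hij]
  rw [substList_congr (t := t) (t' := t ∘ repl i j)]
  · congr 1
    have e1 : (t ∘ repl i j) i = t j := by simp [repl]
    have e2 : (t ∘ repl i j) j = t j := by simp [repl, Ne.symm hij]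
    rw [e1, e2, hC.subst_of_closed (hC.cyl_subst _ _ _ hij'), hC.subst_subst]
  · intro k hk
    rw [mem_erase_erase_finRange] at hk
    simp [repl, hk.2]

theorem substAll_swap (hCK : C.InK) (h : K.hasSwap = true) {t : Fin n → ℕ} (ht : ∀ i, n ≤ t i)
    (i j : Fin n) (x : C) :
    C.substAll t (C.swap h i j x) = C.substAll (t ∘ Equiv.swap i j) x := by
  have ht' : ∀ k, n ≤ (t ∘ Equiv.swap i j) k := fun k => ht _
  by_cases hij : i = j
  · subst hij
    obtain ⟨_, hw⟩ := hCK.swapLaws h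
    rw [hw.swap_self]
    simp
  have hij' : (i : ℕ) ≠ j := fun e => hij (Fin.ext e)
  have hi := ht i; have hj := ht j; have hi2 := i.2; have hj2 := j.2
  rw [substAll_eq_substList_two hC ht hij, substAll_eq_substList_two hC ht' (Ne.symm hij)]
  rw [List.erase_comm, substList_congr (t := t) (t' := t ∘ Equiv.swap i j)]
  · congr 1
    rw [Function.comp_apply, Function.comp_apply, Equiv.swap_apply_left, Equiv.swap_apply_right]
    exact swap_subst_subst hCK h hij' (by omega) (by omega) (by omega) (by omega) x
  · intro k hk
    rw [List.erase_comm, mem_erase_erase_finRange] at hk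
    simp [Equiv.swap_apply_of_ne_of_ne hk.2 hk.1]

theorem substAll_update_of_closed {t : Fin n → ℕ} (ht : ∀ i, n ≤ t i) {i : Fin n} {m : ℕ}
    (hm : n ≤ m) {x : C} (hx : C.cyl i x = x) :
    C.substAll (Function.update t i m) x = C.substAll t x := by
  have ht' : ∀ k, n ≤ Function.update t i m k := by
    intro k
    by_cases h : k = i
    · subst h; simpa using hm
    · simpa [h] using ht k
  rw [substAll_eq_substList hC ht i, substAll_eq_substList hC ht' i, hC.subst_of_closed hx,
    hC.subst_of_closed hx]
  refine substList_congr ?_ x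
  intro k hk
  rw [mem_erase_finRange] at hk
  simp [hk]

theorem substAll_update {t : Fin n → ℕ} (ht : ∀ i, n ≤ t i) (i : Fin n) {m : ℕ} (hm : n ≤ m)
    (x : C) : C.substAll (Function.update t i m) x
      = C.subst i m (C.substList t ((List.finRange n).erase i) x) := by
  have ht' : ∀ k, n ≤ Function.update t i m k := by
    intro k
    by_cases h : k = i
    · subst h; simpa using hm
    · simpa [h] using ht k
  rw [substAll_eq_subst hC ht' i, Function.update_self]
  congr 1
  refine substList_congr ?_ x
  intro k hk
  rw [mem_erase_finRange] at hk
  simp [hk]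

/-- The bound index `i` is renamed to `m`, which must avoid the values of `t` so that the remaining
replacements do not capture it. -/
theorem substAll_cyl {t : Fin n → ℕ} (ht : ∀ i, n ≤ t i) (i : Fin n) {m : ℕ} (hm : n ≤ m)
    (hmt : ∀ j, m ≠ t j) {x : C} (hx : C.cyl m x = x) :
    C.substAll t (C.cyl i x) = C.cyl m (C.substAll (Function.update t i m) x) := by
  have hfr : ∀ j ∈ (List.finRange n).erase i, m ≠ j ∧ m ≠ t j :=
    fun j _ => ⟨by have := j.2; omega, hmt j⟩
  rw [substAll_update hC ht i hm, hC.cyl_subst_fresh (substList_closed hC hfr hx),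
    substAll_eq_substList hC ht i, hC.subst_cyl]
  refine substList_cyl_comm hC t _ ?_ x
  intro j hj
  rw [mem_erase_finRange] at hj
  exact ⟨fun e => hj (Fin.ext e.symm), by have := i.2; have := ht j; omega⟩

/-- This half needs no freshness: the value of `t` at `i` is irrelevant for `c_i x`. -/
theorem substAll_le_cyl {t : Fin n → ℕ} (ht : ∀ i, n ≤ t i) (i : Fin n) {m : ℕ} (hm : n ≤ m)
    (x : C) : C.substAll (Function.update t i m) x ≤ C.substAll t (C.cyl i x) := by
  rw [← substAll_update_of_closed hC ht hm (hC.cyl_cyl i x)]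
  exact substList_mono hC _ _ (hC.le_cyl _ _)

theorem substAll_diag {h : K.hasDiag = true} (hd : C.DiagSubstLaws h) {t : Fin n → ℕ}
    (ht : ∀ i, n ≤ t i) (i j : Fin n) :
    C.substAll t (C.diag h i j) = C.diag h (t i) (t j) := by
  have hi := ht i; have hj := ht j; have hi2 := i.2; have hj2 := j.2
  have hrest : ∀ (L : List (Fin n)) (k l : ℕ), (∀ m ∈ L, (m : ℕ) ≠ k ∧ (m : ℕ) ≠ l) →
      C.substList t L (C.diag h k l) = C.diag h k l := by
    intro L k l hL
    induction L with
    | nil => rfl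
    | cons m L ih =>
      rw [substList_cons, ih fun a ha => hL a (List.mem_cons_of_mem _ ha),
        hC.subst_of_closed]
      exact diag_closed hC hd (hL m List.mem_cons_self).1 (hL m List.mem_cons_self).2
  by_cases hij : i = j
  · subst hij
    -- `⊤` is rewritten as `d_nn`, whose index no replacement touches, so that `hrest` applies.
    rw [diag_self hC hd, diag_self hC hd, ← diag_self hC hd n]
    exact hrest _ _ _ fun m _ => by have := m.2; omega
  have hij' : (i : ℕ) ≠ j := fun e => hij (Fin.ext e)
  rw [substAll_eq_substList_two hC ht hij, subst_diag_eq hC hd (by omega) hij',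
    diag_symm hC hd, subst_diag_eq hC hd (by omega) (by omega), diag_symm hC hd]
  refine hrest _ _ _ fun m _ => ?_
  have := m.2
  omega

theorem substAll_inf_diag_le {h : K.hasDiag = true} (hd : C.DiagSubstLaws h) {t : Fin n → ℕ}
    (ht : ∀ i, n ≤ t i) (i : Fin n) {k l : ℕ} (hk : n ≤ k) (hl : n ≤ l) (x : C) :
    C.substAll (Function.update t i k) x ⊓ C.diag h k l ≤ C.substAll (Function.update t i l) x := by
  have hi := i.2
  rw [substAll_update hC ht i hk, substAll_update hC ht i hl]
  exact subst_inf_diag_le_subst hC hd (by omega) (by omega) _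

end SubstAll

end Alg

/-! ### Networks and representations of complex algebras -/

section Networks

variable {K : Kind} {n : ℕ}

/-- A labelling of the `n`-tuples of natural numbers by elements of an atom structure, together
with an equivalence relation that interprets equality; the existential demands are met for the
sets in `F`. -/
structure IsNetwork (S : AtStr.{u} K (Fin n)) (F : Finset (Set S.carrier))
    (al : (Fin n → ℕ) → S.carrier) (E : ℕ → ℕ → Prop) : Prop where
  sub : ∀ h i j t b, S.rel (.sub h i j) (al t) b ↔ b = al (t ∘ repl i j)
  swap : ∀ h i j t b, S.rel (.swap h i j) (al t) b ↔ b = al (t ∘ Equiv.swap i j)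
  cyl : ∀ i t m, S.rel (.cyl i) (al t) (al (Function.update t i m))
  witness : ∀ i t, ∀ X ∈ F, (∃ b ∈ X, S.rel (.cyl i) (al t) b) →
    ∃ m, al (Function.update t i m) ∈ X
  equiv : Equivalence E
  congr : ∀ t i k l, E k l → al (Function.update t i k) = al (Function.update t i l)
  diag : ∀ h i j t, S.pred (.diag h i j) (al t) ↔ E (t i) (t j)

/-- The networks are combined in an ultraproduct over the finite sets `F`, along an ultrafilter for
which almost every `F` contains any given `X`. The demands of every `X` are then met, although each
network handles only finitely many. -/
theorem exists_hom_of_networks (S : AtStr.{u} K (Fin n)) (a : S.carrier)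
    (hN : ∀ F, ∃ al E, IsNetwork S F al E ∧ ∃ t, al t = a) :
    ∃ (U : Type u) (f : Set S.carrier → Set (Fin n → U)),
      Alg.IsHom (Cm S) (fullSetAlg K (Fin n) U) f ∧ ∃ v : Fin n → U, ∀ X, a ∈ X → v ∈ f X := by
  choose al E hN t₀ ht₀ using hN
  let W : Ultrafilter (Finset (Set S.carrier)) := Ultrafilter.of Filter.atTop
  have hW : ∀ X, ∀ᶠ F in W.toFilter, X ∈ F := fun X =>
    (Ultrafilter.of_le Filter.atTop) ((Filter.eventually_ge_atTop {X}).mono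
      fun F hF => Finset.singleton_subset_iff.1 hF)
  let r : Setoid (Finset (Set S.carrier) → ℕ) :=
    { r := fun s t => ∀ᶠ F in W.toFilter, E F (s F) (t F)
      iseqv :=
        { refl := fun s => Filter.Eventually.of_forall fun F => (hN F).equiv.refl _
          symm := fun h => h.mono fun F => (hN F).equiv.symm
          trans := fun h h' => (h.and h').mono fun F h => (hN F).equiv.trans h.1 h.2 } }
  -- Labels are read off at chosen representatives. By `congr` another choice changes them only on a
  -- null set.
  let lab : (Fin n → Quotient r) → Finset (Set S.carrier) → S.carrier :=
    fun v F => al F fun k => (v k).out F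
  let f : Set S.carrier → Set (Fin n → Quotient r) :=
    fun X => {v | ∀ᶠ F in W.toFilter, lab v F ∈ X}
  have hout : ∀ s : Finset (Set S.carrier) → ℕ, ∀ᶠ F in W.toFilter,
      E F ((Quotient.mk r s).out F) (s F) := fun s => Quotient.mk_out (s := r) s
  have hupd : ∀ (v : Fin n → Quotient r) i q F, (fun k => (Function.update v i q k).out F)
      = Function.update (fun k => (v k).out F) i (q.out F) := by
    intro v i q F
    funext k
    by_cases h : k = i
    · subst h; simp
    · simp [h]
  refine ⟨Quotient r, f, ⟨?_, ?_, ?_, ?_, ?_, ?_, ?_⟩, ?_⟩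
  · intro X Y; exact Set.ext fun v => Ultrafilter.eventually_or
  · intro X Y; exact Set.ext fun v => Filter.eventually_and
  · intro X; exact Set.ext fun v => Ultrafilter.eventually_not
  · refine Set.ext fun v => ?_
    refine iff_of_false (fun h => ?_) (fun h => h)
    obtain ⟨F, hF⟩ := Filter.Eventually.exists (f := W.toFilter) h
    exact hF
  · refine Set.ext fun v => ?_
    exact iff_of_true (Filter.Eventually.of_forall fun F => trivial) trivial
  · rintro (i | ⟨h, i, j⟩ | ⟨h, i, j⟩) (X : Set S.carrier)
    · refine Set.ext fun v => ?_
      constructor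
      · intro hv
        -- A network supplies witnesses for `X` only if `X ∈ F`, which holds for almost every `F`.
        have h1 : ∀ᶠ F in W.toFilter, ∃ m,
            al F (Function.update (fun k => (v k).out F) i m) ∈ X := by
          filter_upwards [hv, hW X] with F hF hX
          exact (hN F).witness i _ X hX hF
        obtain ⟨m, hm⟩ := h1.choice
        refine ⟨Function.update v i (Quotient.mk r m), ?_, fun j hj => by simp [hj]⟩
        change ∀ᶠ F in W.toFilter, _
        filter_upwards [hm, hout m] with F hF hE
        change al F _ ∈ X
        rwa [hupd, (hN F).congr _ i _ _ hE]
      · rintro ⟨w, hw, hwv⟩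
        refine Filter.Eventually.mono hw fun F hF => ⟨_, hF, ?_⟩
        have e : (fun k => (w k).out F)
            = Function.update (fun k => (v k).out F) i ((w i).out F) := by
          rw [← hupd]
          funext k
          by_cases h : k = i
          · subst h; simp
          · simp [h, hwv]
        change S.rel _ _ (al F _)
        rw [e]
        exact (hN F).cyl i _ _
    · refine Set.ext fun v => ?_
      refine Filter.eventually_congr (Filter.Eventually.of_forall fun F => ?_)
      constructor
      · rintro ⟨b, hb, hr⟩
        rw [(hN F).sub] at hr
        subst hr
        exact hb
      · intro hb
        exact ⟨_, hb, ((hN F).sub h i j _ _).2 rfl⟩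
    · refine Set.ext fun v => ?_
      refine Filter.eventually_congr (Filter.Eventually.of_forall fun F => ?_)
      constructor
      · rintro ⟨b, hb, hr⟩
        rw [(hN F).swap] at hr
        subst hr
        exact hb
      · intro hb
        exact ⟨_, hb, ((hN F).swap h i j _ _).2 rfl⟩
  · rintro ⟨h, i, j⟩
    refine Set.ext fun v => ?_
    change (∀ᶠ F in W.toFilter, S.pred _ (al F _)) ↔ v i = v j
    simp only [(hN _).diag]
    rw [← Quotient.out_equiv_out]
    rfl
  · refine ⟨fun k => Quotient.mk r fun F => t₀ F k, fun X hX => ?_⟩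
    have key : ∀ᶠ F in W.toFilter, ∀ k : Fin n,
        E F ((Quotient.mk r fun F => t₀ F k).out F) (t₀ F k) :=
      Filter.eventually_all.2 fun k => hout _
    refine key.mono fun F hF => ?_
    -- `congr` changes one coordinate, so equivalent tuples are exchanged coordinate by coordinate.
    have hc : ∀ (s s' : Fin n → ℕ), (∀ k, E F (s k) (s' k)) → al F s = al F s' := by
      intro s s' hs
      have : ∀ T : Finset (Fin n), al F (T.piecewise s' s) = al F s := by
        intro T
        induction T using Finset.induction_on with
        | empty => simp
        | insert i T hi ih =>
          rw [Finset.piecewise_insert, ← (hN F).congr _ i _ _ (hs i), ← ih]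
          congr 1
          funext k
          by_cases h : k = i
          · subst h; simp [hi]
          · simp [h]
      have h2 := this Finset.univ
      rw [Finset.piecewise_univ] at h2
      exact h2.symm
    change al F _ ∈ X
    rw [hc _ _ hF, ht₀]
    exact hX

/-- One homomorphism is taken for each atom. The one for `a` separates any set containing `a` from
any set omitting it, so the product over all atoms is injective. -/
theorem Cm_mem_RK_of_networks (S : AtStr.{u} K (Fin n))
    (hN : ∀ a F, ∃ al E, IsNetwork S F al E ∧ ∃ t, al t = a) : Cm S ∈ RK K (Fin n) := by
  choose U f hf v hv using fun a => exists_hom_of_networks S a (hN a)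
  refine ⟨S.carrier, U, fun X a => f a X, ⟨?_, ?_, ?_, ?_, ?_, ?_, ?_⟩, ?_⟩
  · intro X Y; funext a; exact (hf a).map_sup X Y
  · intro X Y; funext a; exact (hf a).map_inf X Y
  · intro X; funext a; exact (hf a).map_compl X
  · funext a; exact (hf a).map_bot
  · funext a; exact (hf a).map_top
  · intro o X; funext a; exact (hf a).map_un o X
  · intro d; funext a; exact (hf a).map_cst d
  · have key : ∀ (X Y : Set S.carrier), (∀ a, f a X = f a Y) → X ⊆ Y := by
      intro X Y h a ha
      by_contra hY
      have h1 : v a ∈ f a X := hv a X ha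
      have h2 : v a ∈ f a Yᶜ := hv a Yᶜ hY
      rw [show f a Yᶜ = (f a Y)ᶜ from (hf a).map_compl Y, ← h a] at h2
      exact h2 h1
    intro X Y h
    exact (key X Y (congrFun h)).antisymm (key Y X fun b => (congrFun h b).symm)

end Networks

/-! ### Homomorphisms and the derived replacement operators -/

namespace Alg

section Hom

variable {K : Kind} {α : Type}

theorem IsHom.map_cyl {A B : Alg.{u} K α} {f : A → B} (hf : IsHom A B f) (i : α) (x : A) :
    f (A.cyl i x) = B.cyl i (f x) := hf.map_un _ _

theorem IsHom.map_subst [DecidableEq α] {A B : Alg.{u} K α} {f : A → B} (hf : IsHom A B f)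
    (i j : α) (x : A) : f (A.subst i j x) = B.subst i j (f x) := by
  unfold subst
  split_ifs with h1 h2 h3
  · exact hf.map_un _ _
  · rfl
  · rw [hf.map_cyl, hf.map_inf]
    congr 2
    exact hf.map_cst _
  · rfl

theorem IsHom.mono {A B : Alg.{u} K α} {f : A → B} (hf : IsHom A B f) {x y : A} (h : x ≤ y) :
    f x ≤ f y := by
  rw [← inf_eq_left, ← hf.map_inf, inf_eq_left.2 h]

theorem IsHom.comp {A B D : Alg.{u} K α} {f : A → B} {g : B → D} (hg : IsHom B D g)
    (hf : IsHom A B f) : IsHom A D (g ∘ f) where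
  map_sup x y := by simp [hf.map_sup, hg.map_sup]
  map_inf x y := by simp [hf.map_inf, hg.map_inf]
  map_compl x := by simp [hf.map_compl, hg.map_compl]
  map_bot := by simp [hf.map_bot, hg.map_bot]
  map_top := by simp [hf.map_top, hg.map_top]
  map_un o x := by simp [hf.map_un, hg.map_un]
  map_cst d := by simp [hf.map_cst, hg.map_cst]

theorem rd_subst {n : ℕ} (C : Alg.{u} K ℕ) (i j : Fin n) (x : C) :
    (C.rd Fin.val : Alg.{u} K (Fin n)).subst i j x = C.subst i j x := by
  unfold subst
  simp only [Fin.ext_iff]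
  rfl

end Hom

/-! ### Finite-dimensional elements -/

section LocallyFinite

variable {K : Kind}

/-- The elements of an `ω`-dimensional algebra that depend on finitely many dimensions. -/
def finDim (C : Alg.{u} K ℕ) : Set C := {x | ∃ m, ∀ k, m ≤ k → C.cyl k x = x}

/-- Every nonzero finite-dimensional element meets some element of `Y`. -/
def MeetsAll (C : Alg.{u} K ℕ) (Y : Set C) : Prop :=
  ∀ z ∈ C.finDim, z ≠ ⊥ → ∃ y ∈ Y, z ⊓ y ≠ ⊥

variable {C : Alg.{u} K ℕ} {n : ℕ}

theorem neatSet_subset_finDim : neatSet n C ⊆ C.finDim := fun _ h => ⟨n, h⟩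

variable (hC : C.SubstLaws)
include hC

theorem finDim_inf {x y : C} (hx : x ∈ C.finDim) (hy : y ∈ C.finDim) : x ⊓ y ∈ C.finDim := by
  obtain ⟨m, hm⟩ := hx
  obtain ⟨m', hm'⟩ := hy
  exact ⟨max m m', fun k hk => hC.closed_inf (hm k (le_of_max_le_left hk))
    (hm' k (le_of_max_le_right hk))⟩

theorem finDim_compl {x : C} (hx : x ∈ C.finDim) : xᶜ ∈ C.finDim := by
  obtain ⟨m, hm⟩ := hx
  exact ⟨m, fun k hk => hC.cyl_compl_closed (hm k hk)⟩

theorem finDim_cyl (i : ℕ) {x : C} (hx : x ∈ C.finDim) : C.cyl i x ∈ C.finDim := by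
  obtain ⟨m, hm⟩ := hx
  exact ⟨m, fun k hk => hC.closed_cyl (hm k hk)⟩

theorem finDim_subst (i j : ℕ) {x : C} (hx : x ∈ C.finDim) : C.subst i j x ∈ C.finDim := by
  obtain ⟨m, hm⟩ := hx
  refine ⟨m + i + j + 1, fun k hk => hC.closed_subst ?_ ?_ (hm k ?_)⟩ <;> omega

theorem finDim_substAll (t : Fin n → ℕ) {x : C} (hx : x ∈ C.finDim) :
    C.substAll t x ∈ C.finDim := by
  unfold substAll
  induction List.finRange n with
  | nil => exact hx
  | cons i L ih => exact finDim_subst hC _ _ ih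

theorem finDim_diag {h : K.hasDiag = true} (hd : C.DiagSubstLaws h) (i j : ℕ) :
    C.diag h i j ∈ C.finDim :=
  ⟨i + j + 1, fun k hk => diag_closed hC hd (by omega) (by omega)⟩

/-- The dimensions of `z` beyond `n` are cylindrified away one at a time. This does not affect
whether `z` meets an element of `Y`, since those elements are closed in these dimensions. -/
theorem meetsAll_of_neatSet {Y : Set C} (hY : Y ⊆ neatSet n C)
    (h : ∀ z ∈ neatSet n C, z ≠ ⊥ → ∃ y ∈ Y, z ⊓ y ≠ ⊥) : C.MeetsAll Y := by
  have key : ∀ (d : ℕ) (z : C), (∀ k, n + d ≤ k → C.cyl k z = z) → z ≠ ⊥ →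
      ∃ y ∈ Y, z ⊓ y ≠ ⊥ := by
    intro d
    induction d with
    | zero => exact h
    | succ d ih =>
      intro z hz hz0
      obtain ⟨y, hy, hzy⟩ := ih (C.cyl (n + d) z) (fun k hk => by
        rcases eq_or_lt_of_le hk with rfl | hk
        · exact hC.cyl_cyl _ _
        · exact hC.closed_cyl (hz k hk)) (fun e => hz0 (hC.cyl_eq_bot.1 e))
      refine ⟨y, hy, fun e => hzy ?_⟩
      rw [← hC.cyl_inf_of_closed (hY hy (n + d) (by omega)), e, hC.cyl_bot]
  rintro z ⟨m, hm⟩ hz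
  exact key m z (fun k hk => hm k (by omega)) hz

/-- A `y` is chosen that meets `s_[k/i] c_i z`. If `s_[i/k] y` missed `z`, it would miss `c_i z`,
and `s_[k/i]` would carry this back to `y`, which does not depend on `k`. -/
theorem meetsAll_subst {Y : Set C} (hY : C.MeetsAll Y) {i k : ℕ} (hik : i ≠ k)
    (hk : ∀ y ∈ Y, C.cyl k y = y) : C.MeetsAll (C.subst i k '' Y) := by
  intro z hz hz0
  have hw0 : C.subst k i (C.cyl i z) ≠ ⊥ := by
    intro e
    have := hC.subst_cancel (i := k) (j := i) (hC.cyl_cyl i z)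
    rw [e, hC.subst_bot] at this
    exact hz0 (hC.cyl_eq_bot.1 this.symm)
  obtain ⟨y, hy, hzy⟩ := hY _ (finDim_subst hC k i (finDim_cyl hC i hz)) hw0
  refine ⟨_, ⟨y, hy, rfl⟩, fun e => hzy ?_⟩
  have h1 : C.cyl i z ⊓ C.subst i k y = ⊥ := by
    rw [← hC.cyl_inf_of_closed (hC.cyl_subst _ _ _ hik), e, hC.cyl_bot]
  have h2 := congrArg (C.subst k i) h1
  rwa [hC.subst_inf, hC.subst_cancel (hk y hy), hC.subst_bot] at h2

/-- Injectivity keeps `t i` fresh at the stage where `i` is replaced, so `meetsAll_subst` applies to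
one index at a time. -/
theorem meetsAll_substAll_of_injective {Y : Set C} (hYn : Y ⊆ neatSet n C) (hY : C.MeetsAll Y)
    {t : Fin n → ℕ} (ht : ∀ i, n ≤ t i) (hinj : Function.Injective t) :
    C.MeetsAll (C.substAll t '' Y) := by
  have key : ∀ L : List (Fin n), L.Nodup → C.MeetsAll (C.substList t L '' Y) := by
    intro L hL
    induction L with
    | nil => rwa [show C.substList t [] '' Y = Y from Set.image_id Y]
    | cons i L ih =>
      rw [List.nodup_cons] at hL
      have := meetsAll_subst hC (ih hL.2) (i := i) (k := t i)
        (by have := ht i; have := i.2; omega) (by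
          rintro _ ⟨y, hy, rfl⟩
          refine substList_closed hC (fun j hj => ⟨?_, fun e => ?_⟩) (hYn hy _ (ht i))
          · have := ht i; have := j.2; omega
          · rw [hinj e] at hL; exact hL.1 hj)
      rwa [Set.image_image] at this
  exact key _ (List.nodup_finRange n)

theorem eq_bot_of_substAll_eq_bot {x : C} {t : Fin n → ℕ} (ht : ∀ i, n ≤ t i)
    (hinj : Function.Injective t) (hx : x ∈ neatSet n C) (h : C.substAll t x = ⊥) : x = ⊥ := by
  have key : ∀ L : List (Fin n), L.Nodup → C.substList t L x = ⊥ → x = ⊥ := by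
    intro L hL h
    induction L with
    | nil => exact h
    | cons i L ih =>
      rw [List.nodup_cons] at hL
      refine ih hL.2 ?_
      have hcl : C.cyl (t i) (C.substList t L x) = C.substList t L x := by
        refine substList_closed hC (fun j hj => ⟨?_, fun e => ?_⟩) (hx _ (ht i))
        · have := ht i; have := j.2; omega
        · rw [hinj e] at hL; exact hL.1 hj
      rw [← hC.subst_cancel (i := i) hcl, ← substList_cons, h, hC.subst_bot]
  exact key _ (List.nodup_finRange n) h

/-- A generic filter on the finite-dimensional elements. -/
theorem exists_generic_filter {ι : Type*} [Countable ι] (Y : ι → Set C)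
    (hfin : ∀ i, Y i ⊆ C.finDim) (hY : ∀ i, C.MeetsAll (Y i)) {z : C} (hz : z ∈ C.finDim)
    (hz0 : z ≠ ⊥) : ∃ G : Set C, z ∈ G ∧ (∀ x ∈ G, ∀ y ∈ G, x ⊓ y ∈ G) ∧
      (∀ x ∈ G, ∀ y, x ≤ y → y ∈ G) ∧ ⊥ ∉ G ∧ ∀ i, ∃ y ∈ Y i, y ∈ G := by
  classical
  -- The order is reversed so that ideals of `P` generate filters of `C`. The ideal meeting
  -- countably many cofinal sets is the Rasiowa–Sikorski lemma.
  let P := {x : C // x ∈ C.finDim ∧ x ≠ ⊥}ᵒᵈ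
  have : Encodable ι := Encodable.ofCountable ι
  let D : ι → Order.Cofinal P := fun i =>
    { carrier := {p | ∃ y ∈ Y i, (OrderDual.ofDual p).1 ≤ y}
      isCofinal := by
        intro p
        obtain ⟨y, hy, hpy⟩ := hY i (OrderDual.ofDual p).1 (OrderDual.ofDual p).2.1
          (OrderDual.ofDual p).2.2
        exact ⟨OrderDual.toDual ⟨_, finDim_inf hC (OrderDual.ofDual p).2.1 (hfin i hy), hpy⟩,
          ⟨y, hy, inf_le_right⟩, (inf_le_left : (OrderDual.ofDual p).1 ⊓ y ≤ _)⟩ }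
  let p₀ : P := OrderDual.toDual ⟨z, hz, hz0⟩
  let I := Order.idealOfCofinals p₀ D
  refine ⟨{x | ∃ p ∈ I, (OrderDual.ofDual p).1 ≤ x}, ⟨p₀, Order.mem_idealOfCofinals _ _, le_rfl⟩,
    ?_, ?_, ?_, ?_⟩
  · rintro x ⟨p, hp, hpx⟩ y ⟨q, hq, hqy⟩
    obtain ⟨r, hr, hpr, hqr⟩ := I.directed p hp q hq
    exact ⟨r, hr, le_inf (le_trans (show (OrderDual.ofDual r).1 ≤ _ from hpr) hpx)
      (le_trans (show (OrderDual.ofDual r).1 ≤ _ from hqr) hqy)⟩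
  · rintro x ⟨p, hp, hpx⟩ y hxy
    exact ⟨p, hp, hpx.trans hxy⟩
  · rintro ⟨p, -, hp⟩
    exact (OrderDual.ofDual p).2.2 (le_bot_iff.1 hp)
  · intro i
    obtain ⟨p, ⟨y, hy, hpy⟩, hp⟩ := Order.cofinal_meets_idealOfCofinals p₀ D i
    exact ⟨y, hy, p, hp, hpy⟩

end LocallyFinite

end Alg

/-! ### Complete subalgebras of neat reducts -/

/-- `g` embeds `A` as a complete subalgebra of the neat reduct of `C`. -/
structure IsCompleteNeatEmbedding {K : Kind} {n : ℕ} (A : Alg.{u} K (Fin n)) (C : Alg.{u} K ℕ)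
    (g : A → C) : Prop where
  inK : C.InK
  hom : Alg.IsHom A (C.rd Fin.val) g
  inj : Function.Injective g
  neat : ∀ x, g x ∈ neatSet n C
  dense : ∀ X : Set A, IsLUB X ⊤ → ∀ z ∈ neatSet n C, z ≠ ⊥ → ∃ x ∈ X, z ⊓ g x ≠ ⊥

theorem exists_completeNeatEmbedding {K : Kind} {n : ℕ} {A : Alg.{u} K (Fin n)}
    (hA : A ∈ CompleteSub (NrOmega K n)) :
    ∃ (C : Alg.{u} K ℕ) (g : A → C), IsCompleteNeatEmbedding A C g := by
  obtain ⟨B, ⟨C, hC, g, hg, hgi, hgr⟩, f, hf, hfi, hfc⟩ := hA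
  refine ⟨C, g ∘ f, hC, hg.comp hf, hgi.comp hfi, fun x => hgr ▸ Set.mem_range_self _, ?_⟩
  intro X hX z hz hz0
  rw [← hgr] at hz
  obtain ⟨b, rfl⟩ := hz
  by_contra! hne
  have hb : b ≠ ⊥ := fun e => hz0 (e ▸ hg.map_bot)
  refine hb ?_
  rw [← compl_eq_top, ← top_le_iff]
  refine (hfc X hX).2 ?_
  rintro _ ⟨x, hx, rfl⟩
  rw [le_compl_iff_disjoint_left, disjoint_iff]
  refine hgi ?_
  rw [hg.map_inf, hg.map_bot]
  exact hne x hx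

namespace IsCompleteNeatEmbedding

variable {K : Kind} {n : ℕ} {A : Alg.{u} K (Fin n)} {C : Alg.{u} K ℕ} {g : A → C}
  (hg : IsCompleteNeatEmbedding A C g)
include hg

theorem map_subst (i j : Fin n) (x : A) : g (A.subst i j x) = C.subst i j (g x) := by
  rw [hg.hom.map_subst, Alg.rd_subst]

theorem map_cyl (i : Fin n) (x : A) : g (A.cyl i x) = C.cyl i (g x) := hg.hom.map_un _ _

theorem map_diag (h : K.hasDiag = true) (i j : Fin n) : g (A.diag h i j) = C.diag h i j :=
  hg.hom.map_cst _

theorem map_inf (x y : A) : g (x ⊓ y) = g x ⊓ g y := hg.hom.map_inf x y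

theorem map_bot : g ⊥ = ⊥ := hg.hom.map_bot

theorem map_top : g ⊤ = ⊤ := hg.hom.map_top

theorem mono {x y : A} (h : x ≤ y) : g x ≤ g y := hg.hom.mono h

theorem isLUB_top {X : Set A}
    (h : ∀ z ∈ neatSet n C, z ≠ ⊥ → ∃ x ∈ X, z ⊓ g x ≠ ⊥) : IsLUB X ⊤ := by
  refine ⟨fun x _ => le_top, fun b hb => ?_⟩
  by_contra hne
  obtain ⟨x, hx, hbx⟩ := h (g bᶜ) (hg.neat _) (fun e => hne (by
    have : bᶜ = ⊥ := hg.inj (e.trans hg.map_bot.symm)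
    rw [compl_eq_bot] at this
    exact this.ge))
  refine hbx ?_
  rw [← hg.map_inf, disjoint_iff.1 (disjoint_compl_left_iff.2 (hb hx)), hg.map_bot]

/-- Where replacements are in the signature this is complete additivity. In a cylindric algebra `z`
misses `c_i (d_ij ⊓ x)` exactly if `c_i z ⊓ d_ij` misses `x`, so density at that element suffices.
-/
theorem isLUB_subst (hca : A.CompletelyAdditive) (i j : Fin n) {X : Set A} (hX : IsLUB X ⊤) :
    IsLUB (A.subst i j '' X) ⊤ := by
  have hC := hg.inK.substLaws
  have htop : A.subst i j ⊤ = ⊤ := hg.inj (by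
    rw [hg.map_subst, hg.map_top, hC.subst_top])
  by_cases h : K.hasSub = true
  · have e : A.subst i j = A.un (.sub h i j) := funext fun x => A.subst_eq_sub h i j x
    rw [← htop, e]
    exact hca _ _ _ hX
  by_cases hij : i = j
  · subst hij
    have e : A.subst i i = id := funext fun x => hg.inj (by
      rw [hg.map_subst, hC.subst_self]; rfl)
    rwa [e, Set.image_id]
  obtain rfl : K = .CA := by cases K <;> simp_all [Kind.hasSub]
  have hij' : (i : ℕ) ≠ j := fun e => hij (Fin.ext e)
  have hd := hg.inK.diagSubstLaws rfl
  refine hg.isLUB_top fun z hz hz0 => ?_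
  obtain ⟨x, hx, hzx⟩ := hg.dense X hX (C.cyl i z ⊓ C.diag rfl i j)
    (fun k hk => hC.closed_inf (hC.closed_cyl (hz k hk))
      (Alg.diag_closed hC hd (by have := i.2; omega) (by have := j.2; omega))) (fun e => hz0 (by
      have := congrArg (C.cyl i) e
      rw [inf_comm, hC.cyl_inf_of_closed (hC.cyl_cyl i z), Alg.cyl_diag hC hd, top_inf_eq,
        hC.cyl_bot] at this
      exact hC.cyl_eq_bot.1 this))
  refine ⟨_, ⟨x, hx, rfl⟩, fun e => hzx ?_⟩
  rw [hg.map_subst, Alg.ca_subst hg.inK.1 hg.inK.2 hij', hC.inf_cyl_eq_bot] at e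
  rw [inf_assoc]
  exact e

/-- The injective case uses only completeness of the embedding. If `t i = t j`, then `s_t` is
`s_[i/j]` followed by the substitution that sends `i` to a fresh value instead, and `s_[i/j]` maps
`X` to a set with join `⊤`. The induction is on the number of values missing for injectivity. -/
theorem meetsAll_substAll (hca : A.CompletelyAdditive) (t : Fin n → ℕ) (ht : ∀ i, n ≤ t i)
    {X : Set A} (hX : IsLUB X ⊤) : C.MeetsAll ((fun x => C.substAll t (g x)) '' X) := by
  have hC := hg.inK.substLaws
  induction hc : n - (Finset.univ.image t).card using Nat.strong_induction_on generalizing t X with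
  | _ c ih =>
  by_cases hinj : Function.Injective t
  · rw [← Set.image_image (C.substAll t) g]
    refine Alg.meetsAll_substAll_of_injective hC ?_ ?_ ht hinj
    · rintro _ ⟨x, -, rfl⟩
      exact hg.neat x
    · refine Alg.meetsAll_of_neatSet hC (n := n) ?_ ?_
      · rintro _ ⟨x, -, rfl⟩
        exact hg.neat x
      · intro z hz hz0
        obtain ⟨x, hx, h⟩ := hg.dense X hX z hz hz0
        exact ⟨_, ⟨x, hx, rfl⟩, h⟩
  · rw [Function.Injective] at hinj
    push Not at hinj
    obtain ⟨i, j, hij, hne⟩ := hinj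
    obtain ⟨m, hm⟩ := Infinite.exists_notMem_finset (Finset.univ.image t ∪ Finset.range n)
    rw [Finset.mem_union, not_or, Finset.mem_range, not_lt] at hm
    have ht' : ∀ k, n ≤ Function.update t i m k := by
      intro k
      by_cases h : k = i
      · subst h; simpa using hm.2
      · simpa [h] using ht k
    -- The old value at `i` is not lost, since `j` still takes it.
    have himg : insert m (Finset.univ.image t) ⊆ Finset.univ.image (Function.update t i m) := by
      intro k hk
      rw [Finset.mem_insert, Finset.mem_image] at hk
      rw [Finset.mem_image]
      rcases hk with rfl | ⟨l, -, rfl⟩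
      · exact ⟨i, Finset.mem_univ _, Function.update_self ..⟩
      · by_cases h : l = i
        · exact ⟨j, Finset.mem_univ _, by rw [Function.update_of_ne hne.symm, h, hij]⟩
        · exact ⟨l, Finset.mem_univ _, Function.update_of_ne h _ _⟩
    have hcard := Finset.card_le_card himg
    rw [Finset.card_insert_of_notMem hm.1] at hcard
    have hle : (Finset.univ.image (Function.update t i m)).card ≤ n := by
      simpa using Finset.card_image_le (s := Finset.univ) (f := Function.update t i m)
    have h := ih _ (by omega) (Function.update t i m) ht' (hg.isLUB_subst hca i j hX) rfl
    rw [Set.image_image] at h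
    have e : (fun x => C.substAll (Function.update t i m) (g (A.subst i j x)))
        = fun x => C.substAll t (g x) := by
      funext x
      rw [hg.map_subst, Alg.substAll_update_of_closed hC ht hm.2
        (hC.cyl_subst _ _ _ fun e => hne (Fin.ext e)), Alg.substAll_subst hC ht]
      congr 1
      funext k
      by_cases hk : k = i
      · subst hk; simp [repl, hij]
      · simp [repl, hk]
    rwa [e] at h

/-- The label of `t` is the atom `b` with `s_t b` in a generic filter. Finiteness of `F` keeps the
number of families to be met countable, however large `A` is. -/
theorem exists_network (hat : IsAtomic A) (hca : A.CompletelyAdditive) (a : (At A).carrier)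
    (F : Finset (Set (At A).carrier)) : ∃ al E, IsNetwork (At A) F al E ∧ ∃ t, al t = a := by
  classical
  have hC := hg.inK.substLaws
  have hatoms : IsLUB {x : A | IsAtom x} ⊤ := by
    refine ⟨fun _ _ => le_top, fun b hb => ?_⟩
    by_contra hne
    obtain ⟨x, hx, hxb⟩ := (hat.eq_bot_or_exists_atom_le bᶜ).resolve_left (fun e => hne (by
      rw [compl_eq_bot] at e
      exact e.ge))
    exact hx.1 (disjoint_self.1 ((disjoint_compl_right (a := b)).mono (hb hx) hxb))
  -- Point `k` is dimension `n + k` of `C`, so all targets of substitutions lie outside `n`.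
  let T : (Fin n → ℕ) → Fin n → ℕ := fun t k => n + t k
  have hT : ∀ t k, n ≤ T t k := fun t k => Nat.le_add_right _ _
  have hTu : ∀ t i m, T (Function.update t i m) = Function.update (T t) i (n + m) := by
    intro t i m
    funext k
    by_cases h : k = i
    · subst h; simp [T]
    · simp [T, h]
  let s : (Fin n → ℕ) → A → C := fun t x => C.substAll (T t) (g x)
  have sfin : ∀ t x, s t x ∈ C.finDim := fun t x =>
    Alg.finDim_substAll hC _ (Alg.neatSet_subset_finDim (hg.neat x))
  have sinf : ∀ t x y, s t (x ⊓ y) = s t x ⊓ s t y := fun t x y => by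
    simp only [s]; rw [hg.map_inf]; exact Alg.substList_inf hC _ _ _ _
  have sbot : ∀ t, s t ⊥ = ⊥ := fun t => by
    simp only [s]; rw [hg.map_bot]; exact Alg.substList_bot hC _ _
  have smono : ∀ t x y, x ≤ y → s t x ≤ s t y := fun t x y h =>
    Alg.substList_mono hC _ _ (hg.mono h)
  have ssubst : ∀ t i j x, s t (A.subst i j x) = s (t ∘ repl i j) x := fun t i j x => by
    simp only [s]; rw [hg.map_subst, Alg.substAll_subst hC (hT t)]; rfl
  have satoms : ∀ t, C.MeetsAll (s t '' {x | IsAtom x}) := fun t =>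
    hg.meetsAll_substAll hca (T t) (hT t) hatoms
  have scyl : ∀ t i m x, s (Function.update t i m) x ≤ s t (A.cyl i x) := fun t i m x => by
    simp only [s]
    rw [hg.map_cyl, hTu]
    exact Alg.substAll_le_cyl hC (hT t) i (Nat.le_add_right _ _) _
  -- the families to be met by the generic filter
  let ι := (Fin n → ℕ) ⊕ (Fin n × (Fin n → ℕ) × F) ⊕ (ℕ × ℕ)
  let Y : ι → Set C := fun o => match o with
    | .inl t => s t '' {x | IsAtom x}
    -- The filter decides between two cases: an atom of `X` occurs at some variant of `t` in
    -- coordinate `i`, or the label of `t` is below `c_i x` for no `x` in `X`.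
    | .inr (.inl ⟨i, t, X⟩) =>
        {y | ∃ x ∈ X.1, ∃ m, y = s (Function.update t i m) x.1} ∪
        {y | ∃ b : (At A).carrier, (∀ x ∈ X.1, ¬ b.1 ≤ A.cyl i x.1) ∧ y = s t b.1}
    | .inr (.inr ⟨k, l⟩) => if h : K.hasDiag = true then
        {C.diag h (n + k) (n + l), (C.diag h (n + k) (n + l))ᶜ} else {⊤}
  have hYfin : ∀ o, Y o ⊆ C.finDim := by
    rintro (t | ⟨i, t, X⟩ | ⟨k, l⟩) y hy
    · obtain ⟨x, -, rfl⟩ := hy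
      exact sfin t x
    · rcases hy with ⟨x, -, m, rfl⟩ | ⟨b, -, rfl⟩
      · exact sfin _ _
      · exact sfin _ _
    · simp only [Y] at hy
      split_ifs at hy with h
      · have := Alg.finDim_diag hC (hg.inK.diagSubstLaws h) (n + k) (n + l)
        rcases hy with rfl | rfl
        · exact this
        · exact Alg.finDim_compl hC this
      · rw [Set.mem_singleton_iff.1 hy]
        exact ⟨0, fun k _ => hC.cyl_top k⟩
  have hY : ∀ o, C.MeetsAll (Y o) := by
    rintro (t | ⟨i, t, X⟩ | ⟨k, l⟩) z hz hz0
    · exact satoms t z hz hz0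
    · obtain ⟨_, ⟨b, hb, rfl⟩, hzb⟩ := satoms t z hz hz0
      by_cases hx : ∃ x ∈ X.1, b ≤ A.cyl i x.1
      · obtain ⟨x, hxX, hbx⟩ := hx
        obtain ⟨m₀, hm₀⟩ := hz
        -- The witness `m` is fresh for `t`, so that `c_i` becomes `c_(n+m)` under the substitution,
        -- and for `z`, so that `z` can be moved out of that cylindrifier.
        obtain ⟨m, hm⟩ := Infinite.exists_notMem_finset (Finset.univ.image t ∪ Finset.range m₀)
        rw [Finset.mem_union, not_or, Finset.mem_range, not_lt, Finset.mem_image] at hm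
        have e : s t (A.cyl i x.1) = C.cyl (n + m) (s (Function.update t i m) x.1) := by
          simp only [s]
          rw [hg.map_cyl, hTu]
          refine Alg.substAll_cyl hC (hT t) i (Nat.le_add_right _ _) (fun j hj => hm.1 ⟨j,
            Finset.mem_univ _, ?_⟩) (hg.neat _ _ (Nat.le_add_right _ _))
          simp only [T] at hj
          omega
        refine ⟨_, Or.inl ⟨x, hxX, m, rfl⟩, fun h => hzb (le_bot_iff.1 ?_)⟩
        refine (inf_le_inf_left z (smono t _ _ hbx)).trans ?_
        rw [e, hC.inf_cyl_eq_bot.2]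
        rw [hm₀ _ (by omega), h]
      · push Not at hx
        exact ⟨_, Or.inr ⟨⟨b, hb⟩, hx, rfl⟩, hzb⟩
    · simp only [Y]
      split_ifs with h
      · by_contra! hne
        have h1 := hne _ (Or.inl rfl)
        have h2 := hne _ (Or.inr rfl)
        rw [← disjoint_iff] at h1 h2
        exact hz0 (disjoint_self.1 ((disjoint_compl_right_iff.1 h2) |> h1.mono_right))
      · exact ⟨⊤, rfl, by simpa using hz0⟩
  -- Along an injective tuple the substitution cannot annihilate `a`, so a generic filter can
  -- contain `s t₀ a`.
  let t₀ : Fin n → ℕ := Fin.val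
  have hs0 : s t₀ a.1 ≠ ⊥ := fun e => a.2.1 (hg.inj (by
    rw [hg.map_bot]
    exact Alg.eq_bot_of_substAll_eq_bot hC (hT t₀)
      (fun i j h => Fin.ext (by simp only [T, t₀] at h; omega)) (hg.neat _) e))
  obtain ⟨G, hGa, hGinf, hGup, hGbot, hGY⟩ := Alg.exists_generic_filter hC (ι := ι) Y hYfin hY
    (sfin t₀ a.1) hs0
  have hex : ∀ t, ∃ b : (At A).carrier, s t b.1 ∈ G := by
    intro t
    obtain ⟨_, ⟨b, hb, rfl⟩, hG⟩ := hGY (.inl t)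
    exact ⟨⟨b, hb⟩, hG⟩
  choose al hal using hex
  have hiff : ∀ t x, s t x ∈ G ↔ (al t).1 ≤ x := by
    intro t x
    refine ⟨fun hx => ?_, fun h => hGup _ (hal t) _ (smono t _ _ h)⟩
    by_contra hne
    refine hGbot ?_
    rw [← sbot t, ← disjoint_iff.1 ((al t).2.not_le_iff_disjoint.1 hne), sinf]
    exact hGinf _ (hal t) _ hx
  have heq : ∀ t (b : (At A).carrier), (al t).1 ≤ b.1 ↔ b = al t := by
    intro t b
    rw [b.2.le_iff_eq (al t).2.1]
    exact ⟨fun h => Subtype.ext h.symm, fun h => congrArg Subtype.val h.symm⟩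
  -- Without diagonals nothing has to be identified, and `E` is equality of points.
  let E : ℕ → ℕ → Prop := fun k l =>
    if h : K.hasDiag = true then C.diag h (n + k) (n + l) ∈ G else k = l
  have hE : ∀ h k l, E k l ↔ C.diag h (n + k) (n + l) ∈ G := by
    intro h k l
    simp [E, h]
  refine ⟨al, E, ⟨?_, ?_, ?_, ?_, ⟨?_, ?_, ?_⟩, ?_, ?_⟩, t₀, ?_⟩
  · intro h i j t b
    change (al t).1 ≤ A.sub h i j b.1 ↔ _
    rw [← A.subst_eq_sub, ← hiff, ssubst, hiff, heq]
  · intro h i j t b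
    change (al t).1 ≤ A.swap h i j b.1 ↔ _
    have e : s t (A.swap h i j b.1) = s (t ∘ Equiv.swap i j) b.1 := by
      simp only [s]
      rw [show g (A.swap h i j b.1) = C.swap h i j (g b.1) from hg.hom.map_un _ _,
        Alg.substAll_swap hC hg.inK h (hT t)]
      rfl
    rw [← hiff, e, hiff, heq]
  · intro i t m
    change (al t).1 ≤ A.cyl i (al _).1
    rw [← hiff]
    exact hGup _ (hal (Function.update t i m)) _ (scyl t i m _)
  · rintro i t X hX ⟨b, hb, hr⟩
    obtain ⟨y, hy | hy, hG⟩ := hGY (.inr (.inl (i, t, ⟨X, hX⟩)))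
    · obtain ⟨x, hx, m, rfl⟩ := hy
      rw [hiff, heq] at hG
      exact ⟨m, hG ▸ hx⟩
    · obtain ⟨c, hc, rfl⟩ := hy
      rw [hiff, heq] at hG
      subst hG
      exact absurd hr (hc b hb)
  · intro k
    by_cases h : K.hasDiag = true
    · rw [hE h, Alg.diag_self hC (hg.inK.diagSubstLaws h)]
      exact hGup _ hGa _ le_top
    · simp [E, h]
  · intro k l hkl
    by_cases h : K.hasDiag = true
    · rwa [hE h, Alg.diag_symm hC (hg.inK.diagSubstLaws h), ← hE h]
    · simp only [E, h] at hkl ⊢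
      exact hkl.symm
  · intro k l m hkl hlm
    by_cases h : K.hasDiag = true
    · rw [hE h] at *
      exact hGup _ (hGinf _ hkl _ hlm) _
        (Alg.diag_trans hC (hg.inK.diagSubstLaws h) _ _ _)
    · simp only [E, h] at hkl hlm ⊢
      exact hkl.trans hlm
  · intro t i k l hkl
    by_cases h : K.hasDiag = true
    · rw [hE h] at hkl
      rw [← heq, ← hiff]
      refine hGup _ (hGinf _ (hal (Function.update t i k)) _ hkl) _ ?_
      simp only [s]
      rw [hTu, hTu]
      exact Alg.substAll_inf_diag_le hC (hg.inK.diagSubstLaws h) (hT t) i (Nat.le_add_right _ _)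
        (Nat.le_add_right _ _) _
    · simp only [E, h] at hkl
      rw [show k = l from hkl]
  · intro h i j t
    change (al t).1 ≤ A.diag h i j ↔ _
    rw [← hiff, hE h]
    simp only [s]
    rw [hg.map_diag, Alg.substAll_diag hC (hg.inK.diagSubstLaws h) (hT t)]
  · exact ((heq t₀ a).1 ((hiff t₀ a.1).1 hGa)).symm

end IsCompleteNeatEmbedding

theorem stronglyRepresentable_of_completeSub {K : Kind} {n : ℕ} {A : Alg.{u} K (Fin n)}
    (hA : A ∈ CompleteSub (NrOmega K n)) (hat : IsAtomic A) (hca : A.CompletelyAdditive) :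
    StronglyRepresentable A := by
  obtain ⟨C, g, hg⟩ := exists_completeNeatEmbedding hA
  exact ⟨hat, hca, Cm_mem_RK_of_networks _ (hg.exists_network hat hca)⟩

/-! ### Set algebras -/

section SetAlgebras

variable {α : Type} [DecidableEq α] {M : Type u}

theorem repl_apply_self (i j : α) : repl i j i = j := by simp [repl]

theorem repl_apply_of_ne {i j k : α} (h : k ≠ i) : repl i j k = k := by simp [repl, h]

theorem comp_repl (s : α → M) (i j : α) : s ∘ repl i j = Function.update s i (s j) := by
  funext k
  by_cases h : k = i
  · subst h; simp [repl]
  · simp [repl, h]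

/-- The cylindrification of a set of sequences. -/
def cylSet (i : α) (X : Set (α → M)) : Set (α → M) :=
  {s | ∃ t ∈ X, ∀ j, j ≠ i → t j = s j}

theorem mem_cylSet_iff {i : α} {X : Set (α → M)} {s : α → M} :
    s ∈ cylSet i X ↔ ∃ a, Function.update s i a ∈ X := by
  constructor
  · rintro ⟨t, ht, h⟩
    refine ⟨t i, ?_⟩
    have : Function.update s i (t i) = t := by
      funext k
      by_cases hk : k = i
      · subst hk; simp
      · simp [hk, h k hk]
    rwa [this]
  · rintro ⟨a, h⟩
    exact ⟨_, h, fun j hj => by simp [hj]⟩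

theorem fullSetAlg_cylLaws (K : Kind) : (fullSetAlg K α M).CylLaws where
  cyl_bot i := Set.ext fun s => iff_of_false (fun ⟨_, h, _⟩ => h) (fun h => h)
  le_cyl i (X : Set (α → M)) s hs := ⟨s, hs, fun _ _ => rfl⟩
  cyl_inf_cyl i (X Y : Set (α → M)) := Set.ext fun s => by
    constructor
    · rintro ⟨t, ⟨ht, r, hr, h⟩, h'⟩
      exact ⟨⟨t, ht, h'⟩, r, hr, fun j hj => (h j hj).trans (h' j hj)⟩
    · rintro ⟨⟨t, ht, h⟩, r, hr, h'⟩
      exact ⟨t, ⟨ht, r, hr, fun j hj => (h' j hj).trans (h j hj).symm⟩, h⟩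
  cyl_comm i j (X : Set (α → M)) := by
    have key : ∀ i j, cylSet i (cylSet j X) ⊆ cylSet j (cylSet i X) := by
      rintro i j s ⟨t, ⟨r, hr, h⟩, h'⟩
      refine ⟨Function.update s j (r j), ⟨r, hr, fun k hk => ?_⟩, fun k hk => by simp [hk]⟩
      by_cases hkj : k = j
      · subst hkj; simp
      · simp [hkj, h k hkj, h' k hk]
    exact (key i j).antisymm (key j i)

theorem fullSetAlg_subLaws {K : Kind} (h : K.hasSub = true) : (fullSetAlg K α M).SubLaws h where
  sub_self i (X : Set (α → M)) := by
    change {s : α → M | s ∘ repl i i ∈ X} = X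
    rw [repl_self]; rfl
  sub_end i j := ⟨fun _ _ => rfl, fun _ => rfl⟩
  sub_cyl i j (X : Set (α → M)) := Set.ext fun s => by
    constructor
    · rintro ⟨t, ht, h⟩
      exact ⟨t, ht, fun k hk => by rw [h k hk, Function.comp_apply, repl_apply_of_ne hk]⟩
    · rintro ⟨t, ht, h⟩
      exact ⟨t, ht, fun k hk => by rw [h k hk, Function.comp_apply, repl_apply_of_ne hk]⟩
  cyl_sub i j (X : Set (α → M)) hij := Set.ext fun s => by
    constructor
    · rintro ⟨t, ht, h⟩
      have : s ∘ repl i j = t ∘ repl i j := by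
        funext k
        by_cases hk : k = i
        · subst hk; simp [repl_apply_self, h j hij.symm]
        · simp [repl_apply_of_ne hk, h k hk]
      change s ∘ repl i j ∈ X
      rw [this]; exact ht
    · intro hs
      exact ⟨s, hs, fun _ _ => rfl⟩
  sub_cyl_comm i j k (X : Set (α → M)) hi hj := Set.ext fun s => by
    have hne : ∀ l, l ≠ k → repl i j l ≠ k := by
      intro l hl
      by_cases h : l = i
      · subst h; rw [repl_apply_self]; exact hj.symm
      · rwa [repl_apply_of_ne h]
    constructor
    · rintro ⟨t, ht, h⟩
      refine ⟨Function.update s k (t k), ?_, fun l hl => by simp [hl]⟩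
      change _ ∘ repl i j ∈ X
      convert ht using 1
      funext l
      by_cases hl : l = k
      · subst hl; simp [repl_apply_of_ne hi]
      · simp [hne l hl, h l hl]
    · rintro ⟨t, ht, h⟩
      exact ⟨_, ht, fun l hl => h _ (hne l hl)⟩
  cyl_sub_symm i j (X : Set (α → M)) := by
    have key : ∀ i j, cylSet i {s | s ∘ repl j i ∈ X} ⊆ cylSet j {s | s ∘ repl i j ∈ X} := by
      rintro i j s ⟨t, ht, h⟩
      have e : Function.update s j (t i) ∘ repl i j = t ∘ repl j i := by
        funext k
        by_cases hk : k = i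
        · subst hk
          by_cases hkj : k = j
          · subst hkj; simp [repl_apply_self]
          · simp [repl_apply_self, repl_apply_of_ne hkj]
        · by_cases hkj : k = j
          · subst hkj; simp [repl_apply_self, repl_apply_of_ne hk]
          · simp [repl_apply_of_ne hkj, repl_apply_of_ne hk, hkj, h k hk]
      refine ⟨Function.update s j (t i), ?_, fun k hk => by simp [hk]⟩
      change _ ∘ repl i j ∈ X
      rw [e]
      exact ht
    exact (key i j).antisymm (key j i)
  sub_sub_comm i j k l (X : Set (α → M)) hik hil hkj := by
    change {s : α → M | (s ∘ repl i j) ∘ repl k l ∈ X}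
      = {s : α → M | (s ∘ repl k l) ∘ repl i j ∈ X}
    have : repl i j ∘ repl k l = repl k l ∘ repl i j := by
      funext m
      by_cases hm : m = i
      · subst hm; simp [repl_apply_self, repl_apply_of_ne hik, repl_apply_of_ne hkj.symm]
      · by_cases hm' : m = k
        · subst hm'; simp [repl_apply_self, repl_apply_of_ne hm, repl_apply_of_ne hil.symm]
        · simp [repl_apply_of_ne hm, repl_apply_of_ne hm']
    simp only [Function.comp_assoc, this]
  sub_sub i j k (X : Set (α → M)) := by
    change {s : α → M | (s ∘ repl i j) ∘ repl k i ∈ X}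
      = {s : α → M | (s ∘ repl i j) ∘ repl k j ∈ X}
    have : repl i j ∘ repl k i = repl i j ∘ repl k j := by
      funext m
      by_cases hm : m = k
      · subst hm
        by_cases hj : j = i
        · subst hj; rfl
        · simp [repl_apply_self, repl_apply_of_ne hj]
      · simp [repl_apply_of_ne hm]
    simp only [Function.comp_assoc, this]

theorem fullSetAlg_swapLaws {K : Kind} (hs : K.hasSub = true) (h : K.hasSwap = true) :
    (fullSetAlg K α M).SwapLaws hs h where
  swap_self i (X : Set (α → M)) := by
    change {s : α → M | s ∘ Equiv.swap i i ∈ X} = X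
    rw [Equiv.swap_self]; rfl
  swap_symm i j (X : Set (α → M)) := by
    change {s : α → M | s ∘ Equiv.swap i j ∈ X}
      = {s : α → M | s ∘ Equiv.swap j i ∈ X}
    rw [Equiv.swap_comm]
  swap_end i j := ⟨fun _ _ => rfl, fun _ => rfl⟩
  swap_swap i j (X : Set (α → M)) := by
    change {s : α → M | (s ∘ Equiv.swap i j) ∘ Equiv.swap i j ∈ X} = X
    have : (Equiv.swap i j : α → α) ∘ Equiv.swap i j = id := by funext k; simp
    simp only [Function.comp_assoc, this]; rfl
  swap_braid i j k (X : Set (α → M)) hij hik hjk := by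
    change {s : α → M | (s ∘ Equiv.swap i j) ∘ Equiv.swap i k ∈ X}
      = {s : α → M | (s ∘ Equiv.swap j k) ∘ Equiv.swap i j ∈ X}
    have : (Equiv.swap i j : α → α) ∘ Equiv.swap i k = Equiv.swap j k ∘ Equiv.swap i j := by
      funext m
      simp only [Function.comp_apply, Equiv.swap_apply_def]
      split_ifs <;> simp_all
    simp only [Function.comp_assoc, this]
  swap_sub i j (X : Set (α → M)) := by
    change {s : α → M | (s ∘ Equiv.swap i j) ∘ repl i j ∈ X}
      = {s : α → M | s ∘ repl j i ∈ X}
    have : (Equiv.swap i j : α → α) ∘ repl i j = repl j i := by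
      funext m
      by_cases hm : m = i
      · subst hm
        by_cases hj : m = j
        · subst hj; simp [repl]
        · simp [repl_apply_self, repl_apply_of_ne hj]
      · by_cases hj : m = j
        · subst hj; simp [repl_apply_self, repl_apply_of_ne hm]
        · simp [repl_apply_of_ne hm, repl_apply_of_ne hj, Equiv.swap_apply_of_ne_of_ne hm hj]
    simp only [Function.comp_assoc, this]
  swap_conj_cyl i j k (X : Set (α → M)) := Set.ext fun s => by
    constructor
    · rintro ⟨t, ht, h⟩
      refine ⟨t ∘ Equiv.swap i j, ?_, fun l hl => ?_⟩
      · change (t ∘ Equiv.swap i j) ∘ Equiv.swap i j ∈ X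
        have : (Equiv.swap i j : α → α) ∘ Equiv.swap i j = id := by funext k; simp
        rwa [Function.comp_assoc, this]
      · rw [Function.comp_apply, h _ (fun e => hl (by rw [← e, Equiv.swap_apply_self])),
          Function.comp_apply, Equiv.swap_apply_self]
    · rintro ⟨t, ht, h⟩
      exact ⟨_, ht, fun l hl => h _ (fun e => hl ((Equiv.swap i j).injective e))⟩
  swap_conj_sub i j k l (X : Set (α → M)) := by
    change {s : α → M | (s ∘ Equiv.swap i j) ∘ repl k l ∈ X}
      = {s : α → M | (s ∘ repl (Equiv.swap i j k) (Equiv.swap i j l)) ∘ Equiv.swap i j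
        ∈ X}
    have : (Equiv.swap i j : α → α) ∘ repl k l
        = repl (Equiv.swap i j k) (Equiv.swap i j l) ∘ Equiv.swap i j := by
      funext m
      by_cases hm : m = k
      · subst hm; simp [repl_apply_self]
      · have : Equiv.swap i j m ≠ Equiv.swap i j k := fun e => hm ((Equiv.swap i j).injective e)
        simp [repl_apply_of_ne hm, repl_apply_of_ne this]
    simp only [Function.comp_assoc, this]

theorem fullSetAlg_diagLawsCA {K : Kind} (h : K.hasDiag = true) :
    (fullSetAlg K α M).DiagLawsCA h where
  diag_self i := Set.ext fun s => iff_of_true rfl trivial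
  diag_cyl i j k hi hj := Set.ext fun s => by
    constructor
    · intro hs
      refine ⟨Function.update s k (s i), ⟨?_, ?_⟩, fun l hl => by simp [hl]⟩
      · change Function.update s k (s i) i = Function.update s k (s i) k
        simp [hi.symm]
      · change Function.update s k (s i) k = Function.update s k (s i) j
        simp only [Function.update_self, Function.update_of_ne hj.symm]
        exact hs
    · rintro ⟨t, ⟨h1, h2⟩, h⟩
      change s i = s j
      rw [← h i hi.symm, ← h j hj.symm]
      exact Eq.trans h1 h2
  diag_disj i j (X : Set (α → M)) hij := Set.ext fun s => by
    refine iff_of_false ?_ (fun h => h)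
    rintro ⟨⟨t, ⟨h1, h2⟩, h⟩, t', ⟨h1', h2'⟩, h'⟩
    refine h2' ?_
    have : t' = t := by
      funext k
      by_cases hk : k = i
      · subst hk
        rw [show t' k = t' j from h1', show t k = t j from h1, h j hij.symm, h' j hij.symm]
      · rw [h k hk, h' k hk]
    rwa [this]

theorem fullSetAlg_diagLawsQEA {K : Kind} (hs : K.hasSub = true) (h : K.hasDiag = true) :
    (fullSetAlg K α M).DiagLawsQEA hs h where
  sub_diag i j := Set.ext fun s => by
    refine iff_of_true ?_ trivial
    change s (repl i j i) = s (repl i j j)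
    rw [repl_apply_self]
    by_cases hj : j = i
    · subst hj; rw [repl_apply_self]
    · rw [repl_apply_of_ne hj]
  inf_diag_le i j (X : Set (α → M)) s hs := by
    change s ∘ repl i j ∈ X
    rw [comp_repl, ← show s i = s j from hs.2, Function.update_eq_self]
    exact hs.1

/-- A Boolean algebra of sets of sequences that is closed under the operations of the full set
algebra. -/
structure IsClosedFamily (B : BooleanSubalgebra (Set (α → M))) : Prop where
  cyl : ∀ i, ∀ X ∈ B, cylSet i X ∈ B
  sub : ∀ i j, ∀ X ∈ B, {s | s ∘ repl i j ∈ X} ∈ B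
  swap : ∀ i j, ∀ X ∈ B, {s | s ∘ Equiv.swap i j ∈ X} ∈ B
  diag : ∀ i j, {s : α → M | s i = s j} ∈ B

/-- The set algebra with a given universe. -/
def setAlg (K : Kind) {B : BooleanSubalgebra (Set (α → M))} (hB : IsClosedFamily B) :
    Alg.{u} K α where
  carrier := B
  un o X := ⟨(fullSetAlg K α M).un o X.1, by
    rcases o with i | ⟨h, i, j⟩ | ⟨h, i, j⟩
    · exact hB.cyl i _ X.2
    · exact hB.sub i j _ X.2
    · exact hB.swap i j _ X.2⟩
  cst d := ⟨(fullSetAlg K α M).cst d, by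
    rcases d with ⟨h, i, j⟩
    exact hB.diag i j⟩

theorem setAlg_inK (K : Kind) {B : BooleanSubalgebra (Set (α → M))} (hB : IsClosedFamily B) :
    (setAlg K hB).InK := by
  have hc : (setAlg K hB).CylLaws :=
    { cyl_bot := fun i => Subtype.ext ((fullSetAlg_cylLaws K).cyl_bot i)
      le_cyl := fun i x => (fullSetAlg_cylLaws K).le_cyl i x.1
      cyl_inf_cyl := fun i x y => Subtype.ext ((fullSetAlg_cylLaws K).cyl_inf_cyl i x.1 y.1)
      cyl_comm := fun i j x => Subtype.ext ((fullSetAlg_cylLaws K).cyl_comm i j x.1) }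
  have hs : ∀ h : K.hasSub = true, (setAlg K hB).SubLaws h := fun h =>
    have H := fullSetAlg_subLaws (α := α) (M := M) h
    { sub_self := fun i x => Subtype.ext (H.sub_self i x.1)
      sub_end := fun i j => ⟨fun x y => Subtype.ext ((H.sub_end i j).1 x.1 y.1),
        fun x => Subtype.ext ((H.sub_end i j).2 x.1)⟩
      sub_cyl := fun i j x => Subtype.ext (H.sub_cyl i j x.1)
      cyl_sub := fun i j x h => Subtype.ext (H.cyl_sub i j x.1 h)
      sub_cyl_comm := fun i j k x h h' => Subtype.ext (H.sub_cyl_comm i j k x.1 h h')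
      cyl_sub_symm := fun i j x => Subtype.ext (H.cyl_sub_symm i j x.1)
      sub_sub_comm := fun i j k l x h h' h'' =>
        Subtype.ext (H.sub_sub_comm i j k l x.1 h h' h'')
      sub_sub := fun i j k x => Subtype.ext (H.sub_sub i j k x.1) }
  have hw : ∀ (h' : K.hasSub = true) (h : K.hasSwap = true), (setAlg K hB).SwapLaws h' h :=
    fun h' h =>
    have H := fullSetAlg_swapLaws (α := α) (M := M) h' h
    { swap_self := fun i x => Subtype.ext (H.swap_self i x.1)
      swap_symm := fun i j x => Subtype.ext (H.swap_symm i j x.1)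
      swap_end := fun i j => ⟨fun x y => Subtype.ext ((H.swap_end i j).1 x.1 y.1),
        fun x => Subtype.ext ((H.swap_end i j).2 x.1)⟩
      swap_swap := fun i j x => Subtype.ext (H.swap_swap i j x.1)
      swap_braid := fun i j k x h h' h'' => Subtype.ext (H.swap_braid i j k x.1 h h' h'')
      swap_sub := fun i j x => Subtype.ext (H.swap_sub i j x.1)
      swap_conj_cyl := fun i j k x => Subtype.ext (H.swap_conj_cyl i j k x.1)
      swap_conj_sub := fun i j k l x => Subtype.ext (H.swap_conj_sub i j k l x.1) }
  have hd : ∀ h : K.hasDiag = true, (setAlg K hB).DiagLawsCA h := fun h =>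
    have H := fullSetAlg_diagLawsCA (α := α) (M := M) h
    { diag_self := fun i => Subtype.ext (H.diag_self i)
      diag_cyl := fun i j k h h' => Subtype.ext (H.diag_cyl i j k h h')
      diag_disj := fun i j x h => Subtype.ext (H.diag_disj i j x.1 h) }
  have hq : ∀ (h' : K.hasSub = true) (h : K.hasDiag = true), (setAlg K hB).DiagLawsQEA h' h :=
    fun h' h =>
    have H := fullSetAlg_diagLawsQEA (α := α) (M := M) h' h
    { sub_diag := fun i j => Subtype.ext (H.sub_diag i j)
      inf_diag_le := fun i j x => H.inf_diag_le i j x.1 }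
  cases K with
  | Sc => exact ⟨hc, hs rfl⟩
  | QA => exact ⟨hc, hs rfl, hw rfl rfl⟩
  | CA => exact ⟨hc, hd rfl⟩
  | QEA => exact ⟨hc, hs rfl, hw rfl rfl, hq rfl rfl⟩

end SetAlgebras

/-! ### An elementary property of neat reducts -/

section Composition

variable {K : Kind} {n : ℕ}

/-- The compositions of the elements of `A`, in the coordinates `i` and `j`, exist in `A`, as far
as the atoms that are determined by two of their projections are concerned. -/
def HasCompositions (A : Alg.{u} K (Fin n)) (i j : Fin n) : Prop :=
  ∀ x y : A, ∃ z : A, ∀ a : A, IsAtom a → A.cyl i a ⊓ A.cyl j a = a →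
    (a ≤ z ↔ ¬ A.subst i j (A.cyl j (y ⊓ A.cyl i a)) ⊓ A.cyl i (x ⊓ A.cyl j a) = ⊥)

/-- The composition is `c_n (s_[j/n] x ⊓ s_[i/n] y)`, formed with the spare dimension `n`; it lies
in the neat reduct and hence comes from `A`. For an atom `a = c_i a ⊓ c_j a`, meeting it can be
expressed without dimension `n`. -/
theorem hasCompositions_of_mem_NrOmega {A : Alg.{u} K (Fin n)} (hA : A ∈ NrOmega K n)
    {i j : Fin n} (hij : i ≠ j) : HasCompositions A i j := by
  obtain ⟨C, hCK, f, hf, hfi, hfr⟩ := hA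
  have hC := hCK.substLaws
  have hij' : (i : ℕ) ≠ j := fun e => hij (Fin.ext e)
  have hin : (i : ℕ) ≠ n := i.2.ne
  have hjn : (j : ℕ) ≠ n := j.2.ne
  have hneat : ∀ x k, n ≤ k → C.cyl k (f x) = f x := fun x =>
    (hfr ▸ Set.mem_range_self x : f x ∈ neatSet n C)
  have fcyl : ∀ i x, f (A.cyl i x) = C.cyl i (f x) := fun i x => hf.map_un _ _
  have finf : ∀ x y, f (x ⊓ y) = f x ⊓ f y := fun x y => hf.map_inf x y
  have fbot : ∀ x, f x = ⊥ ↔ x = ⊥ := fun x =>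
    ⟨fun h => hfi (h.trans hf.map_bot.symm), fun h => h ▸ hf.map_bot⟩
  intro x y
  have hz : C.cyl n (C.subst j n (f x) ⊓ C.subst i n (f y)) ∈ neatSet n C := by
    intro k hk
    rcases eq_or_lt_of_le hk with rfl | hk
    · exact hC.cyl_cyl _ _
    · refine hC.closed_cyl (hC.closed_inf ?_ ?_) <;>
        refine hC.closed_subst ?_ hk.ne' (hneat _ _ hk.le)
      · have := j.2; omega
      · have := i.2; omega
  rw [← hfr] at hz
  obtain ⟨z, hz⟩ := hz
  refine ⟨z, fun a ha hrect => ?_⟩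
  rw [← not_iff_not, not_not, ha.not_le_iff_disjoint, disjoint_iff, ← fbot, ← fbot, finf, finf, hz,
    hf.map_subst, Alg.rd_subst, fcyl, fcyl, finf, finf, fcyl, fcyl]
  have han := hneat a n le_rfl
  rw [hC.inf_cyl_eq_bot, han]
  set p := f x ⊓ C.cyl j (f a) with hp
  set q := f y ⊓ C.cyl i (f a) with hq
  have hpn : C.cyl n p = p := hC.closed_inf (hneat x n le_rfl) (hC.closed_cyl han)
  have hqn : C.cyl n q = q := hC.closed_inf (hneat y n le_rfl) (hC.closed_cyl han)
  -- The factors `c_j a` and `c_i a` of `a` are absorbed by the replacements of `j` and of `i`,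
  -- respectively.
  have e1 : f a ⊓ (C.subst j n (f x) ⊓ C.subst i n (f y)) = C.subst j n p ⊓ C.subst i n q := by
    have hr : f a = C.cyl i (f a) ⊓ C.cyl j (f a) := by rw [← fcyl, ← fcyl, ← finf, hrect]
    rw [hp, hq, hC.subst_inf, hC.subst_inf, hC.subst_cyl, hC.subst_cyl]
    conv_lhs => rw [hr]
    ac_rfl
  -- The first factor does not depend on `j` and the second does not depend on `i`, so each
  -- cylindrifier acts on one of them only.
  have e2 : C.cyl i (C.cyl j (C.subst j n p ⊓ C.subst i n q))
      = C.subst j n (C.cyl i p) ⊓ C.subst i n (C.cyl j q) := by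
    rw [inf_comm, hC.cyl_inf_of_closed (hC.cyl_subst _ _ _ hjn),
      ← hC.subst_cyl_comm _ _ _ _ hij'.symm hjn, inf_comm,
      hC.cyl_inf_of_closed (hC.cyl_subst _ _ _ hin), ← hC.subst_cyl_comm _ _ _ _ hij' hin]
  have hpn' : C.cyl n (C.cyl i p) = C.cyl i p := hC.closed_cyl hpn
  have hqn' : C.cyl n (C.cyl j q) = C.cyl j q := hC.closed_cyl hqn
  rw [e1, ← hC.cyl_eq_bot (i := j), ← hC.cyl_eq_bot (i := i), e2]
  -- The two sides differ by the renaming of `n` to `j`, which is undone by `s_[j/n]`.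
  constructor
  · intro h
    have := congrArg (C.subst n j) h
    rw [hC.subst_inf, hC.subst_bot, hC.subst_cancel hpn', hC.subst_subst,
      hC.subst_of_closed (hC.closed_subst hin.symm hjn.symm hqn')] at this
    rw [inf_comm, this]
  · intro h
    have := congrArg (C.subst j n) h
    rw [hC.subst_inf, hC.subst_bot, hC.subst_subst, inf_comm,
      hC.subst_of_closed (hC.closed_subst hij'.symm hjn (hC.cyl_cyl j q))] at this
    exact this

end Composition

/-! ### Ultraproducts -/

section Ultraproducts

variable {K : Kind} {α : Type}

theorem Alg.pi_eval_isHom {I : Type u} (F : I → Alg.{u} K α) (k : I) :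
    Alg.IsHom (Alg.pi F) (F k) (fun x => x k) :=
  ⟨fun _ _ => rfl, fun _ _ => rfl, fun _ => rfl, rfl, rfl, fun _ _ => rfl, fun _ => rfl⟩

variable {I : Type u} {U : Ultrafilter I} {F : I → Alg.{u} K α} {B : Alg.{u} K α}
  {q : Alg.pi F → B}

/-- The quantifier step of Łoś's theorem: witnesses are chosen factor by factor, with `⊥` as a dummy
where there is none. -/
theorem los_exists (hs : Function.Surjective q) {P : B → Prop} {Q : ∀ i, F i → Prop}
    (h : ∀ x : Alg.pi F, P (q x) ↔ ∀ᶠ i in U.toFilter, Q i (x i)) :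
    (∃ b, P b) ↔ ∀ᶠ i in U.toFilter, ∃ b, Q i b := by
  classical
  constructor
  · rintro ⟨b, hb⟩
    obtain ⟨x, rfl⟩ := hs b
    exact ((h x).1 hb).mono fun i hi => ⟨_, hi⟩
  · intro hQ
    refine ⟨q fun i => if hi : ∃ b, Q i b then hi.choose else ⊥, (h _).2 (hQ.mono fun i hi => ?_)⟩
    rw [dif_pos hi]
    exact hi.choose_spec

theorem los_forall (hs : Function.Surjective q) {P : B → Prop} {Q : ∀ i, F i → Prop}
    (h : ∀ x : Alg.pi F, P (q x) ↔ ∀ᶠ i in U.toFilter, Q i (x i)) :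
    (∀ b, P b) ↔ ∀ᶠ i in U.toFilter, ∀ b, Q i b := by
  have := los_exists (U := U) hs (P := fun b => ¬ P b) (Q := fun i b => ¬ Q i b) (fun x => by
    rw [h x]
    exact Ultrafilter.eventually_not.symm)
  rw [← not_iff_not, not_forall, this, ← Ultrafilter.eventually_not]
  simp only [not_forall]

theorem los_le (hq : Alg.IsHom (Alg.pi F) B q)
    (he : ∀ x y : (∀ i, F i), q x = q y ↔ ∀ᶠ i in (U : Filter I), x i = y i) (x y : Alg.pi F) :
    q x ≤ q y ↔ ∀ᶠ i in U.toFilter, x i ≤ y i := by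
  rw [← inf_eq_left, ← hq.map_inf]
  refine (he _ _).trans ?_
  exact Filter.eventually_congr (Filter.Eventually.of_forall fun i => inf_eq_left)

theorem los_eq_bot (hq : Alg.IsHom (Alg.pi F) B q)
    (he : ∀ x y : (∀ i, F i), q x = q y ↔ ∀ᶠ i in (U : Filter I), x i = y i) (x : Alg.pi F) :
    q x = ⊥ ↔ ∀ᶠ i in U.toFilter, x i = ⊥ := by
  rw [← hq.map_bot]
  exact he _ _

theorem los_isAtom (hq : Alg.IsHom (Alg.pi F) B q) (hs : Function.Surjective q)
    (he : ∀ x y : (∀ i, F i), q x = q y ↔ ∀ᶠ i in (U : Filter I), x i = y i) (x : Alg.pi F) :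
    IsAtom (q x) ↔ ∀ᶠ i in U.toFilter, IsAtom (x i) := by
  have hat : ∀ {β : Type u} [BooleanAlgebra β] (a : β),
      IsAtom a ↔ ¬ a = ⊥ ∧ ∀ b, b ≤ a → b = ⊥ ∨ a ≤ b := by
    intro β _ a
    refine ⟨fun h => ⟨h.1, fun b hb => ?_⟩, fun h => ⟨h.1, fun b hb => ?_⟩⟩
    · rcases h.le_iff.1 hb with e | e
      · exact Or.inl e
      · exact Or.inr e.ge
    · exact (h.2 b hb.le).resolve_right hb.not_ge
  simp only [hat]
  rw [Filter.eventually_and, los_eq_bot hq he, ← Ultrafilter.eventually_not]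
  refine and_congr Iff.rfl (los_forall hs fun y => ?_)
  rw [los_le hq he, los_le hq he, los_eq_bot hq he, ← Ultrafilter.eventually_or,
    ← Ultrafilter.eventually_imp]

/-- The property is a single first-order sentence. Both directions are needed: from the factors to
the ultraproduct for `Up`, and from an ultrapower back to its factor for `Ur`. -/
theorem hasCompositions_ultraproduct {n : ℕ} {F : I → Alg.{u} K (Fin n)} {B : Alg.{u} K (Fin n)}
    (hB : IsUltraproduct U F B) (i j : Fin n) :
    HasCompositions B i j ↔ ∀ᶠ k in U.toFilter, HasCompositions (F k) i j := by
  obtain ⟨q, hq, hs, he⟩ := hB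
  refine los_forall hs fun x => los_forall hs fun y => los_exists hs fun z =>
    los_forall hs fun a => ?_
  rw [Ultrafilter.eventually_imp, Ultrafilter.eventually_imp, los_isAtom hq hs he]
  refine imp_congr_right fun _ => ?_
  have hc : ∀ (x : Alg.pi F) k, (Alg.pi F).cyl i x k = (F k).cyl i (x k) := fun _ _ => rfl
  have hc' : ∀ (x : Alg.pi F) k, (Alg.pi F).cyl j x k = (F k).cyl j (x k) := fun _ _ => rfl
  have hsub : ∀ (x : Alg.pi F) k, (Alg.pi F).subst i j x k = (F k).subst i j (x k) :=
    fun x k => (Alg.pi_eval_isHom F k).map_subst i j x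
  have hinf : ∀ (x y : Alg.pi F) k, (x ⊓ y) k = x k ⊓ y k := fun _ _ _ => rfl
  have h1 : B.cyl i (q a) ⊓ B.cyl j (q a) = q a ↔
      ∀ᶠ k in U.toFilter, (F k).cyl i (a k) ⊓ (F k).cyl j (a k) = a k := by
    rw [← hq.map_cyl, ← hq.map_cyl, ← hq.map_inf]
    exact he _ _
  have h2 : B.subst i j (B.cyl j (q y ⊓ B.cyl i (q a))) ⊓ B.cyl i (q x ⊓ B.cyl j (q a)) = ⊥ ↔
      ∀ᶠ k in U.toFilter, (F k).subst i j ((F k).cyl j (y k ⊓ (F k).cyl i (a k)))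
        ⊓ (F k).cyl i (x k ⊓ (F k).cyl j (a k)) = ⊥ := by
    rw [← hq.map_cyl, ← hq.map_cyl, ← hq.map_inf, ← hq.map_inf, ← hq.map_cyl, ← hq.map_cyl,
      ← hq.map_subst, ← hq.map_inf, los_eq_bot hq he]
    refine Filter.eventually_congr (Filter.Eventually.of_forall fun k => ?_)
    rw [← hc, ← hc', ← hinf, ← hinf, ← hc, ← hc', ← hsub, ← hinf]
  rw [h1, h2, los_le hq he, ← Ultrafilter.eventually_not]
  refine imp_congr_right fun _ => ?_
  simp only [iff_iff_implies_and_implies, Filter.eventually_and, Ultrafilter.eventually_imp]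

theorem hasCompositions_of_mem_Up_Ur_NrOmega {n : ℕ} {A : Alg.{u} K (Fin n)}
    (hA : A ∈ Up (Ur (NrOmega K n))) {i j : Fin n} (hij : i ≠ j) : HasCompositions A i j := by
  obtain ⟨I, U, F, hF, hA⟩ := hA
  rw [hasCompositions_ultraproduct hA]
  refine Filter.Eventually.of_forall fun k => ?_
  obtain ⟨J, V, B, hB, hBF⟩ := hF k
  obtain ⟨_, h⟩ := ((hasCompositions_ultraproduct hBF i j).1
    (hasCompositions_of_mem_NrOmega hB hij)).exists
  exact h

end Ultraproducts

/-! ### Set algebras that contain all singletons -/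

section Singletons

variable {K : Kind} {α : Type} [DecidableEq α] {M : Type u}

theorem setAlg_subst {B : BooleanSubalgebra (Set (α → M))} (hB : IsClosedFamily B) (i j : α)
    (X : setAlg K hB) : ((setAlg K hB).subst i j X).1 = {s | s ∘ repl i j ∈ X.1} := by
  unfold Alg.subst
  split_ifs with h1 h2 h3
  · rfl
  · subst h3
    simp only [repl_self]
    rfl
  · refine Set.ext fun s => ⟨?_, fun hs => ?_⟩
    · rintro ⟨t, ⟨h, ht⟩, hts⟩
      have e : s ∘ repl i j = t := by
        rw [comp_repl]
        funext k
        by_cases hk : k = i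
        · subst hk
          rw [Function.update_self, show t k = t j from h, hts j (Ne.symm h3)]
        · rw [Function.update_of_ne hk, hts k hk]
      change s ∘ repl i j ∈ X.1
      rwa [e]
    · refine ⟨s ∘ repl i j, ⟨?_, hs⟩, fun k hk => by rw [Function.comp_apply, repl_apply_of_ne hk]⟩
      change s (repl i j i) = s (repl i j j)
      rw [repl_apply_self, repl_apply_of_ne (Ne.symm h3)]
  · exact absurd h2 (by cases K <;> simp_all [Kind.hasSub, Kind.hasDiag])

/-- Every operator is the image operator of a relation between sequences, which allows all of them
to be treated uniformly. -/
theorem mem_un_fullSetAlg (o : UnOp K α) (X : Set (α → M)) (s : α → M) :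
    (fullSetAlg K α M).un o X s ↔ ∃ t ∈ X, (fullSetAlg K α M).un o ({t} : Set (α → M)) s := by
  rcases o with i | ⟨h, i, j⟩ | ⟨h, i, j⟩
  · constructor
    · rintro ⟨t, ht, h⟩
      exact ⟨t, ht, t, rfl, h⟩
    · rintro ⟨t, ht, _, rfl, h⟩
      exact ⟨_, ht, h⟩
  · constructor
    · intro h
      exact ⟨_, h, rfl⟩
    · rintro ⟨t, ht, rfl⟩
      exact ht
  · constructor
    · intro h
      exact ⟨_, h, rfl⟩
    · rintro ⟨t, ht, rfl⟩
      exact ht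

variable {B : BooleanSubalgebra (Set (α → M))} (hB : IsClosedFamily B)
  (hsing : ∀ s, ({s} : Set (α → M)) ∈ B)

/-- The atom `{s}`. -/
def singletonElt (K : Kind) (s : α → M) : setAlg K hB := ⟨{s}, hsing s⟩

theorem singletonElt_le_iff {s : α → M} {X : setAlg K hB} :
    singletonElt hB hsing K s ≤ X ↔ s ∈ X.1 := Set.singleton_subset_iff

theorem isAtom_singletonElt (s : α → M) : IsAtom (singletonElt hB hsing K s) := by
  refine ⟨fun h => ?_, fun X hX => ?_⟩
  · have : s ∈ (⊥ : setAlg K hB).1 := h ▸ (rfl : s ∈ (singletonElt hB hsing K s).1)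
    exact this
  · have h1 : X.1 ⊂ {s} := hX
    exact Subtype.ext (Set.ssubset_singleton_iff.1 h1)

theorem exists_mem_of_ne_bot {X : setAlg K hB} (h : X ≠ ⊥) : ∃ s, s ∈ X.1 := by
  by_contra hne
  push Not at hne
  exact h (Subtype.ext (Set.eq_empty_of_forall_notMem hne))

theorem exists_eq_singletonElt {X : setAlg K hB} (h : IsAtom X) :
    ∃ s, X = singletonElt hB hsing K s := by
  obtain ⟨s, hs⟩ := exists_mem_of_ne_bot hB h.1
  have := (singletonElt_le_iff hB hsing).2 hs
  exact ⟨s, ((h.le_iff_eq (isAtom_singletonElt hB hsing s).1).1 this).symm⟩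

include hsing

theorem setAlg_isAtomic : IsAtomic (setAlg K hB) := ⟨fun X => by
  by_cases h : X = ⊥
  · exact Or.inl h
  · obtain ⟨s, hs⟩ := exists_mem_of_ne_bot hB h
    exact Or.inr ⟨_, isAtom_singletonElt hB hsing s, (singletonElt_le_iff hB hsing).2 hs⟩⟩

theorem setAlg_completelyAdditive : (setAlg K hB).CompletelyAdditive := by
  intro o X p hX
  have hp : ∀ s ∈ p.1, ∃ x ∈ X, s ∈ x.1 := by
    intro s hs
    by_contra! hne
    have h1 : p ≤ (singletonElt hB hsing K s)ᶜ := hX.2 fun x hx => by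
      intro t ht e
      exact hne x hx ((show t = s from e) ▸ ht)
    exact h1 hs rfl
  have hmono : ∀ x y : setAlg K hB, x ≤ y → (setAlg K hB).un o x ≤ (setAlg K hB).un o y := by
    intro x y h s hs
    obtain ⟨t, ht, hts⟩ := (mem_un_fullSetAlg o _ _).1 hs
    exact (mem_un_fullSetAlg o _ _).2 ⟨t, h ht, hts⟩
  refine ⟨?_, fun b hb s hs => ?_⟩
  · rintro _ ⟨x, hx, rfl⟩
    exact hmono _ _ (hX.1 hx)
  · obtain ⟨t, ht, hts⟩ := (mem_un_fullSetAlg o _ _).1 hs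
    obtain ⟨x, hx, htx⟩ := hp t ht
    exact hb ⟨x, hx, rfl⟩ ((mem_un_fullSetAlg o _ _).2 ⟨t, htx, hts⟩)

/-- The inclusion is already complete: if `s` lies in all members of `X`, then the element `{s}` is
a lower bound of `X`. -/
theorem setAlg_mem_CRK [Nonempty M] : setAlg K hB ∈ CRK K α := by
  refine ⟨M, PUnit, fun _ => Set.univ, ⟨⟨⟩⟩, fun _ => Set.univ_nonempty,
    fun i j h => absurd (Subsingleton.elim i j) h, fun X => {s | s.1 ∈ X.1}, ?_, ?_, ?_⟩
  · refine ⟨fun _ _ => rfl, fun _ _ => rfl, fun _ => rfl, rfl, rfl, ?_, ?_⟩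
    · rintro (i | ⟨h, i, j⟩ | ⟨h, i, j⟩) X
      · refine Set.ext fun s => ⟨?_, ?_⟩
        · rintro ⟨t, ht, h⟩
          exact ⟨⟨t, ⟨⟩, fun _ => trivial⟩, ht, h⟩
        · rintro ⟨t, ht, h⟩
          exact ⟨t.1, ht, h⟩
      · rfl
      · rfl
    · rintro ⟨h, i, j⟩
      rfl
  · intro X Y h
    refine Subtype.ext (Set.ext fun s => ?_)
    exact Set.ext_iff.1 h ⟨s, ⟨⟩, fun _ => trivial⟩
  · intro X p hp
    refine Set.ext fun s => ?_
    rw [Set.mem_iInter₂]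
    refine ⟨fun hs x hx => hp.1 hx hs, fun hs => ?_⟩
    exact (singletonElt_le_iff hB hsing).1
      (hp.2 fun x hx => (singletonElt_le_iff hB hsing).2 (hs x hx))

/-- The atoms are the singletons, so the complex algebra is the full set algebra on `M`. -/
theorem setAlg_Cm_At_mem_RK : Cm (At (setAlg K hB)) ∈ RK K α := by
  let at' : (α → M) → (At (setAlg K hB)).carrier := fun s =>
    ⟨singletonElt hB hsing K s, isAtom_singletonElt hB hsing s⟩
  have hat : ∀ a : (At (setAlg K hB)).carrier, ∃ s, a = at' s := fun a => by
    obtain ⟨s, hs⟩ := exists_eq_singletonElt hB hsing a.2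
    exact ⟨s, Subtype.ext hs⟩
  refine ⟨PUnit, fun _ => M, fun (Y : Set (At (setAlg K hB)).carrier) _ => {s | at' s ∈ Y},
    ?_, ?_⟩
  · refine ⟨fun _ _ => rfl, fun _ _ => rfl, fun _ => rfl, rfl, rfl, ?_, ?_⟩
    · intro o Y
      funext _
      refine Set.ext fun s => ?_
      refine Iff.trans ?_ (mem_un_fullSetAlg o _ _).symm
      constructor
      · rintro ⟨b, hb, h⟩
        obtain ⟨t, rfl⟩ := hat b
        exact ⟨t, hb, (singletonElt_le_iff hB hsing).1 h⟩
      · rintro ⟨t, ht, h⟩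
        exact ⟨at' t, ht, (singletonElt_le_iff hB hsing).2 h⟩
    · intro d
      funext _
      refine Set.ext fun s => ?_
      exact singletonElt_le_iff hB hsing
  · intro Y Z h
    refine Set.ext fun a => ?_
    obtain ⟨s, rfl⟩ := hat a
    exact Set.ext_iff.1 (congrFun h ⟨⟩) s

end Singletons

/-! ### Countably generated set algebras -/

section Generated

variable {α : Type} [DecidableEq α] {M : Type u}

/-- The closure of a family of sets of sequences under all operations. -/
inductive Generated (G : Set (Set (α → M))) : Set (α → M) → Prop
  | base (X) : X ∈ G → Generated G X
  | compl (X) : Generated G X → Generated G Xᶜ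
  | inter (X Y) : Generated G X → Generated G Y → Generated G (X ∩ Y)
  | cyl (i X) : Generated G X → Generated G (cylSet i X)
  | sub (i j X) : Generated G X → Generated G {s | s ∘ repl i j ∈ X}
  | swap (i j X) : Generated G X → Generated G {s | s ∘ Equiv.swap i j ∈ X}
  | diag (i j) : Generated G {s | s i = s j}

/-- The Boolean algebra of the generated sets. -/
def generatedFamily (i : α) (G : Set (Set (α → M))) : BooleanSubalgebra (Set (α → M)) where
  carrier := {X | Generated G X}
  supClosed' X hX Y hY := by
    have := ((hX.compl X).inter _ _ (hY.compl Y)).compl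
    rwa [← Set.compl_union, compl_compl] at this
  infClosed' X hX Y hY := hX.inter X Y hY
  compl_mem' {X} hX := hX.compl X
  bot_mem' := by
    have := (Generated.diag i i : Generated G _).compl
    simpa using this

theorem generatedFamily_isClosed (i : α) (G : Set (Set (α → M))) :
    IsClosedFamily (generatedFamily i G) :=
  ⟨fun i X => Generated.cyl i X, fun i j X => Generated.sub i j X,
    fun i j X => Generated.swap i j X, fun i j => Generated.diag i j⟩

/-- The sets obtained from the members of `S` by at most one operation. -/
def oneStep (S : Set (Set (α → M))) : Set (Set (α → M)) :=
  S ∪ compl '' S ∪ Set.image2 (· ∩ ·) S S ∪ (⋃ i, cylSet i '' S) ∪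
    (⋃ i, ⋃ j, (fun X => {s | s ∘ repl i j ∈ X}) '' S) ∪
    (⋃ i, ⋃ j, (fun X => {s | s ∘ Equiv.swap i j ∈ X}) '' S) ∪
    Set.range fun p : α × α => {s | s p.1 = s p.2}

theorem countable_generated [Countable α] {G : Set (Set (α → M))} (hG : G.Countable) :
    {X | Generated G X}.Countable := by
  have hc : ∀ k : ℕ, (oneStep^[k] G).Countable := by
    intro k
    induction k with
    | zero => exact hG
    | succ k ih =>
      rw [Function.iterate_succ_apply']
      exact ((((((ih.union (ih.image _)).union (ih.image2 ih _)).union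
        (Set.countable_iUnion fun i => ih.image _)).union
        (Set.countable_iUnion fun i => Set.countable_iUnion fun j => ih.image _)).union
        (Set.countable_iUnion fun i => Set.countable_iUnion fun j => ih.image _)).union
        (Set.countable_range _))
  have hsub : ∀ S : Set (Set (α → M)), S ⊆ oneStep S := fun S X hX => by simp [oneStep, hX]
  have hmono : Monotone fun k => oneStep^[k] G := by
    refine monotone_nat_of_le_succ fun k => ?_
    rw [Function.iterate_succ_apply']
    exact hsub _
  refine (Set.countable_iUnion hc).mono fun X hX => ?_
  rw [Set.mem_iUnion]
  have hstep : ∀ {X Y : Set (α → M)}, (∃ k, X ∈ oneStep^[k] G) →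
      (∀ S : Set (Set (α → M)), X ∈ S → Y ∈ oneStep S) → ∃ k, Y ∈ oneStep^[k] G := by
    rintro X Y ⟨k, hk⟩ h
    exact ⟨k + 1, by rw [Function.iterate_succ_apply']; exact h _ hk⟩
  induction hX with
  | base X hX => exact ⟨0, hX⟩
  | compl X _ ih => exact hstep ih fun S hS => by simp [oneStep, hS]
  | inter X Y _ _ ih1 ih2 =>
    obtain ⟨k, hk⟩ := ih1
    obtain ⟨l, hl⟩ := ih2
    refine ⟨max k l + 1, ?_⟩
    rw [Function.iterate_succ_apply']
    refine Or.inl (Or.inl (Or.inl (Or.inl (Or.inr ⟨X, hmono (le_max_left k l) hk, Y,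
      hmono (le_max_right k l) hl, rfl⟩))))
  | cyl i X _ ih =>
    exact hstep ih fun S hS =>
      Or.inl (Or.inl (Or.inl (Or.inr (Set.mem_iUnion.2 ⟨i, X, hS, rfl⟩))))
  | sub i j X _ ih =>
    exact hstep ih fun S hS =>
      Or.inl (Or.inl (Or.inr (Set.mem_iUnion₂.2 ⟨i, j, X, hS, rfl⟩)))
  | swap i j X _ ih =>
    exact hstep ih fun S hS => Or.inl (Or.inr (Set.mem_iUnion₂.2 ⟨i, j, X, hS, rfl⟩))
  | diag i j =>
    exact ⟨1, Or.inr ⟨(i, j), rfl⟩⟩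

end Generated

/-! ### A countable completely representable algebra without compositions -/

section Sorted

variable {n : ℕ}

/-- The sequences whose `k`-th entry is of sort `k`. -/
def sortedBox (n : ℕ) : Set (Fin n → ℤ × ℕ) := {s | ∀ k, (s k).2 = k}

/-- On `sortedBox n`, the set `Y` is determined by finite colourings `χ k` that do not depend on
the coordinate `k`. -/
def IsLowDim (Y : Set (Fin n → ℤ × ℕ)) : Prop :=
  ∃ (κ : Type) (_ : Finite κ) (χ : Fin n → (Fin n → ℤ × ℕ) → κ),
    (∀ k s u, χ k (Function.update s k u) = χ k s) ∧
    ∀ s s', s ∈ sortedBox n → s' ∈ sortedBox n → (∀ k, χ k s = χ k s') → s ∈ Y → s' ∈ Y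

theorem IsLowDim.compl {Y : Set (Fin n → ℤ × ℕ)} (h : IsLowDim Y) : IsLowDim Yᶜ := by
  obtain ⟨κ, hκ, χ, h1, h2⟩ := h
  exact ⟨κ, hκ, χ, h1, fun s s' hs hs' h hY hY' => hY (h2 s' s hs' hs (fun k => (h k).symm) hY')⟩

theorem IsLowDim.inter {Y Z : Set (Fin n → ℤ × ℕ)} (h : IsLowDim Y) (h' : IsLowDim Z) :
    IsLowDim (Y ∩ Z) := by
  obtain ⟨κ, hκ, χ, h1, h2⟩ := h
  obtain ⟨κ', hκ', χ', h1', h2'⟩ := h'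
  refine ⟨κ × κ', inferInstance, fun k s => (χ k s, χ' k s), fun k s u => Prod.ext (h1 k s u) (h1' k s u),
    fun s s' hs hs' h hY => ⟨h2 s s' hs hs' (fun k => (Prod.ext_iff.1 (h k)).1) hY.1,
      h2' s s' hs hs' (fun k => (Prod.ext_iff.1 (h k)).2) hY.2⟩⟩

/-- The colouring for `m` is membership in `Y`; all others are constant. -/
theorem isLowDim_of_independent {Y : Set (Fin n → ℤ × ℕ)} (m : Fin n)
    (h : ∀ s u, Function.update s m u ∈ Y ↔ s ∈ Y) : IsLowDim Y := by
  refine ⟨Prop, inferInstance, fun k s => k = m → s ∈ Y, fun k s u => ?_,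
    fun s s' _ _ hk hs => cast (hk m) (fun _ => hs) rfl⟩
  refine propext (forall_congr' fun hk => ?_)
  subst hk
  exact h s u

theorem isLowDim_of_disjoint {Y : Set (Fin n → ℤ × ℕ)} (h : ∀ s ∈ sortedBox n, s ∉ Y) :
    IsLowDim Y :=
  ⟨Unit, inferInstance, fun _ _ => (), fun _ _ _ => rfl, fun s _ hs _ _ hY => absurd hY (h s hs)⟩

/-- Each colouring compares with `p` away from its own coordinate. Two of them together see every
coordinate, which is where `1 < n` enters. -/
theorem isLowDim_of_eq_sequence (hn : 1 < n) (p : Fin n → ℤ × ℕ) : IsLowDim {p} := by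
  refine ⟨Prop, inferInstance, fun k s => ∀ l, l ≠ k → s l = p l, fun k s u => ?_,
    fun s s' _ _ h hs => ?_⟩
  · refine propext (forall₂_congr fun l hl => ?_)
    rw [Function.update_of_ne hl]
  · have h' : ∀ k l, l ≠ k → s' l = p l := fun k =>
      cast (h k) fun l _ => congrFun (show s = p from hs) l
    refine funext fun l => ?_
    by_cases hl : l = ⟨0, by omega⟩
    · exact h' ⟨1, hn⟩ l (by rw [hl]; simp)
    · exact h' _ l hl

/-- `IsLowDim` for all permuted copies of a set. -/
def IsHereditarilyLowDim (X : Set (Fin n → ℤ × ℕ)) : Prop :=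
  ∀ σ : Equiv.Perm (Fin n), IsLowDim {s | s ∘ σ ∈ X}

theorem update_comp_perm (σ : Equiv.Perm (Fin n)) (s : Fin n → ℤ × ℕ) (i : Fin n) (u : ℤ × ℕ) :
    Function.update s (σ i) u ∘ σ = Function.update (s ∘ σ) i u := by
  funext k
  by_cases hk : k = i
  · subst hk; simp
  · have : σ k ≠ σ i := fun e => hk (σ.injective e)
    simp [hk, this]

/-- A cylindrification or proper replacement yields a set independent of a coordinate, whatever it
is applied to. Diagonals are empty on the box because distinct coordinates carry distinct sorts.
Transpositions are the reason for considering all permuted copies. -/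
theorem Generated.isHereditarilyLowDim {G : Set (Set (Fin n → ℤ × ℕ))}
    (hG : ∀ X ∈ G, IsHereditarilyLowDim X) {X : Set (Fin n → ℤ × ℕ)} (hX : Generated G X) :
    IsHereditarilyLowDim X := by
  induction hX with
  | base X hX => exact hG X hX
  | compl X _ ih => exact fun σ => (ih σ).compl
  | inter X Y _ _ ih1 ih2 => exact fun σ => (ih1 σ).inter (ih2 σ)
  | cyl i X _ _ =>
    refine fun σ => isLowDim_of_independent (σ i) fun s u => ?_
    simp only [Set.mem_ofPred_eq, update_comp_perm, mem_cylSet_iff, Function.update_idem]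
  | sub i j X _ ih =>
    by_cases hij : i = j
    · subst hij
      simpa only [repl_self, Function.comp_id, Set.ofPred_mem_eq] using ih
    · refine fun σ => isLowDim_of_independent (σ i) fun s u => ?_
      simp only [Set.mem_ofPred_eq, update_comp_perm, comp_repl, Function.update_idem]
      rw [Function.update_of_ne (Ne.symm hij)]
  | swap i j X _ ih =>
    intro σ
    exact ih (σ * Equiv.swap i j)
  | diag i j =>
    intro σ
    by_cases hij : i = j
    · subst hij
      exact isLowDim_of_independent i fun s u => iff_of_true rfl rfl
    · refine isLowDim_of_disjoint fun s hs h => hij ?_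
      have h' : (s (σ i)).2 = (s (σ j)).2 := congrArg Prod.snd h
      rw [hs, hs] at h'
      exact σ.injective (Fin.ext h')

theorem isHereditarilyLowDim_singleton (hn : 1 < n) (p : Fin n → ℤ × ℕ) :
    IsHereditarilyLowDim {p} := by
  intro σ
  have : {s : Fin n → ℤ × ℕ | s ∘ σ ∈ ({p} : Set (Fin n → ℤ × ℕ))} = {p ∘ σ.symm} := by
    ext s
    simp only [Set.mem_ofPred_eq, Set.mem_singleton_iff]
    exact (Equiv.eq_comp_symm σ s p).symm
  rw [this]
  exact isLowDim_of_eq_sequence hn _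

/-- The sort `n` does not occur in the box. The sum and negation relations are thus invisible there,
and only their composition would show. -/
theorem isHereditarilyLowDim_of_sort {X : Set (Fin n → ℤ × ℕ)} (k : Fin n)
    (h : ∀ s ∈ X, (s k).2 = n) : IsHereditarilyLowDim X := by
  refine fun σ => isLowDim_of_disjoint fun s hs hX => ?_
  have := h _ hX
  rw [Function.comp_apply, hs] at this
  exact (σ k).2.ne this

/-- By Gallai's theorem, the hyperplane `∑ k, s k = 0` is not determined by finite colourings
that depend on proper subsets of the coordinates. -/
theorem not_isLowDim_hyperplane (hn : 0 < n) {Z : Set (Fin n → ℤ × ℕ)}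
    (hZ : ∀ s ∈ sortedBox n, s ∈ Z ↔ ∑ k, (s k).1 = 0) : ¬ IsLowDim Z := by
  rintro ⟨κ, hκ, χ, hχ, hdet⟩
  let e : Fin n → Fin n → ℤ := fun i => Pi.single i 1
  let o : Fin n := ⟨0, hn⟩
  let T : (Fin n → ℤ) → Fin n → ℤ × ℕ := fun v k => (v k, k)
  -- The map `π` projects onto the hyperplane along coordinate `o`.
  let π : (Fin n → ℤ) → Fin n → ℤ := fun v => v - Pi.single o (∑ k, v k)
  have hT : ∀ v, T v ∈ sortedBox n := fun v k => rfl
  -- Gallai's theorem, applied to the joint colouring pulled back along `π`, gives `a > 0` and `q`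
  -- with coordinate sum `a` such that all the points `q - a • e i` of the hyperplane have the same
  -- colours.
  obtain ⟨a, ha, b, c, hc⟩ := Combinatorics.exists_mono_homothetic_copy
    (Finset.univ.image fun i => e o - e i) (fun v k => χ k (T (π v)))
  have hsum : ∀ i, ∑ k, e i k = 1 := fun i => by simp [e]
  let q : Fin n → ℤ := a • e o + b - Pi.single o (∑ k, b k)
  have hp : ∀ i, π (a • (e o - e i) + b) = q - a • e i := by
    intro i
    have h1 : ∑ k, (a • (e o - e i) + b) k = ∑ k, b k := by
      simp only [Pi.add_apply, Pi.smul_apply, Pi.sub_apply, Finset.sum_add_distrib,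
        ← Finset.smul_sum, Finset.sum_sub_distrib, hsum, sub_self, smul_zero, zero_add]
    simp only [π, q]
    rw [h1, smul_sub]
    abel
  have hqsum : ∑ k, q k = a := by
    simp only [q, Pi.add_apply, Pi.smul_apply, Pi.sub_apply, Finset.sum_add_distrib,
        ← Finset.smul_sum, Finset.sum_sub_distrib, hsum]
    simp
  have hcol : ∀ i k, χ k (T (q - a • e i)) = c k := by
    intro i k
    rw [← hp, ← hc _ (Finset.mem_image_of_mem _ (Finset.mem_univ i))]
  -- The point `q` differs from `q - a • e i` only in coordinate `i`, which `χ i` ignores. So `q`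
  -- has the same colours although it is off the hyperplane.
  have hq : ∀ i, χ i (T q) = c i := by
    intro i
    rw [← hcol i i, ← hχ i (T (q - a • e i)) (q i, i)]
    congr 1
    funext k
    by_cases hk : k = i
    · subst hk; simp [T]
    · simp [T, e, hk]
  have hmem : T (q - a • e o) ∈ Z := by
    rw [hZ _ (hT _)]
    simp only [T, Pi.sub_apply, Pi.smul_apply, Finset.sum_sub_distrib, ← Finset.smul_sum, hsum,
      hqsum]
    simp
  have := hdet _ _ (hT _) (hT q) (fun k => by rw [hcol, hq]) hmem
  rw [hZ _ (hT _)] at this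
  have h0 : (a : ℤ) = 0 := hqsum ▸ this
  omega

/-- The sequences whose coordinate `j` is the sum of the other coordinates and is of sort `n`. -/
def sumRel (j : Fin n) : Set (Fin n → ℤ × ℕ) :=
  {s | (s j).2 = n ∧ (∀ k, k ≠ j → (s k).2 = k) ∧ (s j).1 = ∑ k ∈ Finset.univ.erase j, (s k).1}

/-- The sequences whose coordinate `i` is minus the coordinate `j` and is of sort `n`. -/
def negRel (i j : Fin n) : Set (Fin n → ℤ × ℕ) :=
  {s | (s i).2 = n ∧ (∀ k, k ≠ i → (s k).2 = k) ∧ (s i).1 = - (s j).1}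

/-- The generators of the algebra. -/
def sortedGenerators (i j : Fin n) : Set (Set (Fin n → ℤ × ℕ)) :=
  insert (sumRel j) (insert (negRel i j) (Set.range fun s => {s}))

/-- The composition of `sumRel` and `negRel`, on `sortedBox n`. -/
theorem composition_iff {i j : Fin n} (hij : i ≠ j) {s : Fin n → ℤ × ℕ} (hs : s ∈ sortedBox n) :
    (∃ w, w ∘ repl i j ∈ cylSet j (negRel i j ∩ cylSet i {s}) ∧
      w ∈ cylSet i (sumRel j ∩ cylSet j {s})) ↔ ∑ k, (s k).1 = 0 := by
  have hsum := Finset.add_sum_erase Finset.univ (fun k => (s k).1) (Finset.mem_univ j)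
  constructor
  · rintro ⟨w, ⟨r, ⟨hr, s', hs', hsr⟩, hrw⟩, v, ⟨hv, s'', hs'', hsv⟩, hvw⟩
    rw [Set.mem_singleton_iff] at hs' hs''
    rw [hs'] at hsr
    rw [hs''] at hsv
    have e1 : r i = v j := by
      rw [hrw i hij, Function.comp_apply, repl_apply_self, hvw j hij.symm]
    have e2 : (v j).1 = ∑ k ∈ Finset.univ.erase j, (s k).1 := by
      rw [hv.2.2]
      exact Finset.sum_congr rfl fun k hk => by rw [hsv k (Finset.ne_of_mem_erase hk)]
    have e3 : (r i).1 = - (s j).1 := by rw [hr.2.2, hsr j hij.symm]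
    rw [e1, e2] at e3
    omega
  · intro h
    -- The intermediate value is minus the entry at `j`, which on the hyperplane is the sum of the
    -- other entries; it gets sort `n`.
    have ht : - (s j).1 = ∑ k ∈ Finset.univ.erase j, (s k).1 := by omega
    have hneg : Function.update s i (-(s j).1, n) ∈ negRel i j := by
      refine ⟨by simp, fun k hk => by simp [hk, hs k], by simp [hij.symm]⟩
    have hpos : Function.update s j (-(s j).1, n) ∈ sumRel j := by
      refine ⟨by simp, fun k hk => by simp [hk, hs k], ?_⟩
      rw [Function.update_self]
      refine ht.trans (Finset.sum_congr rfl fun k hk => ?_)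
      rw [Function.update_of_ne (Finset.ne_of_mem_erase hk)]
    refine ⟨Function.update s j (-(s j).1, n), ⟨_, ⟨hneg, s, rfl, fun k hk => by simp [hk]⟩, ?_⟩,
      _, ⟨hpos, s, rfl, fun k hk => by simp [hk]⟩, fun _ _ => rfl⟩
    intro k hk
    rw [comp_repl]
    by_cases hki : k = i
    · subst hki; simp
    · simp [hki, hk]

end Sorted

/-- All singletons are atoms determined by two projections, so a composition of `sumRel j` and
`negRel i j` in the algebra would coincide with the hyperplane on the sorted box. -/
theorem exists_CRK_not_mem_Up_Ur_NrOmega (K : Kind) {n : ℕ} (hn : 1 < n) :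
    ∃ A : Alg.{0} K (Fin n), A ∈ CRK K (Fin n) ∧ Countable A ∧ StronglyRepresentable A ∧
      A ∉ NrOmega K n ∧ A ∉ Up (Ur (NrOmega K n)) := by
  let i : Fin n := ⟨0, by omega⟩
  let j : Fin n := ⟨1, hn⟩
  have hij : i ≠ j := by simp [i, j]
  let B := generatedFamily i (sortedGenerators i j)
  have hB : IsClosedFamily B := generatedFamily_isClosed _ _
  have hsing : ∀ s, ({s} : Set (Fin n → ℤ × ℕ)) ∈ B := fun s =>
    Generated.base _ (Or.inr (Or.inr ⟨s, rfl⟩))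
  have hlow : ∀ X ∈ B, IsHereditarilyLowDim X := fun X hX =>
    Generated.isHereditarilyLowDim (by
      rintro X (rfl | rfl | ⟨s, rfl⟩)
      · exact isHereditarilyLowDim_of_sort j fun s hs => hs.1
      · exact isHereditarilyLowDim_of_sort i fun s hs => hs.1
      · exact isHereditarilyLowDim_singleton hn s) hX
  have hnot : ¬ HasCompositions (setAlg K hB) i j := by
    intro h
    obtain ⟨z, hz⟩ := h ⟨sumRel j, Generated.base _ (Or.inl rfl)⟩
      ⟨negRel i j, Generated.base _ (Or.inr (Or.inl rfl))⟩
    refine not_isLowDim_hyperplane (by omega) (fun s hs => ?_) (hlow z.1 z.2 1)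
    have hrect : (setAlg K hB).cyl i (singletonElt hB hsing K s)
        ⊓ (setAlg K hB).cyl j (singletonElt hB hsing K s) = singletonElt hB hsing K s := by
      refine Subtype.ext (Set.ext fun t => ⟨?_, ?_⟩)
      · rintro ⟨⟨_, rfl, h1⟩, _, rfl, h2⟩
        refine funext fun k => ?_
        by_cases hk : k = i
        · subst hk; exact (h2 _ hij).symm
        · exact (h1 k hk).symm
      · rintro rfl
        exact ⟨⟨_, rfl, fun _ _ => rfl⟩, _, rfl, fun _ _ => rfl⟩
    have h1 := hz _ (isAtom_singletonElt hB hsing s) hrect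
    rw [singletonElt_le_iff] at h1
    refine Iff.trans h1 (Iff.trans ?_ (composition_iff hij hs))
    rw [← ne_eq]
    refine Iff.trans ⟨exists_mem_of_ne_bot hB, ?_⟩ (exists_congr fun w => and_congr ?_ Iff.rfl)
    · rintro ⟨w, hw⟩ e
      rw [e] at hw
      exact hw
    · exact Set.ext_iff.1 (setAlg_subst hB i j _) w
  refine ⟨setAlg K hB, setAlg_mem_CRK hB hsing, ?_, ⟨setAlg_isAtomic hB hsing,
    setAlg_completelyAdditive hB hsing, setAlg_Cm_At_mem_RK hB hsing⟩,
    fun h => hnot (hasCompositions_of_mem_NrOmega h hij),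
    fun h => hnot (hasCompositions_of_mem_Up_Ur_NrOmega h hij)⟩
  refine (countable_generated (G := sortedGenerators i j) ?_).to_subtype
  exact ((Set.countable_range _).insert _).insert _

/-! ### The algebra of tame sets of sequences in a coloured binary tree -/

section Tame

/-- `x` and `y` have the same first `a` entries. -/
def Agree (a : ℕ) (x y : ℕ → Bool) : Prop := ∀ b < a, x b = y b

theorem Agree.symm {a : ℕ} {x y : ℕ → Bool} (h : Agree a x y) : Agree a y x :=
  fun b hb => (h b hb).symm

theorem Agree.trans {a : ℕ} {x y z : ℕ → Bool} (h : Agree a x y) (h' : Agree a y z) :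
    Agree a x z := fun b hb => (h b hb).trans (h' b hb)

theorem agree_comm {a : ℕ} {x y : ℕ → Bool} : Agree a x y ↔ Agree a y x :=
  ⟨Agree.symm, Agree.symm⟩

theorem agree_succ {a : ℕ} {x y : ℕ → Bool} : Agree (a + 1) x y ↔ Agree a x y ∧ x a = y a := by
  refine ⟨fun h => ⟨fun b hb => h b (by omega), h a (by omega)⟩, fun h b hb => ?_⟩
  rcases Nat.lt_succ_iff_lt_or_eq.1 hb with hb | rfl
  · exact h.1 b hb
  · exact h.2

theorem exists_agree_notMem (N : ℕ) (y : ℕ → Bool) (F : Finset (ℕ → Bool)) :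
    ∃ x, Agree N x y ∧ x ∉ F := by
  have hinj : Function.Injective fun (m b : ℕ) => if b < N then y b else decide (b = N + m) := by
    intro m m' h
    have := congrFun h (N + m)
    simpa using this
  obtain ⟨x, ⟨m, rfl⟩, hx⟩ := (Set.infinite_range_of_injective hinj).exists_notMem_finset F
  exact ⟨_, fun b hb => by simp [hb], hx⟩

/-- The binary tree is homogeneous. -/
theorem exists_agree_extension {α : Type} {S : Finset α} {N : ℕ} {s s' : α → ℕ → Bool}
    (h : ∀ k ∈ S, ∀ l ∈ S, ∀ a ≤ N, Agree a (s k) (s l) ↔ Agree a (s' k) (s' l))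
    (y : ℕ → Bool) : ∃ y', ∀ l ∈ S, ∀ a ≤ N, Agree a y (s l) ↔ Agree a y' (s' l) := by
  classical
  -- At each level `y'` follows or leaves `s' k` as `y` does `s k`, for some `k` whose branch still
  -- agrees with `y`. The hypothesis makes the choice of `k` immaterial; if there is none, the value
  -- is arbitrary.
  let y' : ℕ → Bool := fun a => if hk : ∃ k ∈ S, Agree a y (s k) then
    ((y a).xor (s hk.choose a)).xor (s' hk.choose a) else false
  refine ⟨y', fun l hl a => ?_⟩
  induction a with
  | zero => exact fun _ => iff_of_true (fun b hb => by omega) (fun b hb => by omega)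
  | succ a ih =>
    intro ha
    rw [agree_succ, agree_succ, ← ih (by omega)]
    refine and_congr_right fun hal => ?_
    have hk : ∃ k ∈ S, Agree a y (s k) := ⟨l, hl, hal⟩
    have hy' : y' a = ((y a).xor (s hk.choose a)).xor (s' hk.choose a) := dif_pos hk
    have h1 := h _ hk.choose_spec.1 l hl
    have h2 : Agree a (s hk.choose) (s l) := hk.choose_spec.2.symm.trans hal
    have h3 := h1 (a + 1) ha
    rw [agree_succ, agree_succ, ← h1 a (by omega), and_iff_right h2, and_iff_right h2] at h3
    rw [hy']
    revert h3
    generalize y a = b1, s hk.choose a = b2, s' hk.choose a = b3, s l a = b4, s' l a = b5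
    revert b1 b2 b3 b4 b5
    decide

variable {I : Type} {α β : Type}

/-- On the coordinates in `S`, the sequences `s` and `s'` have the same equalities, the same
agreements up to level `N`, and the same colours from `F`. -/
def Sim (N : ℕ) (F : Finset I) (S : Finset α) (s s' : α → (ℕ → Bool) × I) : Prop :=
  ∀ k ∈ S, (∀ c ∈ F, (s k).2 = c ↔ (s' k).2 = c) ∧
    ∀ l ∈ S, (s k = s l ↔ s' k = s' l) ∧
      ∀ a ≤ N, Agree a (s k).1 (s l).1 ↔ Agree a (s' k).1 (s' l).1

theorem Sim.symm {N : ℕ} {F : Finset I} {S : Finset α} {s s' : α → (ℕ → Bool) × I}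
    (h : Sim N F S s s') : Sim N F S s' s := fun k hk =>
  ⟨fun c hc => ((h k hk).1 c hc).symm, fun l hl => ⟨((h k hk).2 l hl).1.symm,
    fun a ha => (((h k hk).2 l hl).2 a ha).symm⟩⟩

theorem Sim.mono {N N' : ℕ} {F F' : Finset I} {S S' : Finset α} {s s' : α → (ℕ → Bool) × I}
    (h : Sim N' F' S' s s') (hN : N ≤ N') (hF : F ⊆ F') (hS : S ⊆ S') : Sim N F S s s' :=
  fun k hk => ⟨fun c hc => (h k (hS hk)).1 c (hF hc), fun l hl => ⟨((h k (hS hk)).2 l (hS hl)).1,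
    fun a ha => ((h k (hS hk)).2 l (hS hl)).2 a (ha.trans hN)⟩⟩

theorem Sim.comp [DecidableEq α] {N : ℕ} {F : Finset I} {S : Finset β} (τ : β → α)
    {s s' : α → (ℕ → Bool) × I} (h : Sim N F (S.image τ) s s') : Sim N F S (s ∘ τ) (s' ∘ τ) :=
  fun _ hk => ⟨(h _ (Finset.mem_image_of_mem τ hk)).1, fun _ hl =>
    (h _ (Finset.mem_image_of_mem τ hk)).2 _ (Finset.mem_image_of_mem τ hl)⟩

theorem sim_of_eqOn {N : ℕ} {F : Finset I} {S : Finset α} {s s' : α → (ℕ → Bool) × I}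
    (h : ∀ k ∈ S, s k = s' k) : Sim N F S s s' := fun k hk =>
  ⟨fun c _ => by rw [h k hk], fun l hl => ⟨by rw [h k hk, h l hl], fun a _ => by
    rw [h k hk, h l hl]⟩⟩

/-- This back-and-forth step makes tame sets closed under cylindrifiers. If `u` is an entry of `s`,
the matching entry of `s'` is used. Otherwise a branch is found by homogeneity of the tree and
altered from level `N` on to differ from all entries, with the colour of `u` kept. -/
theorem Sim.exists_update [DecidableEq α] {N : ℕ} {F : Finset I} {S : Finset α}
    {s s' : α → (ℕ → Bool) × I} {i : α} (h : Sim N F (S.erase i) s s') (u : (ℕ → Bool) × I) :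
    ∃ u', Sim N F S (Function.update s i u) (Function.update s' i u') := by
  classical
  suffices H : ∃ u' : (ℕ → Bool) × I, (∀ c ∈ F, u.2 = c ↔ u'.2 = c) ∧
      ∀ l ∈ S.erase i, (u = s l ↔ u' = s' l) ∧
        ∀ a ≤ N, Agree a u.1 (s l).1 ↔ Agree a u'.1 (s' l).1 by
    obtain ⟨u', hc, hu⟩ := H
    refine ⟨u', fun k hk => ?_⟩
    by_cases hki : k = i
    · subst hki
      simp only [Function.update_self]
      refine ⟨hc, fun l hl => ?_⟩
      by_cases hlk : l = k
      · subst hlk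
        simp only [Function.update_self]
        exact ⟨trivial, fun a _ => iff_of_true (fun _ _ => rfl) (fun _ _ => rfl)⟩
      · simp only [Function.update_of_ne hlk]
        exact hu l (Finset.mem_erase.2 ⟨hlk, hl⟩)
    · have hk' := Finset.mem_erase.2 ⟨hki, hk⟩
      simp only [Function.update_of_ne hki]
      refine ⟨(h k hk').1, fun l hl => ?_⟩
      by_cases hli : l = i
      · subst hli
        simp only [Function.update_self]
        exact ⟨by rw [eq_comm, (hu k hk').1, eq_comm], fun a ha => by
          rw [agree_comm, (hu k hk').2 a ha, agree_comm]⟩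
      · simp only [Function.update_of_ne hli]
        exact (h k hk').2 l (Finset.mem_erase.2 ⟨hli, hl⟩)
  by_cases hex : ∃ k ∈ S.erase i, u = s k
  · obtain ⟨k, hk, rfl⟩ := hex
    exact ⟨s' k, (h k hk).1, (h k hk).2⟩
  · push Not at hex
    obtain ⟨y, hy⟩ := exists_agree_extension (s := fun k => (s k).1) (s' := fun k => (s' k).1)
      (fun k hk l hl a ha => ((h k hk).2 l hl).2 a ha) u.1
    obtain ⟨x, hx, hxF⟩ := exists_agree_notMem N y ((S.erase i).image fun k => (s' k).1)
    refine ⟨(x, u.2), fun c _ => Iff.rfl, fun l hl => ⟨iff_of_false (hex l hl) fun e => ?_,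
      fun a ha => ?_⟩⟩
    · exact hxF (Finset.mem_image.2 ⟨l, hl, by rw [← e]⟩)
    · rw [hy l hl a ha]
      have hxy : Agree a x y := fun b hb => hx b (by omega)
      exact ⟨fun h => hxy.trans h, fun h => hxy.symm.trans h⟩

/-- The sets of sequences that are invariant under some `Sim N F S`. -/
def IsTame (X : Set (α → (ℕ → Bool) × I)) : Prop :=
  ∃ (N : ℕ) (F : Finset I) (S : Finset α), ∀ s s', Sim N F S s s' → s ∈ X → s' ∈ X

theorem IsTame.comp [DecidableEq α] {X : Set (β → (ℕ → Bool) × I)} (hX : IsTame X) (τ : β → α) :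
    IsTame {s : α → (ℕ → Bool) × I | s ∘ τ ∈ X} := by
  obtain ⟨N, F, S, h⟩ := hX
  exact ⟨N, F, S.image τ, fun s s' hs => h _ _ (hs.comp τ)⟩

theorem IsTame.union {X Y : Set (α → (ℕ → Bool) × I)} (hX : IsTame X) (hY : IsTame Y) :
    IsTame (X ∪ Y) := by
  classical
  obtain ⟨N, F, S, h⟩ := hX
  obtain ⟨N', F', S', h'⟩ := hY
  exact ⟨max N N', F ∪ F', S ∪ S', fun s s' hs hm => hm.imp
    (h _ _ (hs.mono (le_max_left _ _) Finset.subset_union_left Finset.subset_union_left))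
    (h' _ _ (hs.mono (le_max_right _ _) Finset.subset_union_right Finset.subset_union_right))⟩

theorem IsTame.compl {X : Set (α → (ℕ → Bool) × I)} (hX : IsTame X) : IsTame Xᶜ := by
  obtain ⟨N, F, S, h⟩ := hX
  exact ⟨N, F, S, fun s s' hs hm hm' => hm (h _ _ hs.symm hm')⟩

variable (I α) in
/-- The Boolean algebra of tame sets. -/
def tameFamily : BooleanSubalgebra (Set (α → (ℕ → Bool) × I)) where
  carrier := {X | IsTame X}
  supClosed' _ hX _ hY := hX.union hY
  infClosed' X hX Y hY := by
    have := (hX.compl.union hY.compl).compl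
    rwa [← Set.compl_inter, compl_compl] at this
  compl_mem' hX := hX.compl
  bot_mem' := ⟨0, ∅, ∅, fun _ _ _ h => h⟩

theorem tameFamily_isClosed [DecidableEq α] : IsClosedFamily (tameFamily I α) where
  cyl i X hX := by
    obtain ⟨N, F, S, h⟩ := hX
    refine ⟨N, F, S.erase i, fun s s' hs hm => ?_⟩
    rw [mem_cylSet_iff] at hm ⊢
    obtain ⟨u, hu⟩ := hm
    obtain ⟨u', hu'⟩ := hs.exists_update u
    exact ⟨u', h _ _ hu' hu⟩
  sub i j X hX := hX.comp _
  swap i j X hX := hX.comp _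
  diag i j := ⟨0, ∅, {i, j}, fun s s' hs h => (((hs i (by simp)).2 j (by simp)).1).1 h⟩

theorem isTame_agree (a : ℕ) (i j : α) :
    IsTame {s : α → (ℕ → Bool) × I | Agree a (s i).1 (s j).1} := by
  classical
  exact ⟨a, ∅, {i, j}, fun s s' hs h => (((hs i (by simp)).2 j (by simp)).2 a le_rfl).1 h⟩

theorem isTame_colour (c : I) (i : α) : IsTame {s : α → (ℕ → Bool) × I | (s i).2 = c} :=
  ⟨0, {c}, {i}, fun s s' hs h => ((hs i (by simp)).1 c (by simp)).1 h⟩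

/-- Distinct entries of `s` lie on distinct branches of the tree. -/
def IsSpread (s : α → (ℕ → Bool) × I) : Prop := ∀ k l, (s k).1 = (s l).1 → s k = s l

theorem IsSpread.comp {s : α → (ℕ → Bool) × I} (h : IsSpread s) (τ : β → α) :
    IsSpread (s ∘ τ) := fun k l hkl => h (τ k) (τ l) hkl

/-- Distinct entries receive distinct tails from level `N` on, while colours and everything below
`N` are kept. Hence every nonempty tame set contains a spread sequence. -/
theorem exists_isSpread [Finite α] (N : ℕ) (F : Finset I) (S : Finset α)
    (s : α → (ℕ → Bool) × I) : ∃ s', IsSpread s' ∧ Sim N F S s s' := by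
  obtain ⟨r, hr⟩ := exists_injective_nat (Set.range s)
  let g : Set.range s → (ℕ → Bool) × I := fun m =>
    (fun b => if b < N then m.1.1 b else decide (b = N + r m), m.1.2)
  let e : α → Set.range s := fun k => ⟨s k, k, rfl⟩
  have hg : ∀ k l, (g (e k)).1 = (g (e l)).1 → s k = s l := by
    intro k l h
    have h1 := congrFun h (N + r (e k))
    simp only [g] at h1
    simp only [add_lt_iff_neg_left, not_lt_zero, if_false, decide_true, add_right_inj] at h1
    exact congrArg Subtype.val (hr (of_decide_eq_true h1.symm))
  have hag : ∀ k, Agree N (g (e k)).1 (s k).1 := fun k b hb => by simp [g, e, hb]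
  have heq : ∀ k l, s k = s l → g (e k) = g (e l) := fun k l h => congrArg g (Subtype.ext h)
  refine ⟨fun k => g (e k), fun k l h => heq k l (hg k l h), fun k _ => ⟨fun c _ => Iff.rfl,
    fun l _ => ⟨⟨heq k l, fun h => hg k l (congrArg Prod.fst h)⟩, fun a ha => ?_⟩⟩⟩
  have h1 : Agree a (g (e k)).1 (s k).1 := fun b hb => hag k b (by omega)
  have h2 : Agree a (g (e l)).1 (s l).1 := fun b hb => hag l b (by omega)
  exact ⟨fun h => h1.trans (h.trans h2.symm), fun h => h1.symm.trans (h.trans h2)⟩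

/-- The sequences that are similar to `p` at all levels. -/
def simClass (p : α → (ℕ → Bool) × I) : Set (α → (ℕ → Bool) × I) := {t | ∀ N F S, Sim N F S p t}

/-- Finitely many colours, and one level at which all pairs of distinct branches of `p` have
separated, determine the class. Entries of `p` on the same branch are equal since `p` is spread, and
equality is part of similarity, so they never separate. -/
theorem isTame_simClass [Finite α] {p : α → (ℕ → Bool) × I} (hp : IsSpread p) :
    IsTame (simClass p) := by
  classical
  have := Fintype.ofFinite α
  have hex : ∀ kl : α × α, ∃ N, (p kl.1).1 ≠ (p kl.2).1 → ¬ Agree N (p kl.1).1 (p kl.2).1 := by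
    intro kl
    by_cases h : (p kl.1).1 = (p kl.2).1
    · exact ⟨0, fun h' => absurd h h'⟩
    · obtain ⟨b, hb⟩ := Function.ne_iff.1 h
      exact ⟨b + 1, fun _ h' => hb (h' b (by omega))⟩
  choose N hN using hex
  refine ⟨Finset.univ.sup N, Finset.univ.image fun k => (p k).2, Finset.univ,
    fun s s' hs hps N' F' S' k _ => ?_⟩
  have hps' := hps (Finset.univ.sup N) (Finset.univ.image fun k => (p k).2) Finset.univ
  have hcol : ∀ k, (s' k).2 = (p k).2 := fun k =>
    ((hs k (Finset.mem_univ _)).1 _ (Finset.mem_image_of_mem _ (Finset.mem_univ k))).1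
      (((hps' k (Finset.mem_univ _)).1 _ (Finset.mem_image_of_mem _ (Finset.mem_univ k))).1 rfl)
  have heq : ∀ k l, p k = p l ↔ s' k = s' l := fun k l =>
    ((hps' k (Finset.mem_univ _)).2 l (Finset.mem_univ _)).1.trans
      ((hs k (Finset.mem_univ _)).2 l (Finset.mem_univ _)).1
  have hag : ∀ k l, ∀ a ≤ Finset.univ.sup N,
      (Agree a (p k).1 (p l).1 ↔ Agree a (s' k).1 (s' l).1) := fun k l a ha =>
    (((hps' k (Finset.mem_univ _)).2 l (Finset.mem_univ _)).2 a ha).trans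
      (((hs k (Finset.mem_univ _)).2 l (Finset.mem_univ _)).2 a ha)
  refine ⟨fun c _ => by rw [hcol], fun l _ => ⟨heq k l, fun a _ => ?_⟩⟩
  by_cases h : (p k).1 = (p l).1
  · have h1 := hp k l h
    refine iff_of_true ?_ ?_
    · rw [h]; exact fun _ _ => rfl
    · rw [(heq k l).1 h1]; exact fun _ _ => rfl
  · have hle : N (k, l) ≤ Finset.univ.sup N := Finset.le_sup (Finset.mem_univ _)
    have h1 := hN (k, l) h
    have h2 := fun e => h1 ((hag k l _ hle).2 e)
    by_cases ha : a ≤ Finset.univ.sup N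
    · exact hag k l a ha
    · exact iff_of_false (fun e => h1 fun b hb => e b (by omega))
        (fun e => h2 fun b hb => e b (by omega))

theorem mem_simClass_self (p : α → (ℕ → Bool) × I) : p ∈ simClass p :=
  fun _ _ _ => sim_of_eqOn fun _ _ => rfl

theorem IsTame.mem_iff_of_mem_simClass {X : Set (α → (ℕ → Bool) × I)} (hX : IsTame X)
    {p t : α → (ℕ → Bool) × I} (h : t ∈ simClass p) : t ∈ X ↔ p ∈ X := by
  obtain ⟨N, F, S, hX⟩ := hX
  exact ⟨hX _ _ (h N F S).symm, hX _ _ (h N F S)⟩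

theorem IsTame.exists_isSpread_mem [Finite α] {X : Set (α → (ℕ → Bool) × I)} (hX : IsTame X)
    (hne : X.Nonempty) : ∃ p ∈ X, IsSpread p := by
  obtain ⟨N, F, S, h⟩ := hX
  obtain ⟨s, hs⟩ := hne
  obtain ⟨p, hp, hsp⟩ := exists_isSpread N F S s
  exact ⟨p, h _ _ hsp hs, hp⟩

end Tame

/-! ### The neat reduct of the algebra of tame sets -/

section TameAlgebra

variable {K : Kind} {I : Type} {n : ℕ}

variable (K I) in
/-- The algebra of tame sets of sequences. -/
def tameAlg (α : Type) [DecidableEq α] : Alg.{0} K α :=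
  setAlg K (tameFamily_isClosed (I := I) (α := α))

/-- A set closed under all `c_k` with `n ≤ k` tolerates changes of finitely many coordinates beyond
`n`, and tameness makes it blind outside a finite set of coordinates. It therefore depends on the
first `n` entries only and is recovered by padding with entry `0`. -/
theorem tameAlg_mem_NrOmega [Nonempty I] (hn : 0 < n) : tameAlg K I (Fin n) ∈ NrOmega K n := by
  let f : tameAlg K I (Fin n) → tameAlg K I ℕ := fun X =>
    ⟨{s | s ∘ Fin.val ∈ X.1}, IsTame.comp X.2 _⟩
  let τ : ℕ → Fin n := fun k => if h : k < n then ⟨k, h⟩ else ⟨0, hn⟩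
  have hτ : τ ∘ Fin.val = id := by
    funext k
    simp [τ]
  refine ⟨tameAlg K I ℕ, setAlg_inK K _, f, ⟨?_, ?_, ?_, ?_, ?_, ?_, ?_⟩, ?_, ?_⟩
  · exact fun _ _ => rfl
  · exact fun _ _ => rfl
  · exact fun _ => rfl
  · rfl
  · rfl
  · rintro (i | ⟨h, i, j⟩ | ⟨h, i, j⟩) X
    · refine Subtype.ext (Set.ext fun s => ?_)
      change s ∘ Fin.val ∈ cylSet i X.1 ↔ s ∈ cylSet (i : ℕ) {s | s ∘ Fin.val ∈ X.1}
      rw [mem_cylSet_iff, mem_cylSet_iff]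
      refine exists_congr fun u => ?_
      have : Function.update s (i : ℕ) u ∘ Fin.val = Function.update (s ∘ Fin.val) i u :=
        Function.update_comp_eq_of_injective s Fin.val_injective i u
      rw [Set.mem_ofPred_eq, this]
    · refine Subtype.ext (Set.ext fun s => ?_)
      change (s ∘ Fin.val) ∘ repl i j ∈ X.1 ↔ (s ∘ repl (i : ℕ) j) ∘ Fin.val ∈ X.1
      rw [comp_repl, comp_repl]
      rw [Function.update_comp_eq_of_injective s Fin.val_injective i]
      rfl
    · refine Subtype.ext (Set.ext fun s => ?_)
      change (s ∘ Fin.val) ∘ Equiv.swap i j ∈ X.1 ↔ (s ∘ Equiv.swap (i : ℕ) j) ∘ Fin.val ∈ X.1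
      have : (Fin.val ∘ Equiv.swap i j : Fin n → ℕ) = Equiv.swap (i : ℕ) j ∘ Fin.val := by
        funext k
        simp only [Function.comp_apply, Equiv.swap_apply_def, Fin.ext_iff]
        split_ifs <;> rfl
      rw [Function.comp_assoc, this, Function.comp_assoc]
  · rintro ⟨h, i, j⟩
    rfl
  · intro X Y h
    refine Subtype.ext (Set.ext fun s => ?_)
    have := Set.ext_iff.1 (congrArg Subtype.val h) (s ∘ τ)
    change (s ∘ τ) ∘ Fin.val ∈ X.1 ↔ (s ∘ τ) ∘ Fin.val ∈ Y.1 at this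
    rwa [Function.comp_assoc, hτ] at this
  · refine Set.Subset.antisymm ?_ ?_
    · rintro _ ⟨X, rfl⟩ k hk
      refine Subtype.ext (Set.ext fun s => ?_)
      change s ∈ cylSet k {s | s ∘ Fin.val ∈ X.1} ↔ s ∘ Fin.val ∈ X.1
      rw [mem_cylSet_iff]
      have : ∀ u, Function.update s k u ∘ (Fin.val : Fin n → ℕ) = s ∘ Fin.val := by
        intro u
        funext i
        have := i.2
        exact Function.update_of_ne (by omega) _ _
      simp only [Set.mem_ofPred_eq, this]
      exact exists_const _
    · intro X hX
      have hupd : ∀ k, n ≤ k → ∀ s u, s ∈ X.1 → Function.update s k u ∈ X.1 := by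
        intro k hk s u hs
        have h1 := congrArg Subtype.val (hX k hk)
        change cylSet k X.1 = X.1 at h1
        rw [← h1, mem_cylSet_iff]
        exact ⟨s k, by simpa using hs⟩
      have hind : ∀ s s', (∀ k < n, s k = s' k) → s ∈ X.1 → s' ∈ X.1 := by
        intro s s' h hs
        obtain ⟨N, F, S, hS⟩ := X.2
        have key : ∀ T : Finset ℕ, T.piecewise s' s ∈ X.1 := by
          intro T
          induction T using Finset.induction_on with
          | empty => simpa using hs
          | insert k T hk ih =>
            rw [Finset.piecewise_insert]
            by_cases hkn : k < n
            · rw [← h k hkn, ← Finset.piecewise_eq_of_notMem T s' s hk, Function.update_eq_self]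
              exact ih
            · exact hupd k (by omega) _ _ ih
        exact hS _ _ (sim_of_eqOn fun k hk => Finset.piecewise_eq_of_mem _ _ _ hk) (key S)
      refine ⟨⟨{t | t ∘ τ ∈ X.1}, IsTame.comp X.2 τ⟩, Subtype.ext (Set.ext fun s => ?_)⟩
      change (s ∘ Fin.val) ∘ τ ∈ X.1 ↔ s ∈ X.1
      have hs : ∀ k < n, ((s ∘ Fin.val) ∘ τ) k = s k := fun k hk => by simp [τ, hk]
      exact ⟨hind _ _ hs, hind _ _ fun k hk => (hs k hk).symm⟩

theorem uncountable_tameAlg [Uncountable I] (hn : 0 < n) : Uncountable (tameAlg K I (Fin n)) := by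
  let g : I → tameAlg K I (Fin n) := fun c => ⟨_, isTame_colour c ⟨0, hn⟩⟩
  refine Function.Injective.uncountable (f := g) fun c d h => ?_
  have := Set.ext_iff.1 (congrArg Subtype.val h) fun _ => (fun _ => false, c)
  exact this.1 rfl

/-- The atom of a spread sequence. -/
def simAtom (K : Kind) {p : Fin n → (ℕ → Bool) × I} (hp : IsSpread p) : tameAlg K I (Fin n) :=
  ⟨simClass p, isTame_simClass hp⟩

theorem simAtom_le_iff {p : Fin n → (ℕ → Bool) × I} (hp : IsSpread p) {X : tameAlg K I (Fin n)} :
    simAtom K hp ≤ X ↔ p ∈ X.1 :=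
  ⟨fun h => h (mem_simClass_self p), fun h _ ht => (X.2.mem_iff_of_mem_simClass ht).2 h⟩

theorem exists_isSpread_mem_of_ne_bot {X : tameAlg K I (Fin n)} (hX : X ≠ ⊥) :
    ∃ p ∈ X.1, IsSpread p :=
  X.2.exists_isSpread_mem (exists_mem_of_ne_bot _ hX)

theorem isAtom_simAtom {p : Fin n → (ℕ → Bool) × I} (hp : IsSpread p) :
    IsAtom (simAtom K hp) := by
  refine ⟨fun h => ?_, fun X hX => ?_⟩
  · have : p ∈ (⊥ : tameAlg K I (Fin n)).1 := h ▸ mem_simClass_self p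
    exact this
  · by_contra hne
    obtain ⟨t, ht⟩ := exists_mem_of_ne_bot _ hne
    exact hX.not_ge ((simAtom_le_iff hp).2 ((X.2.mem_iff_of_mem_simClass (hX.le ht)).1 ht))

theorem isAtomic_tameAlg : IsAtomic (tameAlg K I (Fin n)) := ⟨fun X => by
  by_cases h : X = ⊥
  · exact Or.inl h
  · obtain ⟨p, hp, hsp⟩ := exists_isSpread_mem_of_ne_bot h
    exact Or.inr ⟨_, isAtom_simAtom hsp, (simAtom_le_iff hsp).2 hp⟩⟩

/-- By self-conjugacy `c_i x ≤ b` is equivalent to `x ≤ (c_i bᶜ)ᶜ`, so `c_i` is a left adjoint. -/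
theorem isLUB_cyl {α : Type} {A : Alg.{u} K α} (hA : A.CylLaws) (i : α) {X : Set A} {s : A}
    (h : IsLUB X s) : IsLUB (A.cyl i '' X) (A.cyl i s) := by
  refine ⟨?_, fun b hb => ?_⟩
  · rintro _ ⟨x, hx, rfl⟩
    exact hA.cyl_mono i (h.1 hx)
  · have h1 : s ≤ (A.cyl i bᶜ)ᶜ := h.2 fun x hx => by
      rw [le_compl_iff_disjoint_left, disjoint_iff, ← hA.inf_cyl_eq_bot, ← disjoint_iff,
        disjoint_compl_left_iff]
      exact hb ⟨x, hx, rfl⟩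
    rwa [le_compl_iff_disjoint_left, disjoint_iff, ← hA.inf_cyl_eq_bot, ← disjoint_iff,
        disjoint_compl_left_iff] at h1

/-- Joins here need not be unions, but they are unions at spread sequences, because these have
atoms. -/
theorem exists_mem_of_isLUB {X : Set (tameAlg K I (Fin n))} {s : tameAlg K I (Fin n)}
    (h : IsLUB X s) {p : Fin n → (ℕ → Bool) × I} (hp : IsSpread p) (hps : p ∈ s.1) :
    ∃ x ∈ X, p ∈ x.1 := by
  by_contra! hne
  have h1 : s ≤ (simAtom K hp)ᶜ := h.2 fun x hx => by
    rw [le_compl_iff_disjoint_left, ← (isAtom_simAtom hp).not_le_iff_disjoint, simAtom_le_iff]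
    exact hne x hx
  exact h1 hps (mem_simClass_self p)

/-- Substitutions map spread sequences to spread sequences, so their additivity can be tested there.
Cylindrifiers are completely additive anyway. -/
theorem completelyAdditive_tameAlg : (tameAlg K I (Fin n)).CompletelyAdditive := by
  have key : ∀ (o : UnOp K (Fin n)) (τ : Fin n → Fin n),
      (∀ X : tameAlg K I (Fin n), ((tameAlg K I (Fin n)).un o X).1 = {s | s ∘ τ ∈ X.1}) →
      ∀ (X : Set (tameAlg K I (Fin n))) s, IsLUB X s →
        IsLUB ((tameAlg K I (Fin n)).un o '' X) ((tameAlg K I (Fin n)).un o s) := by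
    intro o τ ho X s h
    refine ⟨?_, fun b hb => ?_⟩
    · rintro _ ⟨x, hx, rfl⟩
      change ((tameAlg K I (Fin n)).un o x).1 ⊆ ((tameAlg K I (Fin n)).un o s).1
      rw [ho, ho]
      exact fun t ht => h.1 hx ht
    · by_contra hne
      rw [← disjoint_compl_right_iff, disjoint_iff] at hne
      obtain ⟨p, hp, hsp⟩ := exists_isSpread_mem_of_ne_bot hne
      have hp1 : p ∈ ((tameAlg K I (Fin n)).un o s).1 := hp.1
      rw [ho] at hp1
      obtain ⟨x, hx, hpx⟩ := exists_mem_of_isLUB h (hsp.comp τ) hp1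
      have : p ∈ ((tameAlg K I (Fin n)).un o x).1 := by rw [ho]; exact hpx
      exact hp.2 (hb ⟨x, hx, rfl⟩ this)
  rintro (i | ⟨h, i, j⟩ | ⟨h, i, j⟩) X s hX
  · exact isLUB_cyl (setAlg_inK K _).substLaws.toCylLaws i hX
  · exact key _ (repl i j) (fun X => rfl) X s hX
  · exact key _ (Equiv.swap i j) (fun X => rfl) X s hX

end TameAlgebra

/-! ### The algebra of tame sets has no complete representation -/

section NotCompletelyRepresentable

/-- A set whose points are separated by a binary splitting sequence of equivalence relations
injects into the power set of `ℕ`. -/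
theorem exists_injective_of_splitting {V I : Type} (z : I → V) (R : ℕ → V → V → Prop)
    (hrefl : ∀ a u, R a u u) (heucl : ∀ a u v w, R a u v → R a u w → R a v w)
    (hzero : ∀ u v, R 0 u v)
    (hsplit : ∀ a u v w, R a u v → R a u w → R (a + 1) u v ∨ R (a + 1) u w ∨ R (a + 1) v w)
    (hsep : ∀ c d, c ≠ d → ∃ a, ¬ R a (z c) (z d)) :
    ∃ f : I → Set ℕ, Function.Injective f := by
  classical
  have hsymm : ∀ a u v, R a u v → R a v u := fun a u v h => heucl a u v u h (hrefl a u)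
  let r : ℕ → Setoid V := fun a =>
    ⟨R a, hrefl a, fun {u v} h => hsymm a u v h, fun {u v w} h h' =>
      heucl a v u w (hsymm a u v h) h'⟩
  let p : ℕ → V → V := fun a u => (Quotient.mk (r a) u).out
  have hp : ∀ a u, R a (p a u) u := fun a u => Quotient.mk_out (s := r a) u
  -- The code of `c` records at each level whether `z c` stays with the representative of its class
  -- when the class splits. At the first level where two points separate, exactly one of them stays.
  refine ⟨fun c => {a | R (a + 1) (p a (z c)) (z c)}, fun c d h => ?_⟩
  by_contra hne
  have hex := hsep c d hne
  obtain ⟨a, ha⟩ : ∃ a, Nat.find hex = a + 1 :=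
    Nat.exists_eq_succ_of_ne_zero fun e => Nat.find_spec hex (by rw [e]; exact hzero _ _)
  have h1 : ¬ R (a + 1) (z c) (z d) := ha ▸ Nat.find_spec hex
  have h2 : R a (z c) (z d) := not_not.1 (Nat.find_min hex (by omega : a < Nat.find hex))
  have h3 : p a (z c) = p a (z d) := congrArg Quotient.out (Quotient.sound (s := r a) h2)
  have h4 : R (a + 1) (p a (z c)) (z c) ↔ R (a + 1) (p a (z d)) (z d) := Set.ext_iff.1 h a
  rw [← h3] at h4
  by_cases h5 : R (a + 1) (p a (z c)) (z c)
  · exact h1 (heucl _ _ _ _ h5 (h4.1 h5))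
  · rcases hsplit a _ _ _ (hp a (z c)) (h3 ▸ hp a (z d)) with h6 | h6 | h6
    · exact h5 h6
    · exact h5 (h4.2 h6)
    · exact h1 h6

theorem genSetAlg_subst {K : Kind} {α : Type} [DecidableEq α] {M J : Type u} (U : J → Set M)
    (i j : α) (X : genSetAlg K α U) : (genSetAlg K α U).subst i j X =
      {s : genSpace α U | (X : Set (genSpace α U)) (genSpace.comp s (repl i j))} := by
  unfold Alg.subst
  split_ifs with h1 h2 h3
  · rfl
  · subst h3
    simp only [repl_self]
    rfl
  · refine Set.ext fun s => ⟨?_, fun hs => ?_⟩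
    · rintro ⟨t, ⟨h, ht⟩, hts⟩
      have e : genSpace.comp s (repl i j) = t := by
        refine Subtype.ext ?_
        change s.1 ∘ repl i j = t.1
        rw [comp_repl]
        funext k
        by_cases hk : k = i
        · subst hk
          rw [Function.update_self, show t.1 k = t.1 j from h, hts j (Ne.symm h3)]
        · rw [Function.update_of_ne hk, hts k hk]
      change (X : Set (genSpace α U)) (genSpace.comp s (repl i j))
      rwa [e]
    · refine ⟨genSpace.comp s (repl i j), ⟨?_, hs⟩, fun k hk => by
        change s.1 (repl i j k) = s.1 k
        rw [repl_apply_of_ne hk]⟩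
      change s.1 (repl i j i) = s.1 (repl i j j)
      rw [repl_apply_self, repl_apply_of_ne (Ne.symm h3)]
  · exact absurd h2 (by cases K <;> simp_all [Kind.hasSub, Kind.hasDiag])

variable {K : Kind}

/-- A component of a complete representation, given by its satisfaction relation. -/
structure IsCompleteModel {α : Type} [DecidableEq α] (A : Alg.{u} K α) {V : Type u}
    (G : (α → V) → A → Prop) : Prop where
  inf : ∀ s x y, G s (x ⊓ y) ↔ G s x ∧ G s y
  compl : ∀ s x, G s xᶜ ↔ ¬ G s x
  cyl : ∀ s i x, G s (A.cyl i x) ↔ ∃ u, G (Function.update s i u) x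
  subst : ∀ s i j x, G s (A.subst i j x) ↔ G (s ∘ repl i j) x
  omits : ∀ X : Set A, IsGLB X ⊥ → ∀ s, ∃ x ∈ X, ¬ G s x

/-- One base of the generalized space is enough. A witness for `c_i` shares a coordinate other than
`i` with the given sequence, so by disjointness it stays in that base; this is why there must be two
dimensions. -/
theorem exists_isCompleteModel {α : Type} [DecidableEq α] [Nontrivial α] {A : Alg.{u} K α}
    (hA : A ∈ CRK K α) :
    ∃ (V : Type u) (_ : Nonempty V) (G : (α → V) → A → Prop), IsCompleteModel A G := by
  obtain ⟨M, J, U, ⟨κ⟩, hne, hdisj, f, hf, -, hmeet⟩ := hA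
  let pt : (α → U κ) → genSpace α U := fun s => ⟨fun k => s k, κ, fun k => (s k).2⟩
  refine ⟨U κ, (hne κ).to_subtype, fun s x => pt s ∈ f x, ⟨fun s x y => ?_, fun s x => ?_,
    fun s i x => ⟨?_, ?_⟩, fun s i j x => ?_, fun X hX s => ?_⟩⟩
  · rw [hf.map_inf]
    rfl
  · rw [hf.map_compl]
    rfl
  · intro h
    rw [hf.map_cyl] at h
    obtain ⟨t, ht, hts⟩ := h
    obtain ⟨κ', hκ'⟩ := t.2
    obtain ⟨j, hj⟩ := exists_ne i
    have hκ : κ' = κ := by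
      by_contra hne
      have h1 := hκ' j
      rw [hts j hj] at h1
      exact Set.disjoint_left.1 (hdisj _ _ hne) h1 (s j).2
    subst hκ
    refine ⟨⟨t.1 i, hκ' i⟩, ?_⟩
    have : pt (Function.update s i ⟨t.1 i, hκ' i⟩) = t := by
      refine Subtype.ext (funext fun k => ?_)
      by_cases hk : k = i
      · subst hk
        simp [pt]
      · simp only [pt, Function.update_of_ne hk]
        exact (hts k hk).symm
    rwa [this]
  · rintro ⟨u, hu⟩
    rw [hf.map_cyl]
    exact ⟨_, hu, fun k hk => by simp [pt, Function.update_of_ne hk]⟩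
  · rw [hf.map_subst]
    exact Set.ext_iff.1 (genSetAlg_subst U i j (f x)) (pt s)
  · by_contra! h
    have h1 : pt s ∈ f ⊥ := by
      rw [hmeet X ⊥ hX]
      exact Set.mem_iInter₂.2 h
    rw [hf.map_bot] at h1
    exact h1

namespace IsCompleteModel

variable {α : Type} [DecidableEq α] {A : Alg.{u} K α} {V : Type u} {G : (α → V) → A → Prop}
  (hG : IsCompleteModel A G)
include hG

theorem mono {s : α → V} {x y : A} (h : x ≤ y) (hx : G s x) : G s y := by
  rw [← inf_eq_left.2 h, hG.inf] at hx
  exact hx.2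

theorem top (s : α → V) : G s ⊤ := by
  obtain ⟨x, -, hx⟩ := hG.omits {⊥} isGLB_singleton s
  exact hG.mono le_top ((hG.compl s x).2 hx)

theorem sup (s : α → V) (x y : A) : G s (x ⊔ y) ↔ G s x ∨ G s y := by
  rw [← compl_compl (x ⊔ y), compl_sup, hG.compl, hG.inf, hG.compl, hG.compl]
  tauto

theorem congr [Finite α] {s s' : α → V} {x : A} (h : ∀ k, s k = s' k ∨ A.cyl k x = x)
    (hs : G s x) : G s' x := by
  have := Fintype.ofFinite α
  have key : ∀ T : Finset α, G (T.piecewise s' s) x := by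
    intro T
    induction T using Finset.induction_on with
    | empty => simpa using hs
    | insert k T hk ih =>
      rw [Finset.piecewise_insert]
      rcases h k with h | h
      · rwa [← h, ← Finset.piecewise_eq_of_notMem T s' s hk, Function.update_eq_self]
      · rw [← h, hG.cyl]
        exact ⟨_, by rwa [Function.update_idem, Function.update_eq_self]⟩
  simpa using key Finset.univ

end IsCompleteModel

/-! ### Tree relations and colours in a complete model -/

variable {I : Type} {n : ℕ}

theorem cyl_tameAlg_eq_self {k : Fin n} {X : tameAlg K I (Fin n)}
    (h : ∀ s u, Function.update s k u ∈ X.1 → s ∈ X.1) :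
    (tameAlg K I (Fin n)).cyl k X = X := by
  refine Subtype.ext (Set.ext fun s => ?_)
  change s ∈ cylSet k X.1 ↔ _
  rw [mem_cylSet_iff]
  exact ⟨fun ⟨u, hu⟩ => h s u hu, fun hs => ⟨s k, by rwa [Function.update_eq_self]⟩⟩

theorem mem_subst_tameAlg {i j : Fin n} {X : tameAlg K I (Fin n)}
    {s : Fin n → (ℕ → Bool) × I} :
    s ∈ ((tameAlg K I (Fin n)).subst i j X).1 ↔ s ∘ repl i j ∈ X.1 :=
  Set.ext_iff.1 (setAlg_subst tameFamily_isClosed i j X) s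

/-- By atomicity the complements of the atoms have meet `⊥`, and a complete model omits this meet,
so every tuple satisfies some atom. -/
theorem IsCompleteModel.exists_simAtom {V : Type} {G : (Fin n → V) → tameAlg K I (Fin n) → Prop}
    (hG : IsCompleteModel _ G) (s : Fin n → V) :
    ∃ p : Fin n → (ℕ → Bool) × I, IsSpread p ∧ ∀ X, G s X ↔ p ∈ X.1 := by
  obtain ⟨_, ⟨p, hp, rfl⟩, h⟩ := hG.omits
    {X | ∃ (p : Fin n → (ℕ → Bool) × I) (hp : IsSpread p), X = (simAtom K hp)ᶜ}
    ⟨fun _ _ => bot_le, fun b hb => by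
      by_contra hne
      obtain ⟨p, hpb, hp⟩ := exists_isSpread_mem_of_ne_bot (fun h => hne h.le)
      exact hb ⟨p, hp, rfl⟩ hpb (mem_simClass_self p)⟩ s
  rw [hG.compl, not_not] at h
  refine ⟨p, hp, fun X => ⟨fun hX => ?_, fun hX => hG.mono ((simAtom_le_iff hp).2 hX) h⟩⟩
  by_contra hpX
  have h1 : simAtom K hp ≤ Xᶜ := (simAtom_le_iff hp).2 hpX
  exact (hG.compl s X).1 (hG.mono h1 h) hX

/-- Agreement up to level `a` defines in the model an equivalence relation whose classes split into
at most two at the next level. Each colour is realised by a point, and points of different colours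
separate at a finite level. Three coordinates are needed to express transitivity and the splitting.
-/
theorem exists_injective_of_tameAlg_mem_CRK (hn : 2 < n) (h : tameAlg K I (Fin n) ∈ CRK K (Fin n)) :
    ∃ f : I → Set ℕ, Function.Injective f := by
  have : Nontrivial (Fin n) := Fin.nontrivial_iff_two_le.2 (by omega)
  obtain ⟨V, ⟨v₀⟩, G, hG⟩ := exists_isCompleteModel h
  obtain ⟨i, j, k, hij, hik, hjk⟩ : ∃ i j k : Fin n, i ≠ j ∧ i ≠ k ∧ j ≠ k :=
    ⟨⟨0, by omega⟩, ⟨1, by omega⟩, ⟨2, hn⟩, by simp [Fin.ext_iff]⟩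
  let E : ℕ → tameAlg K I (Fin n) := fun a => ⟨_, isTame_agree a i j⟩
  let P : I → tameAlg K I (Fin n) := fun c => ⟨_, isTame_colour c i⟩
  have hE : ∀ a s, s ∈ (E a).1 ↔ Agree a (s i).1 (s j).1 := fun _ _ => Iff.rfl
  have hP : ∀ c s, s ∈ (P c).1 ↔ (s i).2 = c := fun _ _ => Iff.rfl
  let q : V → V → V → Fin n → V := fun u v w l => if l = i then u else if l = j then v else w
  have hqi : ∀ u v w, q u v w i = u := fun u v w => if_pos rfl
  have hqj : ∀ u v w, q u v w j = v := fun u v w => by simp [q, hij.symm]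
  have hqk : ∀ u v w, q u v w k = w := fun u v w => by simp [q, hik.symm, hjk.symm]
  let R : ℕ → V → V → Prop := fun a u v => G (q u v v) (E a)
  have hR : ∀ a s, G s (E a) ↔ R a (s i) (s j) := by
    have hcyl : ∀ a l, l ≠ i → l ≠ j → (tameAlg K I (Fin n)).cyl l (E a) = E a :=
      fun a l hi hj => cyl_tameAlg_eq_self fun s u hu => by
        rwa [hE, Function.update_of_ne hi.symm, Function.update_of_ne hj.symm] at hu
    have hor : ∀ a (s : Fin n → V) l, s l = q (s i) (s j) (s j) l ∨ (tameAlg K I (Fin n)).cyl l (E a) = E a := by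
      intro a s l
      by_cases hi : l = i
      · exact Or.inl (by rw [hi, hqi])
      · by_cases hj : l = j
        · exact Or.inl (by rw [hj, hqj])
        · exact Or.inr (hcyl a l hi hj)
    exact fun a s => ⟨hG.congr (hor a s), hG.congr fun l => (hor a s l).imp_left Eq.symm⟩
  -- `E'` and `E''` are agreement of the coordinates `i, k` and `j, k`, obtained from `E` by
  -- replacements.
  let E' : ℕ → tameAlg K I (Fin n) := fun a => (tameAlg K I (Fin n)).subst j k (E a)
  let E'' : ℕ → tameAlg K I (Fin n) := fun a => (tameAlg K I (Fin n)).subst i j (E' a)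
  have hR' : ∀ a s, G s (E' a) ↔ R a (s i) (s k) := fun a s => by
    rw [hG.subst, hR, Function.comp_apply, Function.comp_apply, repl_apply_self,
      repl_apply_of_ne hij]
  have hR'' : ∀ a s, G s (E'' a) ↔ R a (s j) (s k) := fun a s => by
    rw [hG.subst, hR', Function.comp_apply, Function.comp_apply, repl_apply_self,
      repl_apply_of_ne hik.symm]
  have hE' : ∀ a s, s ∈ (E' a).1 ↔ Agree a (s i).1 (s k).1 := fun a s => by
    rw [mem_subst_tameAlg, hE, Function.comp_apply, Function.comp_apply, repl_apply_self,
      repl_apply_of_ne hij]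
  have hE'' : ∀ a s, s ∈ (E'' a).1 ↔ Agree a (s j).1 (s k).1 := fun a s => by
    rw [mem_subst_tameAlg, hE', Function.comp_apply, Function.comp_apply, repl_apply_self,
      repl_apply_of_ne hik.symm]
  have hz : ∀ c, ∃ z, ∀ s : Fin n → V, s i = z → G s (P c) := by
    intro c
    have htop : (tameAlg K I (Fin n)).cyl i (P c) = ⊤ := Subtype.ext (Set.ext fun s =>
      iff_of_true (mem_cylSet_iff.2 ⟨(fun _ => false, c), by simp [P]⟩) trivial)
    obtain ⟨z, hz⟩ := (hG.cyl (fun _ => v₀) i (P c)).1 (htop ▸ hG.top _)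
    refine ⟨z, fun s hs => hG.congr (fun l => ?_) hz⟩
    by_cases hl : l = i
    · subst hl
      exact Or.inl (by rw [Function.update_self, hs])
    · exact Or.inr (cyl_tameAlg_eq_self fun s u hu => by
        rwa [hP, Function.update_of_ne (Ne.symm hl)] at hu)
  choose z hz using hz
  refine exists_injective_of_splitting z R (fun a u => ?_) (fun a u v w h1 h2 => ?_)
    (fun u v => ?_) (fun a u v w h1 h2 => ?_) fun c d hcd => ?_
  · have h1 := (hR a (q u u u ∘ repl i j)).1
    rw [Function.comp_apply, Function.comp_apply, repl_apply_self, repl_apply_of_ne hij.symm,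
      hqj] at h1
    refine h1 ?_
    rw [← hG.subst]
    refine hG.mono (fun s _ => ?_) (hG.top _)
    rw [mem_subst_tameAlg, hE, Function.comp_apply, Function.comp_apply, repl_apply_self,
      repl_apply_of_ne hij.symm]
    exact fun _ _ => rfl
  · have h3 : E a ⊓ E' a ≤ E'' a := fun s hs =>
      (hE'' a s).2 (((hE a s).1 hs.1).symm.trans ((hE' a s).1 hs.2))
    have h4 := hG.mono (s := q u v w) h3
    rwa [hG.inf, hR, hR', hR'', hqi, hqj, hqk, and_imp, forall_prop_of_true h1,
      forall_prop_of_true h2] at h4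
  · have h1 : (⊤ : tameAlg K I (Fin n)) ≤ E 0 := fun s _ => (hE 0 s).2 fun b hb => by omega
    exact hG.mono h1 (hG.top _)
  · have h3 : E a ⊓ E' a ≤ E (a + 1) ⊔ (E' (a + 1) ⊔ E'' (a + 1)) := by
      intro s hs
      have h4 := (hE a s).1 hs.1
      have h5 := (hE' a s).1 hs.2
      change s ∈ (E (a + 1)).1 ∨ s ∈ (E' (a + 1)).1 ∨ s ∈ (E'' (a + 1)).1
      rw [hE, hE', hE'', agree_succ, agree_succ, agree_succ, and_iff_right h4, and_iff_right h5,
        and_iff_right (h4.symm.trans h5)]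
      generalize (s i).1 a = b1, (s j).1 a = b2, (s k).1 a = b3
      revert b1 b2 b3
      decide
    have h4 := hG.mono (s := q u v w) h3
    rwa [hG.inf, hG.sup, hG.sup, hR, hR', hR, hR', hR'', hqi, hqj, hqk, and_imp,
      forall_prop_of_true h1, forall_prop_of_true h2] at h4
  -- The pair of points satisfies the atom of a spread sequence `p`. Its entries at `i` and `j` have
  -- different colours, hence lie on different branches. Without completeness the points could agree
  -- at every level.
  · obtain ⟨p, hsp, hp⟩ := hG.exists_simAtom (q (z c) (z d) (z d))
    have h1 : (p i).2 = c := (hp (P c)).1 (hz c _ (hqi _ _ _))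
    have h2 := (hp ((tameAlg K I (Fin n)).subst i j (P d))).1 ((hG.subst _ _ _ _).2 (hz d _ (by
      rw [Function.comp_apply, repl_apply_self, hqj])))
    rw [mem_subst_tameAlg, hP, Function.comp_apply, repl_apply_self] at h2
    have h3 : (p i).1 ≠ (p j).1 := fun e => hcd (by rw [← h1, ← h2, hsp i j e])
    obtain ⟨b, hb⟩ := Function.ne_iff.1 h3
    exact ⟨b + 1, fun h => hb ((hE _ _).1 ((hp _).1 h) b (by omega))⟩

theorem uncountable_set_set_nat : Uncountable (Set (Set ℕ)) := by
  refine uncountable_iff_not_countable _ |>.2 fun h => ?_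
  obtain ⟨g, hg⟩ := exists_injective_nat (Set (Set ℕ))
  exact Function.cantor_injective _ (Set.singleton_injective.comp hg)

theorem exists_mem_NrOmega_not_mem_CRK (K : Kind) {n : ℕ} (hn : 2 < n) :
    ∃ A : Alg.{0} K (Fin n), A ∈ NrOmega K n ∧ Uncountable A ∧ IsAtomic A ∧
      A.CompletelyAdditive ∧ A ∉ CRK K (Fin n) := by
  have := uncountable_set_set_nat
  refine ⟨tameAlg K (Set (Set ℕ)) (Fin n), tameAlg_mem_NrOmega (by omega),
    uncountable_tameAlg (by omega), isAtomic_tameAlg, completelyAdditive_tameAlg, fun h => ?_⟩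
  obtain ⟨f, hf⟩ := exists_injective_of_tameAlg_mem_CRK hn h
  exact Function.cantor_injective f hf

end NotCompletelyRepresentable

end AlgLogic

theorem mainTheorem5 (K : AlgLogic.Kind) :
    (∀ n : ℕ, 2 < n → ∃ A : AlgLogic.Alg.{0} K (Fin n),
      A ∈ AlgLogic.NrOmega K n ∧ Uncountable A ∧ IsAtomic A ∧ A.CompletelyAdditive ∧
        A ∉ AlgLogic.CRK K (Fin n)) ∧
    (∀ n : ℕ, 1 < n → ∃ A : AlgLogic.Alg.{0} K (Fin n),
      A ∈ AlgLogic.CRK K (Fin n) ∧ Countable A ∧ AlgLogic.StronglyRepresentable A ∧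
        A ∉ AlgLogic.NrOmega K n ∧
        A ∉ AlgLogic.Up (AlgLogic.Ur (AlgLogic.NrOmega K n))) ∧
    (∀ (n : ℕ) (A : AlgLogic.Alg.{u} K (Fin n)),
      A ∈ AlgLogic.CompleteSub (AlgLogic.NrOmega K n) → IsAtomic A → A.CompletelyAdditive →
        AlgLogic.StronglyRepresentable A) := by
  exact ⟨fun _ hn => AlgLogic.exists_mem_NrOmega_not_mem_CRK K hn,
    fun _ hn => AlgLogic.exists_CRK_not_mem_Up_Ur_NrOmega K hn,
    fun _ _ hA hat hca => AlgLogic.stronglyRepresentable_of_completeSub hA hat hca⟩
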